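/- Let $S$ be a scheme, let $G$ be a finite abelian group, let $Q$ be a commutative $S$-group scheme and let $M$ be a sub-$S$-semigroup scheme of $Q$ (not necessarily containing the identity), i.e. an $S$-scheme $M$ with a monomorphism $\iota : M \to Q$ of $S$-schemes and a morphism $m_M : M\times_S M \to M$ such that $\iota\circ m_M = m_Q\circ(\iota\times\iota)$, where $m_Q$ is the multiplication of $Q$. Assume that $M$ is flat over $S$ and that the morphism $$\rho : M \times_S M \to Q,\qquad (x,y) \mapsto xy^{-1}$$ is faithfully flat and quasi-compact. Then the restriction functor $$\mathrm{Tors}^{\otimes}(Q,G) \to \mathrm{Tors}^{\otimes}(M,G),\qquad P \mapsto P\times_Q M,$$ is an equivalence of categories. Here all torsors are taken in the big étale topos $E$ of $S$ (sheaves of sets for the étale topology on the category of $S$-schemes), $G$ being viewed as a constant sheaf and $S$-schemes as the sheaves they represent. A $G$-torsor over an object $X$ of $E$ is an object $P$ of $E$ over $X$ with an action of $G$ over $X$ such that $P \to X$ is an epimorphism and $G \times P \to P \times_X P$, $(g,p) \mapsto (gp,p)$, is an isomorphism. The product of two $G$-torsors over $X$ is $P_1 \otimes P_2 = G_2 \backslash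 (P_1 \times_X P_2)$, where $G_2 = \ker(G \times G \to G)$ is the kernel of the multiplication, acting diagonally. For a commutative semigroup $N$ of $E$ (with or without identity) with multiplication $m : N \times N \to N$ and projections $p_1, p_2 : N \times N \to N$, a multiplicative $G$-torsor over $N$ is a $G$-torsor $P$ over $N$ with an isomorphism $\theta : p_1^{-1}P \otimes p_2^{-1}P \to m^{-1}P$ of $G$-torsors over $N \times N$ that is symmetric, $\theta(p \otimes q) = \theta(q \otimes p)$, and associative, $\theta(\theta(p \otimes q) \otimes r) = \theta(p \otimes \theta(q \otimes r))$, for all local sections $p,q,r$ of $P$. The category $\mathrm{Tors}^{\otimes}(N,G)$ has the multiplicative $G$-torsors over $N$ as objects and the morphisms of $G$-torsors over $N$ compatible with the isomorphisms $\theta$ as morphisms. -/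

import Mathlib

open CategoryTheory Opposite

namespace MultTors

section Site

universe v u

variable {C : Type u} [Category.{v} C] {J : GrothendieckTopology C}

/-! ### Products, fibre products and semigroups in the topos of sheaves of sets -/

/-- The product `X × Y` of two sheaves of sets, with sections `X(T) × Y(T)`. -/
def prodSheaf (X Y : Sheaf J (Type (max u v))) : Sheaf J (Type (max u v)) where
  obj :=
    { obj := fun T => X.obj.obj T × Y.obj.obj T
      map := fun f => ↾fun s => (X.obj.map f s.1, Y.obj.map f s.2) }
  property := by
    rw [isSheaf_iff_isSheaf_of_type]
    have hX := (isSheaf_iff_isSheaf_of_type J _).1 X.property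
    have hY := (isSheaf_iff_isSheaf_of_type J _).1 Y.property
    intro T R hR x hx
    have hx1 : Presieve.FamilyOfElements.Compatible (P := X.obj) (R := R.arrows)
        (fun U f hf => (x f hf).1) := fun U₁ U₂ W g₁ g₂ f₁ f₂ h₁ h₂ e =>
      congrArg Prod.fst (hx g₁ g₂ h₁ h₂ e)
    have hx2 : Presieve.FamilyOfElements.Compatible (P := Y.obj) (R := R.arrows)
        (fun U f hf => (x f hf).2) := fun U₁ U₂ W g₁ g₂ f₁ f₂ h₁ h₂ e =>
      congrArg Prod.snd (hx g₁ g₂ h₁ h₂ e)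
    refine ⟨((hX R hR).amalgamate _ hx1, (hY R hR).amalgamate _ hx2), ?_, ?_⟩
    · intro U f hf
      exact Prod.ext ((hX R hR).valid_glue hx1 f hf) ((hY R hR).valid_glue hx2 f hf)
    · intro t ht
      refine Prod.ext ?_ ?_
      · refine (hX R hR).isSeparatedFor.ext fun U f hf => ?_
        exact (congrArg Prod.fst (ht f hf)).trans ((hX R hR).valid_glue hx1 f hf).symm
      · refine (hY R hR).isSeparatedFor.ext fun U f hf => ?_
        exact (congrArg Prod.snd (ht f hf)).trans ((hY R hR).valid_glue hx2 f hf).symm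

/-- The first projection `X × Y ⟶ X`. -/
def prodFst (X Y : Sheaf J (Type (max u v))) : prodSheaf X Y ⟶ X :=
  ObjectProperty.homMk { app := fun _ => ↾Prod.fst }

/-- The second projection `X × Y ⟶ Y`. -/
def prodSnd (X Y : Sheaf J (Type (max u v))) : prodSheaf X Y ⟶ Y :=
  ObjectProperty.homMk { app := fun _ => ↾Prod.snd }

/-- The fibre product `P ×_X Y` of sheaves of sets, with sections the pairs `(p, y)` in
`P(T) × Y(T)` having the same image in `X(T)`. -/
def fiberSheaf {P X Y : Sheaf J (Type (max u v))} (a : P ⟶ X) (b : Y ⟶ X) :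
    Sheaf J (Type (max u v)) where
  obj :=
    { obj := fun T => { s : P.obj.obj T × Y.obj.obj T // a.hom.app T s.1 = b.hom.app T s.2 }
      map := fun {T T'} f => ↾fun s => ⟨(P.obj.map f s.1.1, Y.obj.map f s.1.2), by
        rw [NatTrans.naturality_apply, NatTrans.naturality_apply, s.2]⟩ }
  property := by
    rw [isSheaf_iff_isSheaf_of_type]
    have hP := (isSheaf_iff_isSheaf_of_type J _).1 P.property
    have hX := (isSheaf_iff_isSheaf_of_type J _).1 X.property
    have hY := (isSheaf_iff_isSheaf_of_type J _).1 Y.property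
    intro T R hR x hx
    have hx1 : Presieve.FamilyOfElements.Compatible (P := P.obj) (R := R.arrows)
        (fun U f hf => (x f hf).1.1) := fun U₁ U₂ W g₁ g₂ f₁ f₂ h₁ h₂ e =>
      congrArg (fun s => s.1.1) (hx g₁ g₂ h₁ h₂ e)
    have hx2 : Presieve.FamilyOfElements.Compatible (P := Y.obj) (R := R.arrows)
        (fun U f hf => (x f hf).1.2) := fun U₁ U₂ W g₁ g₂ f₁ f₂ h₁ h₂ e =>
      congrArg (fun s => s.1.2) (hx g₁ g₂ h₁ h₂ e)
    refine ⟨⟨((hP R hR).amalgamate _ hx1, (hY R hR).amalgamate _ hx2), ?_⟩, ?_, ?_⟩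
    · refine (hX R hR).isSeparatedFor.ext fun U f hf => ?_
      rw [← NatTrans.naturality_apply, ← NatTrans.naturality_apply,
        (hP R hR).valid_glue hx1 f hf, (hY R hR).valid_glue hx2 f hf]
      exact (x f hf).2
    · intro U f hf
      exact Subtype.ext
        (Prod.ext ((hP R hR).valid_glue hx1 f hf) ((hY R hR).valid_glue hx2 f hf))
    · intro t ht
      refine Subtype.ext (Prod.ext ?_ ?_)
      · refine (hP R hR).isSeparatedFor.ext fun U f hf => ?_
        exact (congrArg (fun s => s.1.1) (ht f hf)).trans ((hP R hR).valid_glue hx1 f hf).symm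
      · refine (hY R hR).isSeparatedFor.ext fun U f hf => ?_
        exact (congrArg (fun s => s.1.2) (ht f hf)).trans ((hY R hR).valid_glue hx2 f hf).symm

variable (J) in
/-- A commutative semigroup (with or without identity) in the topos of sheaves of sets. -/
structure CommSemigroupSheaf where
  /-- the underlying sheaf of sets -/
  sheaf : Sheaf J (Type (max u v))
  /-- the multiplication on sections -/
  mul : ∀ {T : Cᵒᵖ}, sheaf.obj.obj T → sheaf.obj.obj T → sheaf.obj.obj T
  map_mul : ∀ {T T' : Cᵒᵖ} (f : T ⟶ T') (x y : sheaf.obj.obj T),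
    sheaf.obj.map f (mul x y) = mul (sheaf.obj.map f x) (sheaf.obj.map f y)
  mul_assoc : ∀ {T : Cᵒᵖ} (x y z : sheaf.obj.obj T), mul (mul x y) z = mul x (mul y z)
  mul_comm : ∀ {T : Cᵒᵖ} (x y : sheaf.obj.obj T), mul x y = mul y x

/-- The multiplication morphism `m : Q × Q ⟶ Q`. -/
def CommSemigroupSheaf.mulHom (Q : CommSemigroupSheaf J) :
    prodSheaf Q.sheaf Q.sheaf ⟶ Q.sheaf :=
  ObjectProperty.homMk
    { app := fun _ => ↾fun s => Q.mul s.1 s.2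
      naturality := fun T T' f => by
        ext s
        exact (Q.map_mul f s.1 s.2).symm }

/-- Morphisms of commutative semigroups in the topos of sheaves of sets. -/
structure SemigroupHom (M Q : CommSemigroupSheaf J) where
  /-- the underlying morphism of sheaves of sets -/
  hom : M.sheaf ⟶ Q.sheaf
  map_mul : ∀ {T : Cᵒᵖ} (x y : M.sheaf.obj.obj T),
    hom.hom.app T (M.mul x y) = Q.mul (hom.hom.app T x) (hom.hom.app T y)

/-! ### Torsors -/

variable {G : Sheaf J CommGrpCat.{max u v}}

variable (G) in
/-- An object of the category of sheaves over `X` endowed with a left action of the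
sheaf of abelian groups `G` over `X` (`G` acting trivially on `X`). -/
structure GObj (X : Sheaf J (Type (max u v))) where
  /-- the underlying sheaf of sets -/
  sheaf : Sheaf J (Type (max u v))
  /-- the structure morphism to `X` -/
  proj : sheaf ⟶ X
  /-- the action of `G`, on sections -/
  smul : ∀ {T : Cᵒᵖ}, G.obj.obj T → sheaf.obj.obj T → sheaf.obj.obj T
  map_smul : ∀ {T T' : Cᵒᵖ} (f : T ⟶ T') (g : G.obj.obj T) (p : sheaf.obj.obj T),
    sheaf.obj.map f (smul g p) = smul (G.obj.map f g) (sheaf.obj.map f p)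
  one_smul : ∀ {T : Cᵒᵖ} (p : sheaf.obj.obj T), smul 1 p = p
  mul_smul : ∀ {T : Cᵒᵖ} (g h : G.obj.obj T) (p : sheaf.obj.obj T),
    smul (g * h) p = smul g (smul h p)
  proj_smul : ∀ {T : Cᵒᵖ} (g : G.obj.obj T) (p : sheaf.obj.obj T),
    proj.hom.app T (smul g p) = proj.hom.app T p

namespace GObj

variable {X Y : Sheaf J (Type (max u v))}

/-- Morphisms of sheaves over `X` that commute with the action of `G`. -/
@[ext]
structure Hom (P P' : GObj G X) where
  /-- the underlying morphism of sheaves of sets -/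
  hom : P.sheaf ⟶ P'.sheaf
  proj : ∀ {T : Cᵒᵖ} (p : P.sheaf.obj.obj T),
    P'.proj.hom.app T (hom.hom.app T p) = P.proj.hom.app T p
  map_smul : ∀ {T : Cᵒᵖ} (g : G.obj.obj T) (p : P.sheaf.obj.obj T),
    hom.hom.app T (P.smul g p) = P'.smul g (hom.hom.app T p)

instance : Category (GObj G X) where
  Hom := Hom
  id P := { hom := 𝟙 _, proj := fun _ => rfl, map_smul := fun _ _ => rfl }
  comp f g :=
    { hom := f.hom ≫ g.hom
      proj := fun p => (g.proj _).trans (f.proj p)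
      map_smul := fun a p =>
        (congrArg (g.hom.hom.app _) (f.map_smul a p)).trans (g.map_smul a _) }

@[ext]
theorem hom_ext {P P' : GObj G X} {f g : P ⟶ P'}
    (h : ∀ {T : Cᵒᵖ} (p : P.sheaf.obj.obj T), f.hom.hom.app T p = g.hom.hom.app T p) : f = g := by
  apply Hom.ext
  apply Sheaf.hom_ext
  ext T p
  exact h p

/-- The morphism `(g, p) ↦ (g • p, p)` from `G × P` to `P ×_X P`, on sections. -/
def shear (P : GObj G X) (T : Cᵒᵖ) (s : G.obj.obj T × P.sheaf.obj.obj T) :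
    (fiberSheaf P.proj P.proj).obj.obj T :=
  ⟨(P.smul s.1 s.2, s.2), P.proj_smul s.1 s.2⟩

/-- `P` is a `G`-torsor over `X`: the morphism `P ⟶ X` is an epimorphism of sheaves, and
`(g, p) ↦ (g • p, p)` is an isomorphism (that is, bijective on sections) from `G × P` to
`P ×_X P`. -/
structure IsTorsor (P : GObj G X) : Prop where
  epi : Epi P.proj
  bijective_shear : ∀ T : Cᵒᵖ, Function.Bijective (P.shear T)

/-- The base change `P ×_X Y` of `P` along `f : Y ⟶ X`, with `G` acting on the factor `P`. -/
def pullback (P : GObj G X) (f : Y ⟶ X) : GObj G Y where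
  sheaf := fiberSheaf P.proj f
  proj := ObjectProperty.homMk { app := fun _ => ↾fun s => s.1.2 }
  smul g s := ⟨(P.smul g s.1.1, s.1.2), (P.proj_smul g s.1.1).trans s.2⟩
  map_smul f g s := Subtype.ext (Prod.ext (P.map_smul f g s.1.1) rfl)
  one_smul s := Subtype.ext (Prod.ext (P.one_smul s.1.1) rfl)
  mul_smul g h s := Subtype.ext (Prod.ext (P.mul_smul g h s.1.1) rfl)
  proj_smul _ _ := rfl

/-! ### The product of torsors -/

/-- The equivalence relation on `(P₁ ×_X P₂)(T)` given by the orbits of `G₂(T)`, where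
`G₂` is the kernel of the multiplication `G × G ⟶ G`, acting diagonally. -/
def tensorSetoid (P₁ P₂ : GObj G X) (T : Cᵒᵖ) :
    Setoid ((fiberSheaf P₁.proj P₂.proj).obj.obj T) where
  r s t := ∃ g h : G.obj.obj T, g * h = 1 ∧ t.1 = (P₁.smul g s.1.1, P₂.smul h s.1.2)
  iseqv :=
    { refl := fun s => ⟨1, 1, _root_.mul_one 1, by rw [P₁.one_smul, P₂.one_smul]⟩
      symm := by
        rintro s t ⟨g, h, e, q⟩
        refine ⟨g⁻¹, h⁻¹, by rw [← mul_inv, e, inv_one], ?_⟩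
        rw [q]
        simp only [← P₁.mul_smul, ← P₂.mul_smul, inv_mul_cancel, P₁.one_smul, P₂.one_smul]
      trans := by
        rintro s t r ⟨g, h, e, q⟩ ⟨g', h', e', q'⟩
        refine ⟨g' * g, h' * h, by rw [mul_mul_mul_comm, e, e', _root_.mul_one], ?_⟩
        rw [q', q]
        simp only [P₁.mul_smul, P₂.mul_smul] }

/-- The presheaf `T ↦ G₂(T) \ (P₁ ×_X P₂)(T)`. -/
def tensorPresheaf (P₁ P₂ : GObj G X) : Cᵒᵖ ⥤ Type (max u v) where
  obj T := Quotient (tensorSetoid P₁ P₂ T)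
  map {T T'} f := ↾Quotient.map ((fiberSheaf P₁.proj P₂.proj).obj.map f) (by
    rintro s t ⟨g, h, e, q⟩
    refine ⟨G.obj.map f g, G.obj.map f h, by rw [← map_mul, e, map_one], ?_⟩
    refine Prod.ext ?_ ?_
    · exact (congrArg (fun z => P₁.sheaf.obj.map f z.1) q).trans (P₁.map_smul f g _)
    · exact (congrArg (fun z => P₂.sheaf.obj.map f z.2) q).trans (P₂.map_smul f h _))
  map_id T := by
    ext s
    induction s using Quotient.inductionOn with | _ s => ?_
    exact congrArg (Quotient.mk _)
      (ConcreteCategory.congr_hom ((fiberSheaf P₁.proj P₂.proj).obj.map_id T) s)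
  map_comp f g := by
    ext s
    induction s using Quotient.inductionOn with | _ s => ?_
    exact congrArg (Quotient.mk _)
      (ConcreteCategory.congr_hom ((fiberSheaf P₁.proj P₂.proj).obj.map_comp f g) s)

/-- The presheaf `G × F`. -/
def prodPresheaf (G : Sheaf J CommGrpCat.{max u v}) (F : Cᵒᵖ ⥤ Type (max u v)) :
    Cᵒᵖ ⥤ Type (max u v) where
  obj T := G.obj.obj T × F.obj T
  map f := ↾fun s => (G.obj.map f s.1, F.map f s.2)

/-- The section `(g, s)` of `G × F`. -/
def prodPresheafMk {F : Cᵒᵖ ⥤ Type (max u v)} {T : Cᵒᵖ} (g : G.obj.obj T) (s : F.obj T) :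
    (prodPresheaf G F).obj T := (g, s)

/-- The morphism `G × F ⟶ G × F'` induced by `F ⟶ F'`. -/
def prodPresheafMap (G : Sheaf J CommGrpCat.{max u v}) {F F' : Cᵒᵖ ⥤ Type (max u v)}
    (a : F ⟶ F') : prodPresheaf G F ⟶ prodPresheaf G F' where
  app T := ↾fun s => (s.1, a.app T s.2)
  naturality T T' f := by
    ext s
    exact congrArg (Prod.mk (G.obj.map f s.1)) (NatTrans.naturality_apply a f s.2)

theorem W_prodPresheafMap {F F' : Cᵒᵖ ⥤ Type (max u v)} {a : F ⟶ F'} (ha : J.W a) :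
    J.W (prodPresheafMap G a) := by
  have h1 := ha.isLocallyInjective
  have h2 := ha.isLocallySurjective
  rw [J.W_iff_isLocallyBijective]
  refine ⟨⟨fun {T} s t e => ?_⟩, ⟨fun {T} s => ?_⟩⟩
  · have e' : ((s.1, a.app T s.2) : G.obj.obj T × F'.obj T) = (t.1, a.app T t.2) := e
    have e1 : s.1 = t.1 := congrArg (fun z : G.obj.obj T × F'.obj T => z.1) e'
    have e2 : a.app T s.2 = a.app T t.2 := congrArg (fun z : G.obj.obj T × F'.obj T => z.2) e'
    refine J.superset_covering ?_ (Presheaf.equalizerSieve_mem J a s.2 t.2 e2)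
    intro U f hf
    exact Prod.ext (congrArg (G.obj.map f.op) e1) hf
  · refine J.superset_covering ?_ (Presheaf.imageSieve_mem J a s.2)
    rintro U f ⟨y, hy⟩
    exact ⟨(G.obj.map f.op s.1, y), Prod.ext rfl hy⟩

variable (P₁ P₂ : GObj G X)

/-- The action of `G` on the presheaf quotient: `g • [p₁, p₂] = [g • p₁, p₂]`. -/
def tensorPresheafSMul : prodPresheaf G (tensorPresheaf P₁ P₂) ⟶ tensorPresheaf P₁ P₂ where
  app T := ↾fun s => Quotient.map (sa := tensorSetoid P₁ P₂ T) (sb := tensorSetoid P₁ P₂ T)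
    (fun t => ⟨(P₁.smul s.1 t.1.1, t.1.2), (P₁.proj_smul s.1 t.1.1).trans t.2⟩) (by
      rintro t t' ⟨g, h, e, q⟩
      refine ⟨g, h, e, Prod.ext ?_ (congrArg (fun z => z.2) q)⟩
      refine (congrArg (fun z => P₁.smul s.1 z.1) q).trans ?_
      exact (P₁.mul_smul _ _ _).symm.trans
        ((congrArg (fun z => P₁.smul z _) (mul_comm _ _)).trans (P₁.mul_smul _ _ _))) s.2
  naturality T T' f := by
    ext ⟨g, s⟩
    induction s using Quotient.inductionOn with | _ s => ?_
    exact congrArg (Quotient.mk _)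
      (Subtype.ext (Prod.ext (P₁.map_smul f g s.1.1).symm rfl))

/-- The structure morphism of the presheaf quotient. -/
def tensorPresheafProj : tensorPresheaf P₁ P₂ ⟶ X.obj where
  app T := ↾Quotient.lift (fun t => P₁.proj.hom.app T t.1.1) (by
    rintro t t' ⟨g, h, e, q⟩
    rw [q, P₁.proj_smul])
  naturality T T' f := by
    ext s
    induction s using Quotient.inductionOn with | _ s => ?_
    exact NatTrans.naturality_apply P₁.proj.hom f s.1.1

/-- The quotient sheaf `G₂ \ (P₁ ×_X P₂)`. -/
noncomputable def tensorSheaf : Sheaf J (Type (max u v)) :=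
  (presheafToSheaf J _).obj (tensorPresheaf P₁ P₂)

/-- The canonical morphism from the presheaf quotient to the quotient sheaf. -/
noncomputable def toTensorSheaf : tensorPresheaf P₁ P₂ ⟶ (tensorSheaf P₁ P₂).obj :=
  toSheafify J (tensorPresheaf P₁ P₂)

theorem W_toTensorSheaf : J.W (toTensorSheaf P₁ P₂) := J.W_toSheafify _

theorem exists_tensorSheafSMul :
    ∃ a : prodPresheaf G (tensorSheaf P₁ P₂).obj ⟶ (tensorSheaf P₁ P₂).obj,
      prodPresheafMap G (toTensorSheaf P₁ P₂) ≫ a =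
        tensorPresheafSMul P₁ P₂ ≫ toTensorSheaf P₁ P₂ :=
  (W_prodPresheafMap (W_toTensorSheaf P₁ P₂) _ (tensorSheaf P₁ P₂).property).2 _

/-- The action of `G` on the quotient sheaf, that is, the unique one for which the canonical
morphism from the presheaf quotient is equivariant. -/
noncomputable def tensorSheafSMul :
    prodPresheaf G (tensorSheaf P₁ P₂).obj ⟶ (tensorSheaf P₁ P₂).obj :=
  (exists_tensorSheafSMul P₁ P₂).choose

theorem tensorSheafSMul_comp :
    prodPresheafMap G (toTensorSheaf P₁ P₂) ≫ tensorSheafSMul P₁ P₂ =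
      tensorPresheafSMul P₁ P₂ ≫ toTensorSheaf P₁ P₂ :=
  (exists_tensorSheafSMul P₁ P₂).choose_spec

variable {P₁ P₂} in
/-- The action of `G` on the quotient sheaf, on sections. -/
noncomputable def tensorAct {T : Cᵒᵖ} (g : G.obj.obj T) (s : (tensorSheaf P₁ P₂).obj.obj T) :
    (tensorSheaf P₁ P₂).obj.obj T :=
  (tensorSheafSMul P₁ P₂).app T (prodPresheafMk (F := (tensorSheaf P₁ P₂).obj) g s)

variable {P₁ P₂} in
theorem map_tensorAct {T T' : Cᵒᵖ} (f : T ⟶ T') (g : G.obj.obj T)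
    (s : (tensorSheaf P₁ P₂).obj.obj T) :
    (tensorSheaf P₁ P₂).obj.map f (tensorAct g s) =
      tensorAct (G.obj.map f g) ((tensorSheaf P₁ P₂).obj.map f s) :=
  (NatTrans.naturality_apply (tensorSheafSMul P₁ P₂) f
    (prodPresheafMk (F := (tensorSheaf P₁ P₂).obj) g s)).symm

variable {P₁ P₂} in
/-- The section `p₁ ⊗ p₂` of the quotient sheaf defined by sections `p₁`, `p₂` of
`P₁`, `P₂` with the same image in `X`. -/
noncomputable def tmul {T : Cᵒᵖ} (p₁ : P₁.sheaf.obj.obj T) (p₂ : P₂.sheaf.obj.obj T)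
    (h : P₁.proj.hom.app T p₁ = P₂.proj.hom.app T p₂) : (tensorSheaf P₁ P₂).obj.obj T :=
  (toTensorSheaf P₁ P₂).app T (Quotient.mk (tensorSetoid P₁ P₂ T) ⟨(p₁, p₂), h⟩)

variable {P₁ P₂} in
theorem map_tmul {T T' : Cᵒᵖ} (f : T ⟶ T') (p₁ : P₁.sheaf.obj.obj T)
    (p₂ : P₂.sheaf.obj.obj T) (h : P₁.proj.hom.app T p₁ = P₂.proj.hom.app T p₂) :
    (tensorSheaf P₁ P₂).obj.map f (tmul p₁ p₂ h) =
      tmul (P₁.sheaf.obj.map f p₁) (P₂.sheaf.obj.map f p₂)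
        (by rw [NatTrans.naturality_apply, NatTrans.naturality_apply, h]) :=
  (NatTrans.naturality_apply (toTensorSheaf P₁ P₂) f _).symm

variable {P₁ P₂} in
theorem tensorAct_tmul {T : Cᵒᵖ} (g : G.obj.obj T) (p₁ : P₁.sheaf.obj.obj T)
    (p₂ : P₂.sheaf.obj.obj T) (h : P₁.proj.hom.app T p₁ = P₂.proj.hom.app T p₂) :
    tensorAct g (tmul p₁ p₂ h) = tmul (P₁.smul g p₁) p₂ ((P₁.proj_smul g p₁).trans h) :=
  ConcreteCategory.congr_hom (NatTrans.congr_app (tensorSheafSMul_comp P₁ P₂) T)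
    (prodPresheafMk (F := tensorPresheaf P₁ P₂) g
      (Quotient.mk (tensorSetoid P₁ P₂ T) ⟨(p₁, p₂), h⟩))

variable {P₁ P₂} in
theorem tmul_congr {T : Cᵒᵖ} {p₁ p₁' : P₁.sheaf.obj.obj T} {p₂ p₂' : P₂.sheaf.obj.obj T}
    {h : P₁.proj.hom.app T p₁ = P₂.proj.hom.app T p₂} (e₁ : p₁ = p₁') (e₂ : p₂ = p₂') :
    tmul p₁ p₂ h = tmul p₁' p₂' (e₁ ▸ e₂ ▸ h) := by
  subst e₁ e₂
  rfl

variable {P₁ P₂} in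
/-- Two sections of a sheaf, depending on a section of the quotient sheaf compatibly with
restrictions, are equal as soon as they are equal on the sections `p₁ ⊗ p₂`. -/
theorem tensorSheaf_induction {T : Cᵒᵖ} {Z : Sheaf J (Type (max u v))}
    (a b : ∀ U : Cᵒᵖ, (T ⟶ U) → (tensorSheaf P₁ P₂).obj.obj U → Z.obj.obj U)
    (ha : ∀ {U U' : Cᵒᵖ} (i : T ⟶ U) (f : U ⟶ U') s,
      Z.obj.map f (a U i s) = a U' (i ≫ f) ((tensorSheaf P₁ P₂).obj.map f s))
    (hb : ∀ {U U' : Cᵒᵖ} (i : T ⟶ U) (f : U ⟶ U') s,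
      Z.obj.map f (b U i s) = b U' (i ≫ f) ((tensorSheaf P₁ P₂).obj.map f s))
    (h : ∀ (U : Cᵒᵖ) (i : T ⟶ U) p₁ p₂ e, a U i (tmul p₁ p₂ e) = b U i (tmul p₁ p₂ e))
    (s : (tensorSheaf P₁ P₂).obj.obj T) : a T (𝟙 T) s = b T (𝟙 T) s := by
  have h2 := (W_toTensorSheaf P₁ P₂).isLocallySurjective
  refine (((isSheaf_iff_isSheaf_of_type J _).1 Z.property _
    (Presheaf.imageSieve_mem J (toTensorSheaf P₁ P₂) s)).isSeparatedFor).ext ?_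
  rintro U f ⟨y, hy⟩
  rw [ha, hb]
  have hy' : (tensorSheaf P₁ P₂).obj.map f.op s = (toTensorSheaf P₁ P₂).app (op U) y := hy.symm
  rw [hy']
  induction y using Quotient.inductionOn with | _ y => ?_
  exact h _ _ _ _ _

/-- The structure morphism of the quotient sheaf. -/
noncomputable def tensorProj : tensorSheaf P₁ P₂ ⟶ X :=
  ObjectProperty.homMk (sheafifyLift J (tensorPresheafProj P₁ P₂) X.property)

variable {P₁ P₂} in
theorem tensorProj_tmul {T : Cᵒᵖ} (p₁ : P₁.sheaf.obj.obj T) (p₂ : P₂.sheaf.obj.obj T)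
    (h : P₁.proj.hom.app T p₁ = P₂.proj.hom.app T p₂) :
    (tensorProj P₁ P₂).hom.app T (tmul p₁ p₂ h) = P₁.proj.hom.app T p₁ :=
  ConcreteCategory.congr_hom (NatTrans.congr_app
    (toSheafify_sheafifyLift J (tensorPresheafProj P₁ P₂) X.property) T)
      (Quotient.mk (tensorSetoid P₁ P₂ T) ⟨(p₁, p₂), h⟩)

/-- The product `P₁ ⊗ P₂ = G₂ \ (P₁ ×_X P₂)`, where `G₂` is the kernel of the
multiplication `G × G ⟶ G`, acting diagonally on `P₁ ×_X P₂`. -/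
noncomputable def tensor : GObj G X where
  sheaf := tensorSheaf P₁ P₂
  proj := tensorProj P₁ P₂
  smul g s := tensorAct g s
  map_smul f g s := map_tensorAct f g s
  one_smul {T} p := by
    refine tensorSheaf_induction (Z := tensorSheaf P₁ P₂)
      (fun U _ s => tensorAct 1 s) (fun U _ s => s) ?_ ?_ ?_ p
    · intro U U' i f s
      rw [map_tensorAct, map_one]
    · intros; rfl
    · intro U i p₁ p₂ e
      rw [tensorAct_tmul]
      exact tmul_congr (P₁.one_smul p₁) rfl
  mul_smul {T} g h p := by
    have := tensorSheaf_induction (Z := tensorSheaf P₁ P₂) (T := T)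
      (fun U i s => tensorAct (G.obj.map i (g * h)) s)
      (fun U i s => tensorAct (G.obj.map i g) (tensorAct (G.obj.map i h) s)) ?_ ?_ ?_ p
    · simpa using this
    · intro U U' i f s
      rw [map_tensorAct, Functor.map_comp_apply]
    · intro U U' i f s
      rw [map_tensorAct, map_tensorAct, Functor.map_comp_apply, Functor.map_comp_apply]
    · intro U i p₁ p₂ e
      rw [tensorAct_tmul, tensorAct_tmul, tensorAct_tmul]
      refine tmul_congr ?_ rfl
      rw [map_mul]
      exact P₁.mul_smul _ _ p₁
  proj_smul {T} g p := by
    have := tensorSheaf_induction (P₁ := P₁) (P₂ := P₂) (Z := X) (T := T)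
      (fun U i s => (tensorProj P₁ P₂).hom.app U (tensorAct (G.obj.map i g) s))
      (fun U i s => (tensorProj P₁ P₂).hom.app U s) ?_ ?_ ?_ p
    · simpa using this
    · intro U U' i f s
      rw [← NatTrans.naturality_apply, map_tensorAct, Functor.map_comp_apply]
    · intro U U' i f s
      rw [← NatTrans.naturality_apply]
    · intro U i p₁ p₂ e
      rw [tensorAct_tmul, tensorProj_tmul, tensorProj_tmul]
      exact P₁.proj_smul _ p₁

variable {P₁ P₂}

theorem tmul_smul {T : Cᵒᵖ} (g : G.obj.obj T) (p₁ : P₁.sheaf.obj.obj T)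
    (p₂ : P₂.sheaf.obj.obj T) (h : P₁.proj.hom.app T p₁ = P₂.proj.hom.app T p₂) :
    tmul p₁ (P₂.smul g p₂) (h.trans (P₂.proj_smul g p₂).symm) =
      (tensor P₁ P₂).smul g (tmul p₁ p₂ h) := by
  refine Eq.trans ?_ (tensorAct_tmul g p₁ p₂ h).symm
  refine congrArg ((toTensorSheaf P₁ P₂).app T) (Quotient.sound ?_)
  refine ⟨g, g⁻¹, mul_inv_cancel g, Prod.ext rfl ?_⟩
  simp only [← P₂.mul_smul, inv_mul_cancel, P₂.one_smul]

theorem smul_tmul {T : Cᵒᵖ} (g : G.obj.obj T) (p₁ : P₁.sheaf.obj.obj T)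
    (p₂ : P₂.sheaf.obj.obj T) (h : P₁.proj.hom.app T p₁ = P₂.proj.hom.app T p₂) :
    tmul (P₁.smul g p₁) p₂ ((P₁.proj_smul g p₁).trans h) =
      (tensor P₁ P₂).smul g (tmul p₁ p₂ h) :=
  (tensorAct_tmul g p₁ p₂ h).symm

/-! ### Morphisms out of a product of torsors -/

variable (P₁ P₂) in
/-- A map `(p₁, p₂) ↦ b(p₁, p₂)` from `P₁ ×_X P₂` to `R` over `X` such that
`b(g • p₁, p₂) = g • b(p₁, p₂) = b(p₁, g • p₂)`. -/
structure Pairing (R : GObj G X) where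
  /-- the map on sections -/
  map : ∀ {T : Cᵒᵖ} (p₁ : P₁.sheaf.obj.obj T) (p₂ : P₂.sheaf.obj.obj T),
    P₁.proj.hom.app T p₁ = P₂.proj.hom.app T p₂ → R.sheaf.obj.obj T
  map_map : ∀ {T T' : Cᵒᵖ} (f : T ⟶ T') p₁ p₂ h h',
    R.sheaf.obj.map f (map p₁ p₂ h) = map (P₁.sheaf.obj.map f p₁) (P₂.sheaf.obj.map f p₂) h'
  proj_map : ∀ {T : Cᵒᵖ} (p₁ : P₁.sheaf.obj.obj T) p₂ h,
    R.proj.hom.app T (map p₁ p₂ h) = P₁.proj.hom.app T p₁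
  smul_left : ∀ {T : Cᵒᵖ} (g : G.obj.obj T) p₁ p₂ h h',
    map (P₁.smul g p₁) p₂ h' = R.smul g (map p₁ p₂ h)
  smul_right : ∀ {T : Cᵒᵖ} (g : G.obj.obj T) p₁ p₂ h h',
    map p₁ (P₂.smul g p₂) h' = R.smul g (map p₁ p₂ h)

namespace Pairing

variable {R : GObj G X} (b : Pairing P₁ P₂ R)

/-- The morphism from the presheaf quotient defined by a pairing. -/
def presheafLift : tensorPresheaf P₁ P₂ ⟶ R.sheaf.obj where
  app T := ↾Quotient.lift (fun s => b.map s.1.1 s.1.2 s.2) (by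
    rintro ⟨⟨p₁, p₂⟩, hp⟩ ⟨⟨q₁, q₂⟩, hq⟩ ⟨g, h, e, q⟩
    obtain ⟨rfl, rfl⟩ : q₁ = P₁.smul g p₁ ∧ q₂ = P₂.smul h p₂ := Prod.ext_iff.1 q
    have hp' : P₁.proj.hom.app T p₁ = P₂.proj.hom.app T (P₂.smul h p₂) := by
      rw [P₂.proj_smul]; exact hp
    exact ((b.smul_left g p₁ (P₂.smul h p₂) hp' hq).trans
      ((congrArg (R.smul g) (b.smul_right h p₁ p₂ hp hp')).trans
        ((R.mul_smul g h _).symm.trans (by rw [e, R.one_smul])))).symm)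
  naturality T T' f := by
    ext s
    induction s using Quotient.inductionOn with | _ s => ?_
    exact (b.map_map f s.1.1 s.1.2 s.2 _).symm

/-- The morphism of sheaves `P₁ ⊗ P₂ ⟶ R` defined by a pairing. -/
noncomputable def sheafLift : tensorSheaf P₁ P₂ ⟶ R.sheaf :=
  ObjectProperty.homMk (sheafifyLift J b.presheafLift R.sheaf.property)

theorem toTensorSheaf_sheafLift : toTensorSheaf P₁ P₂ ≫ b.sheafLift.hom = b.presheafLift :=
  toSheafify_sheafifyLift J b.presheafLift R.sheaf.property

theorem sheafLift_tmul {T : Cᵒᵖ} (p₁ : P₁.sheaf.obj.obj T) (p₂ : P₂.sheaf.obj.obj T)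
    (h : P₁.proj.hom.app T p₁ = P₂.proj.hom.app T p₂) :
    b.sheafLift.hom.app T (tmul p₁ p₂ h) = b.map p₁ p₂ h :=
  ConcreteCategory.congr_hom (NatTrans.congr_app b.toTensorSheaf_sheafLift T)
    (Quotient.mk (tensorSetoid P₁ P₂ T) ⟨(p₁, p₂), h⟩)

/-- The morphism `P₁ ⊗ P₂ ⟶ R` defined by a pairing. -/
noncomputable def lift : tensor P₁ P₂ ⟶ R where
  hom := b.sheafLift
  proj {T} p := by
    refine tensorSheaf_induction (P₁ := P₁) (P₂ := P₂) (Z := X) (T := T)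
      (fun U i s => R.proj.hom.app U (b.sheafLift.hom.app U s))
      (fun U i s => (tensorProj P₁ P₂).hom.app U s) ?_ ?_ ?_ p
    · intro U U' i f s
      rw [← NatTrans.naturality_apply, ← NatTrans.naturality_apply]
    · intro U U' i f s
      rw [← NatTrans.naturality_apply]
    · intro U i p₁ p₂ e
      rw [sheafLift_tmul, tensorProj_tmul, b.proj_map]
  map_smul {T} g p := by
    have := tensorSheaf_induction (P₁ := P₁) (P₂ := P₂) (Z := R.sheaf) (T := T)
      (fun U i s => b.sheafLift.hom.app U (tensorAct (G.obj.map i g) s))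
      (fun U i s => R.smul (G.obj.map i g) (b.sheafLift.hom.app U s)) ?_ ?_ ?_ p
    · refine Eq.trans ?_ (this.trans ?_)
      · simp only [Functor.map_id_apply]; rfl
      · simp only [Functor.map_id_apply]; rfl
    · intro U U' i f s
      rw [← NatTrans.naturality_apply, map_tensorAct, Functor.map_comp_apply]
    · intro U U' i f s
      rw [R.map_smul, ← NatTrans.naturality_apply, Functor.map_comp_apply]
    · intro U i p₁ p₂ e
      rw [tensorAct_tmul, sheafLift_tmul, sheafLift_tmul, b.smul_left]

theorem lift_tmul {T : Cᵒᵖ} (p₁ : P₁.sheaf.obj.obj T) (p₂ : P₂.sheaf.obj.obj T)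
    (h : P₁.proj.hom.app T p₁ = P₂.proj.hom.app T p₂) :
    b.lift.hom.hom.app T (tmul p₁ p₂ h) = b.map p₁ p₂ h :=
  b.sheafLift_tmul p₁ p₂ h

end Pairing

theorem IsTorsor.exists_smul {P : GObj G X} (hP : P.IsTorsor) {T : Cᵒᵖ}
    (p q : P.sheaf.obj.obj T) (h : P.proj.hom.app T p = P.proj.hom.app T q) :
    ∃ g : G.obj.obj T, P.smul g q = p := by
  obtain ⟨⟨g, r⟩, e⟩ := (hP.bijective_shear T).2 ⟨(p, q), h⟩
  have e' : (P.smul g r, r) = (p, q) := congrArg Subtype.val e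
  obtain ⟨e1, rfl⟩ := Prod.ext_iff.1 e'
  exact ⟨g, e1⟩

theorem IsTorsor.smul_injective {P : GObj G X} (hP : P.IsTorsor) {T : Cᵒᵖ}
    (p : P.sheaf.obj.obj T) (g h : G.obj.obj T) (e : P.smul g p = P.smul h p) : g = h :=
  congrArg Prod.fst ((hP.bijective_shear T).1 (a₁ := (g, p)) (a₂ := (h, p))
    (Subtype.ext (Prod.ext e rfl)))

theorem IsTorsor.isLocallySurjective {P : GObj G X} (hP : P.IsTorsor) :
    Presheaf.IsLocallySurjective J P.proj.hom :=
  (Sheaf.isLocallySurjective_iff_epi P.proj).2 hP.epi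

/-- The base change of a torsor is a torsor. -/
theorem IsTorsor.pullback {P : GObj G X} (hP : P.IsTorsor) (f : Y ⟶ X) :
    (P.pullback f).IsTorsor where
  epi := by
    have := hP.isLocallySurjective
    refine (Sheaf.isLocallySurjective_iff_epi (P.pullback f).proj).1 ⟨fun {U} s => ?_⟩
    refine J.superset_covering ?_ (Presheaf.imageSieve_mem J P.proj.hom (f.hom.app _ s))
    rintro V i ⟨p, hp⟩
    refine ⟨⟨(p, Y.obj.map i.op s), hp.trans ?_⟩, rfl⟩
    rw [NatTrans.naturality_apply]
  bijective_shear T := by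
    constructor
    · rintro ⟨g, s⟩ ⟨h, t⟩ e
      have e' : ((P.pullback f).smul g s, s) = ((P.pullback f).smul h t, t) :=
        congrArg Subtype.val e
      obtain ⟨e1, rfl⟩ := Prod.ext_iff.1 e'
      refine Prod.ext (hP.smul_injective s.1.1 g h ?_) rfl
      exact congrArg (fun z => z.1.1) e1
    · rintro ⟨⟨⟨⟨p, y⟩, hp⟩, ⟨⟨q, z⟩, hq⟩⟩, e⟩
      obtain rfl : y = z := e
      obtain ⟨g, hg⟩ := hP.exists_smul p q (hp.trans hq.symm)
      refine ⟨(g, ⟨(q, y), hq⟩), ?_⟩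
      exact Subtype.ext (Prod.ext (Subtype.ext (Prod.ext hg rfl)) rfl)

/-- A pairing of torsors defines an isomorphism `P₁ ⊗ P₂ ⟶ R` of sheaves. -/
theorem Pairing.isIso_sheafLift {R : GObj G X} (b : Pairing P₁ P₂ R) (h₁ : P₁.IsTorsor)
    (h₂ : P₂.IsTorsor) (hR : R.IsTorsor) : IsIso b.sheafLift := by
  rw [← J.W_sheafToPresheaf_map_iff_isIso]
  have key : J.W b.presheafLift := by
    rw [J.W_iff_isLocallyBijective]
    have i₁ := h₁.isLocallySurjective
    have i₂ := h₂.isLocallySurjective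
    refine ⟨⟨fun {T} s t e => ?_⟩, ⟨fun {T} r => ?_⟩⟩
    · suffices s = t by
        subst this
        rw [Presheaf.equalizerSieve_self_eq_top]
        exact J.top_mem _
      induction s using Quotient.inductionOn with | _ s => ?_
      induction t using Quotient.inductionOn with | _ t => ?_
      obtain ⟨⟨p₁, p₂⟩, hp⟩ := s
      obtain ⟨⟨q₁, q₂⟩, hq⟩ := t
      have e' : b.map p₁ p₂ hp = b.map q₁ q₂ hq := e
      have e₀ : P₁.proj.hom.app T q₁ = P₁.proj.hom.app T p₁ := by
        rw [← b.proj_map q₁ q₂ hq, ← e', b.proj_map]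
      obtain ⟨g, rfl⟩ := h₁.exists_smul q₁ p₁ e₀
      obtain ⟨h, rfl⟩ := h₂.exists_smul q₂ p₂ (hq.symm.trans (e₀.trans hp))
      refine Quotient.sound ⟨g, h, ?_, rfl⟩
      have hp' : P₁.proj.hom.app T p₁ = P₂.proj.hom.app T (P₂.smul h p₂) := by
        rw [P₂.proj_smul]; exact hp
      rw [b.smul_left g p₁ (P₂.smul h p₂) hp', b.smul_right h p₁ p₂ hp, ← R.mul_smul] at e'
      exact hR.smul_injective (b.map p₁ p₂ hp) _ _ (e'.symm.trans (R.one_smul _).symm)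
    · refine J.transitive (Presheaf.imageSieve_mem J P₁.proj.hom (R.proj.hom.app _ r)) _ ?_
      rintro U f ⟨p₁, hp₁⟩
      refine J.superset_covering ?_ (Presheaf.imageSieve_mem J P₂.proj.hom
        (P₁.proj.hom.app _ p₁))
      rintro V i ⟨p₂, hp₂⟩
      have hp : P₁.proj.hom.app _ (P₁.sheaf.obj.map i.op p₁) = P₂.proj.hom.app _ p₂ := by
        rw [NatTrans.naturality_apply]; exact hp₂.symm
      obtain ⟨g, hg⟩ := hR.exists_smul (R.sheaf.obj.map (i ≫ f).op r)
        (b.map (P₁.sheaf.obj.map i.op p₁) p₂ hp) (by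
          rw [b.proj_map, NatTrans.naturality_apply, NatTrans.naturality_apply, hp₁, op_comp,
            Functor.map_comp_apply])
      have hg' : P₁.proj.hom.app _ (P₁.smul g (P₁.sheaf.obj.map i.op p₁)) =
          P₂.proj.hom.app _ p₂ := (P₁.proj_smul _ _).trans hp
      refine ⟨Quotient.mk (tensorSetoid P₁ P₂ _) ⟨(_, _), hg'⟩, ?_⟩
      exact (b.smul_left g _ _ hp hg').trans hg
  rw [← b.toTensorSheaf_sheafLift] at key
  exact J.W.of_precomp _ _ (W_toTensorSheaf P₁ P₂) key

/-- A morphism whose underlying morphism of sheaves is an isomorphism is an isomorphism. -/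
noncomputable def isoOfIsIso {P R : GObj G X} (a : P ⟶ R) (ha : IsIso a.hom) : P ≅ R where
  hom := a
  inv :=
    { hom := inv a.hom
      proj := fun {T} r => by
        have h1 : a.hom.hom.app T ((inv a.hom).hom.app T r) = r := by
          rw [← ConcreteCategory.comp_apply, ← NatTrans.comp_app,
            ← ObjectProperty.FullSubcategory.comp_hom, IsIso.inv_hom_id]
          rfl
        rw [← a.proj, h1]
      map_smul := fun {T} g r => by
        have h1 : ∀ r, a.hom.hom.app T ((inv a.hom).hom.app T r) = r := fun r => by
          rw [← ConcreteCategory.comp_apply, ← NatTrans.comp_app,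
            ← ObjectProperty.FullSubcategory.comp_hom, IsIso.inv_hom_id]
          rfl
        have h2 : ∀ p, (inv a.hom).hom.app T (a.hom.hom.app T p) = p := fun p => by
          rw [← ConcreteCategory.comp_apply, ← NatTrans.comp_app,
            ← ObjectProperty.FullSubcategory.comp_hom, IsIso.hom_inv_id]
          rfl
        rw [← h2 (P.smul g _), a.map_smul, h1] }
  hom_inv_id := Hom.ext (IsIso.hom_inv_id a.hom)
  inv_hom_id := Hom.ext (IsIso.inv_hom_id a.hom)

end GObj

/-! ### Multiplicative torsors -/

namespace GObj

variable {X Y : Sheaf J (Type (max u v))}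

/-- The section `(p, y)` of `P ×_X Y`. -/
def pullbackMk (P : GObj G X) (f : Y ⟶ X) {T : Cᵒᵖ} (p : P.sheaf.obj.obj T) (y : Y.obj.obj T)
    (h : P.proj.hom.app T p = f.hom.app T y) : (P.pullback f).sheaf.obj.obj T :=
  ⟨(p, y), h⟩

theorem pullbackMk_congr (P : GObj G X) (f : Y ⟶ X) {T : Cᵒᵖ} {p p' : P.sheaf.obj.obj T}
    {y y' : Y.obj.obj T} (h : P.proj.hom.app T p = f.hom.app T y)
    (h' : P.proj.hom.app T p' = f.hom.app T y') (e : p = p') (e' : y = y') :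
    P.pullbackMk f p y h = P.pullbackMk f p' y' h' := by
  subst e e'
  rfl

variable {Q : CommSemigroupSheaf J}

/-- For sections `p`, `q` of `P` over `x`, `y`, the section `p ⊗ q` of `p₁⁻¹ P ⊗ p₂⁻¹ P`
over `(x, y)`. -/
noncomputable def boxMul (P : GObj G Q.sheaf) {T : Cᵒᵖ} (p q : P.sheaf.obj.obj T) :
    ((P.pullback (prodFst Q.sheaf Q.sheaf)).tensor
      (P.pullback (prodSnd Q.sheaf Q.sheaf))).sheaf.obj.obj T :=
  tmul (P.pullbackMk (prodFst Q.sheaf Q.sheaf) p (P.proj.hom.app T p, P.proj.hom.app T q) rfl)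
    (P.pullbackMk (prodSnd Q.sheaf Q.sheaf) q (P.proj.hom.app T p, P.proj.hom.app T q) rfl) rfl

end GObj

variable (G) in
/-- A multiplicative `G`-torsor over a commutative semigroup `Q`: a `G`-torsor `P` over `Q`
together with an isomorphism `θ : p₁⁻¹ P ⊗ p₂⁻¹ P ⟶ m⁻¹ P` of `G`-torsors over `Q × Q`
which is symmetric and associative.

The sheaf `p₁⁻¹ P ⊗ p₂⁻¹ P` is locally generated by the sections `p ⊗ q`, and similarly for
the threefold product over `Q × Q × Q`. So, writing `p * q` for the component in `P` of
`θ(p ⊗ q)`, the commutativity of the symmetry diagram says `θ(p ⊗ q) = θ(q ⊗ p)`, that is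
`p * q = q * p`, and the commutativity of the associativity diagram says
`θ(θ(p ⊗ q) ⊗ r) = θ(p ⊗ θ(q ⊗ r))`, that is `(p * q) * r = p * (q * r)`. -/
structure MultTorsor (Q : CommSemigroupSheaf J) where
  /-- the underlying sheaf over `Q` with action of `G` -/
  P : GObj G Q.sheaf
  isTorsor : P.IsTorsor
  /-- the multiplicative structure -/
  θ : (P.pullback (prodFst Q.sheaf Q.sheaf)).tensor (P.pullback (prodSnd Q.sheaf Q.sheaf)) ≅
    P.pullback Q.mulHom
  symmetry : ∀ {T : Cᵒᵖ} (p q : P.sheaf.obj.obj T),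
    (θ.hom.hom.hom.app T (P.boxMul p q)).1.1 = (θ.hom.hom.hom.app T (P.boxMul q p)).1.1
  associativity : ∀ {T : Cᵒᵖ} (p q r : P.sheaf.obj.obj T),
    (θ.hom.hom.hom.app T
      (P.boxMul (θ.hom.hom.hom.app T (P.boxMul p q)).1.1 r)).1.1 =
    (θ.hom.hom.hom.app T
      (P.boxMul p (θ.hom.hom.hom.app T (P.boxMul q r)).1.1)).1.1

namespace MultTorsor

variable {M Q : CommSemigroupSheaf J}

/-- The section `p * q` of `P` over `x y` which is the component in `P` of `θ(p ⊗ q)`,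
for sections `p`, `q` of `P` over `x`, `y`. -/
noncomputable def mul (A : MultTorsor G Q) {T : Cᵒᵖ} (p q : A.P.sheaf.obj.obj T) :
    A.P.sheaf.obj.obj T :=
  (A.θ.hom.hom.hom.app T (A.P.boxMul p q)).1.1

/-- Morphisms of multiplicative `G`-torsors: morphisms `f` of `G`-torsors over `Q` compatible
with the multiplicative structures, that is, `f(p * q) = f(p) * f(q)`. -/
@[ext]
structure Hom (A B : MultTorsor G Q) where
  /-- the underlying morphism of torsors -/
  hom : A.P ⟶ B.P
  map_mul : ∀ {T : Cᵒᵖ} (p q : A.P.sheaf.obj.obj T),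
    hom.hom.hom.app T (A.mul p q) = B.mul (hom.hom.hom.app T p) (hom.hom.hom.app T q)

/-- The category `Tors^⊗(Q, G)` of multiplicative `G`-torsors over `Q`. -/
instance : Category (MultTorsor G Q) where
  Hom := Hom
  id A := { hom := 𝟙 _, map_mul := fun _ _ => rfl }
  comp f g :=
    { hom := f.hom ≫ g.hom
      map_mul := fun p q =>
        (congrArg (g.hom.hom.hom.app _) (f.map_mul p q)).trans (g.map_mul _ _) }

section

variable (A : MultTorsor G Q)

theorem proj_mul {T : Cᵒᵖ} (p q : A.P.sheaf.obj.obj T) :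
    A.P.proj.hom.app T (A.mul p q) = Q.mul (A.P.proj.hom.app T p) (A.P.proj.hom.app T q) := by
  refine (A.θ.hom.hom.hom.app T (A.P.boxMul p q)).2.trans ?_
  have h : (A.θ.hom.hom.hom.app T (A.P.boxMul p q)).1.2 =
      (A.P.proj.hom.app T p, A.P.proj.hom.app T q) :=
    (A.θ.hom.proj (A.P.boxMul p q)).trans (GObj.tensorProj_tmul _ _ _)
  exact congrArg (fun s => Q.mul s.1 s.2) h

theorem map_mul {T T' : Cᵒᵖ} (f : T ⟶ T') (p q : A.P.sheaf.obj.obj T) :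
    A.P.sheaf.obj.map f (A.mul p q) =
      A.mul (A.P.sheaf.obj.map f p) (A.P.sheaf.obj.map f q) := by
  have h := NatTrans.naturality_apply A.θ.hom.hom.hom f (A.P.boxMul p q)
  refine (congrArg (fun s => s.1.1) h).symm.trans ?_
  refine congrArg (fun s => (A.θ.hom.hom.hom.app T' s).1.1) ?_
  refine (GObj.map_tmul f _ _ _).trans (GObj.tmul_congr ?_ ?_)
  · exact Subtype.ext (Prod.ext rfl (Prod.ext (NatTrans.naturality_apply _ _ _).symm
      (NatTrans.naturality_apply _ _ _).symm))
  · exact Subtype.ext (Prod.ext rfl (Prod.ext (NatTrans.naturality_apply _ _ _).symm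
      (NatTrans.naturality_apply _ _ _).symm))

theorem smul_mul {T : Cᵒᵖ} (g : G.obj.obj T) (p q : A.P.sheaf.obj.obj T) :
    A.mul (A.P.smul g p) q = A.P.smul g (A.mul p q) := by
  refine Eq.trans ?_ (congrArg (fun s => s.1.1) (A.θ.hom.map_smul g (A.P.boxMul p q)))
  refine congrArg (fun s => (A.θ.hom.hom.hom.app T s).1.1) ?_
  refine Eq.trans ?_ (GObj.smul_tmul g _ _ _)
  exact GObj.tmul_congr
    (GObj.pullbackMk_congr _ _ _ _ rfl (congrArg (fun x => (x, A.P.proj.hom.app T q)) (A.P.proj_smul g p)))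
    (GObj.pullbackMk_congr _ _ _ _ rfl (congrArg (fun x => (x, A.P.proj.hom.app T q)) (A.P.proj_smul g p)))

theorem mul_smul {T : Cᵒᵖ} (g : G.obj.obj T) (p q : A.P.sheaf.obj.obj T) :
    A.mul p (A.P.smul g q) = A.P.smul g (A.mul p q) :=
  (A.symmetry _ _).trans ((A.smul_mul g q p).trans (congrArg _ (A.symmetry _ _)))

end

/-- The pairing `p₁⁻¹ P × p₂⁻¹ P ⟶ m⁻¹ P` over `Q × Q` defined by a `G`-biequivariant
multiplication on `P` over that of `Q`. -/
def pairingOfMul (P : GObj G Q.sheaf)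
    (mul : ∀ {T : Cᵒᵖ}, P.sheaf.obj.obj T → P.sheaf.obj.obj T → P.sheaf.obj.obj T)
    (map_mul : ∀ {T T' : Cᵒᵖ} (f : T ⟶ T') (p q : P.sheaf.obj.obj T),
      P.sheaf.obj.map f (mul p q) = mul (P.sheaf.obj.map f p) (P.sheaf.obj.map f q))
    (proj_mul : ∀ {T : Cᵒᵖ} (p q : P.sheaf.obj.obj T),
      P.proj.hom.app T (mul p q) = Q.mul (P.proj.hom.app T p) (P.proj.hom.app T q))
    (smul_mul : ∀ {T : Cᵒᵖ} (g : G.obj.obj T) (p q : P.sheaf.obj.obj T),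
      mul (P.smul g p) q = P.smul g (mul p q))
    (mul_smul : ∀ {T : Cᵒᵖ} (g : G.obj.obj T) (p q : P.sheaf.obj.obj T),
      mul p (P.smul g q) = P.smul g (mul p q)) :
    GObj.Pairing (P.pullback (prodFst Q.sheaf Q.sheaf)) (P.pullback (prodSnd Q.sheaf Q.sheaf))
      (P.pullback Q.mulHom) where
  map {T} s t h := P.pullbackMk Q.mulHom (mul s.1.1 t.1.1) s.1.2 (by
    have h' : s.1.2 = t.1.2 := h
    have hs : P.proj.hom.app T s.1.1 = s.1.2.1 := s.2
    have ht : P.proj.hom.app T t.1.1 = t.1.2.2 := t.2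
    refine (proj_mul _ _).trans ?_
    rw [hs, ht, ← h']
    rfl)
  map_map f s t _ _ := Subtype.ext (Prod.ext (map_mul f s.1.1 t.1.1) rfl)
  proj_map _ _ _ := rfl
  smul_left g s t _ _ := Subtype.ext (Prod.ext (smul_mul g s.1.1 t.1.1) rfl)
  smul_right g s t _ _ := Subtype.ext (Prod.ext (mul_smul g s.1.1 t.1.1) rfl)

theorem pairingOfMul_lift (P : GObj G Q.sheaf)
    (mul : ∀ {T : Cᵒᵖ}, P.sheaf.obj.obj T → P.sheaf.obj.obj T → P.sheaf.obj.obj T)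
    (h₁ h₂ h₃ h₄) {T : Cᵒᵖ} (p q : P.sheaf.obj.obj T) :
    ((pairingOfMul P mul h₁ h₂ h₃ h₄).lift.hom.hom.app T (P.boxMul p q)).1.1 = mul p q := by
  have h : (pairingOfMul P mul h₁ h₂ h₃ h₄).lift.hom.hom.app T (P.boxMul p q) =
      (pairingOfMul P mul h₁ h₂ h₃ h₄).map _ _ _ := GObj.Pairing.lift_tmul _ _ _ _
  exact congrArg (fun s => s.1.1) h

/-- The multiplicative torsor whose isomorphism `θ : p₁⁻¹ P ⊗ p₂⁻¹ P ⟶ m⁻¹ P` is given by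
`θ(p ⊗ q) = p * q`, for a `G`-biequivariant commutative and associative multiplication on a
torsor `P` over the multiplication of `Q`. -/
noncomputable def ofMul (P : GObj G Q.sheaf) (hP : P.IsTorsor)
    (mul : ∀ {T : Cᵒᵖ}, P.sheaf.obj.obj T → P.sheaf.obj.obj T → P.sheaf.obj.obj T)
    (map_mul : ∀ {T T' : Cᵒᵖ} (f : T ⟶ T') (p q : P.sheaf.obj.obj T),
      P.sheaf.obj.map f (mul p q) = mul (P.sheaf.obj.map f p) (P.sheaf.obj.map f q))
    (proj_mul : ∀ {T : Cᵒᵖ} (p q : P.sheaf.obj.obj T),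
      P.proj.hom.app T (mul p q) = Q.mul (P.proj.hom.app T p) (P.proj.hom.app T q))
    (smul_mul : ∀ {T : Cᵒᵖ} (g : G.obj.obj T) (p q : P.sheaf.obj.obj T),
      mul (P.smul g p) q = P.smul g (mul p q))
    (mul_smul : ∀ {T : Cᵒᵖ} (g : G.obj.obj T) (p q : P.sheaf.obj.obj T),
      mul p (P.smul g q) = P.smul g (mul p q))
    (mul_comm : ∀ {T : Cᵒᵖ} (p q : P.sheaf.obj.obj T), mul p q = mul q p)
    (mul_assoc : ∀ {T : Cᵒᵖ} (p q r : P.sheaf.obj.obj T),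
      mul (mul p q) r = mul p (mul q r)) : MultTorsor G Q where
  P := P
  isTorsor := hP
  θ := GObj.isoOfIsIso (pairingOfMul P mul map_mul proj_mul smul_mul mul_smul).lift
    (GObj.Pairing.isIso_sheafLift _ (hP.pullback _) (hP.pullback _) (hP.pullback _))
  symmetry {T} p q := by
    have key : ∀ p q : P.sheaf.obj.obj T,
        ((pairingOfMul P mul map_mul proj_mul smul_mul mul_smul).lift.hom.hom.app T
          (P.boxMul p q)).1.1 = mul p q := pairingOfMul_lift P mul _ _ _ _
    exact (key p q).trans ((mul_comm p q).trans (key q p).symm)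
  associativity {T} p q r := by
    have key : ∀ p q : P.sheaf.obj.obj T,
        ((pairingOfMul P mul map_mul proj_mul smul_mul mul_smul).lift.hom.hom.app T
          (P.boxMul p q)).1.1 = mul p q := pairingOfMul_lift P mul _ _ _ _
    refine (key _ _).trans (Eq.trans ?_ (key _ _).symm)
    refine (congrArg (fun s => mul s r) (key p q)).trans ?_
    exact (mul_assoc p q r).trans (congrArg (fun s => mul p s) (key q r)).symm

theorem ofMul_mul (P : GObj G Q.sheaf) (hP : P.IsTorsor)
    (mul : ∀ {T : Cᵒᵖ}, P.sheaf.obj.obj T → P.sheaf.obj.obj T → P.sheaf.obj.obj T)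
    (h₁ h₂ h₃ h₄ h₅ h₆) {T : Cᵒᵖ} (p q : P.sheaf.obj.obj T) :
    (ofMul P hP mul h₁ h₂ h₃ h₄ h₅ h₆).mul p q = mul p q :=
  pairingOfMul_lift P mul _ _ _ _ p q

/-- The pullback of a multiplicative torsor `A` over `Q` along a morphism `f : M ⟶ Q` of
commutative semigroups: the torsor `P ×_Q M` with the pullback of `θ`, that is,
`θ((p, x) ⊗ (q, y)) = (θ(p ⊗ q), x y)`. -/
noncomputable def pullback (f : SemigroupHom M Q) (A : MultTorsor G Q) : MultTorsor G M :=
  ofMul (A.P.pullback f.hom) (A.isTorsor.pullback f.hom)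
    (fun {T} s t => A.P.pullbackMk f.hom (A.mul s.1.1 t.1.1) (M.mul s.1.2 t.1.2) (by
      have hs : A.P.proj.hom.app T s.1.1 = f.hom.hom.app T s.1.2 := s.2
      have ht : A.P.proj.hom.app T t.1.1 = f.hom.hom.app T t.1.2 := t.2
      rw [A.proj_mul, f.map_mul, hs, ht]))
    (fun i s t => Subtype.ext (Prod.ext (A.map_mul i s.1.1 t.1.1) (M.map_mul i s.1.2 t.1.2)))
    (fun _ _ => rfl)
    (fun g s t => Subtype.ext (Prod.ext (A.smul_mul g s.1.1 t.1.1) rfl))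
    (fun g s t => Subtype.ext (Prod.ext (A.mul_smul g s.1.1 t.1.1) rfl))
    (fun s t => Subtype.ext (Prod.ext (A.symmetry s.1.1 t.1.1) (M.mul_comm s.1.2 t.1.2)))
    (fun s t r => Subtype.ext
      (Prod.ext (A.associativity s.1.1 t.1.1 r.1.1) (M.mul_assoc s.1.2 t.1.2 r.1.2)))

theorem pullback_mul (f : SemigroupHom M Q) (A : MultTorsor G Q) {T : Cᵒᵖ}
    (s t : (pullback f A).P.sheaf.obj.obj T) :
    ((pullback f A).mul s t).1 = (A.mul s.1.1 t.1.1, M.mul s.1.2 t.1.2) :=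
  congrArg Subtype.val (ofMul_mul (A.P.pullback f.hom) _ _ _ _ _ _ _ _ s t)

variable (G) in
/-- The pullback functor `Tors^⊗(Q, G) ⥤ Tors^⊗(M, G)` along a morphism `f : M ⟶ Q` of
commutative semigroups. -/
noncomputable def pullbackFunctor (f : SemigroupHom M Q) : MultTorsor G Q ⥤ MultTorsor G M where
  obj A := pullback f A
  map {A B} a :=
    { hom :=
        { hom := ObjectProperty.homMk
            { app := fun T => ↾fun s => B.P.pullbackMk f.hom (a.hom.hom.hom.app T s.1.1) s.1.2
                ((a.hom.proj s.1.1).trans s.2)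
              naturality := fun T T' i => by
                ext s
                exact GObj.pullbackMk_congr B.P f.hom _ _
                  (NatTrans.naturality_apply a.hom.hom.hom i _) rfl }
          proj := fun _ => rfl
          map_smul := fun g s => Subtype.ext (Prod.ext (a.hom.map_smul g s.1.1) rfl) }
      map_mul := fun {T} s t => by
        refine Subtype.ext (Eq.trans ?_ (pullback_mul f B _ _).symm)
        have h := pullback_mul f A s t
        refine Prod.ext ?_ ((congrArg (fun z => z.2) h :))
        exact (congrArg (fun z => a.hom.hom.hom.app T z.1) h).trans (a.map_mul s.1.1 t.1.1) }
  map_id _ := rfl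
  map_comp _ _ := rfl

end MultTorsor

end Site

section Scheme

open AlgebraicGeometry MonoidalCategory CartesianMonoidalCategory
open scoped MonObj

universe u

/-- The étale topology on the category of `S`-schemes. The big étale topos of `S` is the
category of sheaves of sets for this topology. -/
abbrev bigEtale (S : Scheme.{u}) : GrothendieckTopology (Over S) :=
  Scheme.etaleTopology.over S

instance : Scheme.etaleTopology.{u}.Subcanonical :=
  .of_le (Scheme.etaleTopology_le_proetaleTopology.trans
    Scheme.proetaleTopology_le_fpqcTopology)

/-- The presheaf of abelian groups on the category of schemes whose sections over `T` are the
locally constant functions `T → G`. -/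
def locallyConstantPresheaf (G : Type u) [CommGroup G] :
    Scheme.{u}ᵒᵖ ⥤ CommGrpCat.{u + 1} where
  obj T := CommGrpCat.of (LocallyConstant T.unop (ULift.{u + 1} G))
  map f := CommGrpCat.ofHom (LocallyConstant.comapMonoidHom f.unop.base.hom)

theorem isSheaf_locallyConstantPresheaf (G : Type u) [CommGroup G] :
    Presheaf.IsSheaf Scheme.etaleTopology.{u} (locallyConstantPresheaf G) := by
  apply Presheaf.isSheaf_of_isSheaf_comp _ _ (forget CommGrpCat)
  let t : TopologicalSpace (ULift.{u + 1} G) := ⊥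
  have : DiscreteTopology (ULift.{u + 1} G) := ⟨rfl⟩
  have h := isSheaf_fpqcTopology_continuousMapPresheaf.{u + 1, u} (ULift.{u + 1} G)
  have h' : Presheaf.IsSheaf Scheme.etaleTopology.{u}
      (continuousMapPresheaf.{u + 1, u} (ULift.{u + 1} G)) :=
    Presheaf.IsSheaf.of_le (Scheme.etaleTopology_le_proetaleTopology.trans
      Scheme.proetaleTopology_le_fpqcTopology) h
  refine (Presheaf.isSheaf_of_iso_iff ?_).1 h'
  refine NatIso.ofComponents (fun T => Equiv.toIso
    { toFun := fun (g : C(T.unop, ULift.{u + 1} G)) =>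
        (⟨g, IsLocallyConstant.iff_continuous _ |>.2 g.continuous⟩ :
          LocallyConstant T.unop (ULift.{u + 1} G))
      invFun := fun (g : LocallyConstant T.unop (ULift.{u + 1} G)) =>
        (g : C(T.unop, ULift.{u + 1} G))
      left_inv := fun _ => rfl
      right_inv := fun _ => rfl }) ?_
  intro T T' f
  rfl

/-- The constant sheaf of abelian groups with value `G` in the big étale topos of `S`. -/
noncomputable def constantGroup (S : Scheme.{u}) (G : Type u) [CommGroup G] :
    Sheaf (bigEtale S) CommGrpCat.{u + 1} :=
  (Scheme.etaleTopology.overPullback CommGrpCat.{u + 1} S).obj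
    ⟨locallyConstantPresheaf G, isSheaf_locallyConstantPresheaf G⟩

/-- A commutative semigroup in the category of `S`-schemes (a commutative `S`-semigroup
scheme), with or without identity. -/
structure CommSemigroupScheme (S : Scheme.{u}) where
  /-- the underlying `S`-scheme -/
  X : Over S
  /-- the multiplication -/
  mul : X ⊗ X ⟶ X
  mul_assoc : mul ▷ X ≫ mul = (α_ X X X).hom ≫ X ◁ mul ≫ mul
  mul_comm : (β_ X X).hom ≫ mul = mul

variable {S : Scheme.{u}}

/-- The semigroup in the big étale topos of `S` represented by a commutative `S`-semigroup
scheme: its sections over `T` are the morphisms of `S`-schemes from `T` to it. -/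
noncomputable def CommSemigroupScheme.toSheaf (M : CommSemigroupScheme S) :
    CommSemigroupSheaf (bigEtale S) where
  sheaf := (GrothendieckTopology.uliftYoneda.{u + 1} (bigEtale S)).obj M.X
  mul x y := ⟨lift x.down y.down ≫ M.mul⟩
  map_mul f x y := congrArg ULift.up (by
    change f.unop ≫ lift x.down y.down ≫ M.mul =
      lift (f.unop ≫ x.down) (f.unop ≫ y.down) ≫ M.mul
    rw [← Category.assoc, comp_lift])
  mul_assoc x y z := congrArg ULift.up (by
    have h := lift (lift x.down y.down) z.down ≫= M.mul_assoc
    simpa using h)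
  mul_comm x y := congrArg ULift.up (by
    have h := lift y.down x.down ≫= M.mul_comm
    simpa using h)

/-- The semigroup scheme underlying a commutative `S`-group scheme. -/
def ofCommGroupScheme (Q : Over S) [GrpObj Q] [IsCommMonObj Q] : CommSemigroupScheme S where
  X := Q
  mul := μ[Q]
  mul_assoc := MonObj.mul_assoc Q
  mul_comm := IsCommMonObj.mul_comm Q

/-- A sub-`S`-semigroup scheme of an `S`-group scheme `Q`: an `S`-scheme with a monomorphism
to `Q` (for instance an immersion), stable under the multiplication of `Q`. -/
structure SubSemigroupScheme (Q : Over S) [GrpObj Q] where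
  /-- the underlying `S`-scheme -/
  X : Over S
  /-- the inclusion -/
  incl : X ⟶ Q
  mono_incl : Mono incl
  /-- the multiplication -/
  mul : X ⊗ X ⟶ X
  mul_incl : mul ≫ incl = (incl ⊗ₘ incl) ≫ μ[Q]

namespace SubSemigroupScheme

variable {Q : Over S} [GrpObj Q]

/-- The morphism `(x, y) ↦ x y⁻¹` from `M ×_S M` to `Q`. -/
noncomputable def divHom (M : SubSemigroupScheme Q) : M.X ⊗ M.X ⟶ Q :=
  lift (fst M.X M.X ≫ M.incl) (snd M.X M.X ≫ M.incl ≫ ι[Q]) ≫ μ[Q]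

theorem lift_mul_incl (M : SubSemigroupScheme Q) {T : Over S} (x y : T ⟶ M.X) :
    (lift x y ≫ M.mul) ≫ M.incl = lift (x ≫ M.incl) (y ≫ M.incl) ≫ μ[Q] := by
  rw [Category.assoc, M.mul_incl, ← Category.assoc, lift_map]

variable [IsCommMonObj Q]

/-- A sub-semigroup scheme of a commutative group scheme, as a commutative semigroup scheme. -/
noncomputable def toCommSemigroupScheme (M : SubSemigroupScheme Q) : CommSemigroupScheme S where
  X := M.X
  mul := M.mul
  mul_assoc := by
    have := M.mono_incl
    rw [← cancel_mono M.incl]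
    have h1 : M.mul ▷ M.X ≫ M.mul ≫ M.incl =
        ((M.incl ⊗ₘ M.incl) ⊗ₘ M.incl) ≫ μ[Q] ▷ Q ≫ μ[Q] := by
      rw [M.mul_incl, ← Category.assoc, ← Category.assoc]
      congr 1
      rw [← tensorHom_id, ← tensorHom_id, tensorHom_comp_tensorHom, tensorHom_comp_tensorHom,
        M.mul_incl, Category.id_comp, Category.comp_id]
    have h2 : M.X ◁ M.mul ≫ M.mul ≫ M.incl =
        (M.incl ⊗ₘ (M.incl ⊗ₘ M.incl)) ≫ Q ◁ μ[Q] ≫ μ[Q] := by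
      rw [M.mul_incl, ← Category.assoc, ← Category.assoc]
      congr 1
      rw [← id_tensorHom, ← id_tensorHom, tensorHom_comp_tensorHom, tensorHom_comp_tensorHom,
        M.mul_incl, Category.id_comp, Category.comp_id]
    simp only [Category.assoc]
    rw [h1, h2, MonObj.mul_assoc, associator_naturality_assoc]
  mul_comm := by
    have := M.mono_incl
    rw [← cancel_mono M.incl]
    simp only [Category.assoc, M.mul_incl]
    rw [← BraidedCategory.braiding_naturality_assoc, IsCommMonObj.mul_comm]

/-- The inclusion of a sub-semigroup scheme, as a morphism of semigroups of the big étale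
topos of `S`. -/
noncomputable def inclusion (M : SubSemigroupScheme Q) :
    SemigroupHom M.toCommSemigroupScheme.toSheaf (ofCommGroupScheme Q).toSheaf where
  hom := (GrothendieckTopology.uliftYoneda.{u + 1} (bigEtale S)).map M.incl
  map_mul x y := congrArg ULift.up (M.lift_mul_incl x.down y.down)

end SubSemigroupScheme

end Scheme

end MultTors

universe u

/-!
Let `M ⊆ Q` be as in the statement, and call `J` the étale topology and `K` the fpqc topology on
the category of `S`-schemes. The hypothesis on `ρ` says that every section of `Q` is, `K`-locally,
a quotient `m n⁻¹` of sections of `M`. Write `p * q` for `θ(p ⊗ q)`: a multiplicative torsor is a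
torsor with a biequivariant, commutative and associative multiplication over that of the
semigroup.

*Full faithfulness.* A morphism `W` of multiplicative torsors over `Q` satisfies
`W(a) * w(q) = w(a * q)`, where `w` is its restriction to `M` and `q` is a section over `M` such
that `a * q` lies over `M`. Such sections `q` exist `K`-locally, and multiplicative torsors over the group `Q` have
cancellation, so `W` is determined by `w`. Conversely these equations define `W` for a given `w`,
since étale torsors under `G` over `Q` are sheaves for `K` (`IsTorsor.isSheaf_of_le`); see
`pullbackFunctor_full` and `pullbackFunctor_faithful`.

*Essential surjectivity.* For a multiplicative torsor `P` over `M`, the disjoint union `G ⊔ P` is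
a presheaf of commutative monoids. The `K`-sheaf associated with its group completion is an
extension of `Q` by `G` for the topology `K` (`exists_completionIncl_eq`,
`isLocallySurjective_completionObj`), and this extension is a `K`-torsor over `Q` into which `P`
maps over `M`. It remains to show that the torsor is trivial locally for the étale topology
(`pullbackFunctor_isEquivalence`).

*From fpqc to étale torsors.* Over an affine scheme `Spec A`, a `K`-torsor acquires a section over
`Spec B` for a faithfully flat algebra `B` (a finite affine cover is replaced by its disjoint
union). Comparing the two pullbacks of this section gives a cocycle `c : Spec (B ⊗ B) → G`, that
is, a family of idempotents of `B ⊗ B`. By faithfully flat descent the twisted form of `B^G`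
defined by `c` is an étale `A`-algebra `C` (`etale_descentRing`), and `Spec C → Spec A` is
surjective. Over `Spec (C ⊗ B)` the cocycle becomes the coboundary of a tautological function
(`map_tautIdem`), so that the section, translated by this function, descends to `Spec C`
(`exists_section_descentRing`). The torsor is treated as a sheaf throughout: its representability
by a scheme is not needed.
-/

namespace MultTors

section TwoTopologies

universe w v

variable {C : Type u} [Category.{v} C] {J K : GrothendieckTopology C}

/-! ### Local arguments for sheaves of sets -/

theorem eq_of_locally_eq {F : Cᵒᵖ ⥤ Type w} (hF : Presieve.IsSheaf K F) {T : C}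
    {s t : F.obj (op T)} {R : Sieve T} (hR : R ∈ K T)
    (h : ∀ ⦃U : C⦄ (f : U ⟶ T), R f → F.map f.op s = F.map f.op t) : s = t :=
  (hF R hR).isSeparatedFor.ext h

/-- In a sheaf, sections that exist locally and are characterized by a property stable under
restriction glue. -/
theorem exists_of_locally_unique {F : Cᵒᵖ ⥤ Type w} (hF : Presieve.IsSheaf K F) {T : C}
    (Φ : ∀ ⦃U : C⦄, (U ⟶ T) → F.obj (op U) → Prop)
    (hres : ∀ ⦃U V : C⦄ (f : U ⟶ T) (g : V ⟶ U) s, Φ f s → Φ (g ≫ f) (F.map g.op s))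
    (huniq : ∀ ⦃U : C⦄ (f : U ⟶ T) s t, Φ f s → Φ f t → s = t)
    {R : Sieve T} (hR : R ∈ K T) (hex : ∀ ⦃U : C⦄ (f : U ⟶ T), R f → ∃ s, Φ f s) :
    ∃ s : F.obj (op T), ∀ ⦃U : C⦄ (f : U ⟶ T), R f → Φ f (F.map f.op s) := by
  choose x hx using hex
  have hcomp : Presieve.FamilyOfElements.Compatible (P := F) (R := R.arrows) x := by
    intro U₁ U₂ W g₁ g₂ f₁ f₂ h₁ h₂ e
    refine huniq (g₁ ≫ f₁) _ _ (hres _ _ _ (hx f₁ h₁)) ?_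
    rw [e]
    exact hres _ _ _ (hx f₂ h₂)
  refine ⟨(hF R hR).amalgamate x hcomp, fun U f hf => ?_⟩
  rw [(hF R hR).valid_glue hcomp f hf]
  exact hx f hf

/-! ### Torsors under a sheaf for a finer topology -/


variable {G : Sheaf J CommGrpCat.{max u v}}

namespace GObj

variable {X : Sheaf J (Type (max u v))}

/-- Over a sheaf `X` for a topology `K` finer than `J`, and under a sheaf of groups `G` for `K`,
a `J`-torsor is a sheaf for `K`: `J`-locally it is isomorphic to `G × X`. -/
theorem IsTorsor.isSheaf_of_le (hG : Presieve.IsSheaf K (G.obj ⋙ forget CommGrpCat))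
    (hX : Presieve.IsSheaf K X.obj) {P : GObj G X} (hP : P.IsTorsor) :
    Presieve.IsSheaf K P.sheaf.obj := by
  have hPJ := (isSheaf_iff_isSheaf_of_type J _).1 P.sheaf.property
  have sep : ∀ {T : C} (p q : P.sheaf.obj.obj (op T)) (R : Sieve T), R ∈ K T →
      (∀ ⦃U : C⦄ (f : U ⟶ T), R f → P.sheaf.obj.map f.op p = P.sheaf.obj.map f.op q) →
      p = q := by
    intro T p q R hR h
    have e : P.proj.hom.app _ p = P.proj.hom.app _ q := by
      refine eq_of_locally_eq hX hR fun U f hf => ?_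
      rw [← NatTrans.naturality_apply, ← NatTrans.naturality_apply, h f hf]
    obtain ⟨g, rfl⟩ := hP.exists_smul p q e
    have : g = 1 := by
      refine eq_of_locally_eq hG hR fun U f hf => ?_
      refine hP.smul_injective (P.sheaf.obj.map f.op q) _ _ ?_
      refine (P.map_smul _ _ _).symm.trans ((h f hf).trans ?_)
      refine (P.one_smul _).symm.trans (congrArg (fun z => P.smul z _) ?_)
      exact (_root_.map_one (G.obj.map f.op).hom).symm
    rw [this, P.one_smul]
  intro T R hR x hx
  have hy : Presieve.FamilyOfElements.Compatible (P := X.obj) (R := R.arrows)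
      (fun U f hf => P.proj.hom.app _ (x f hf)) := by
    intro U₁ U₂ W g₁ g₂ f₁ f₂ h₁ h₂ e
    simp only
    rw [← NatTrans.naturality_apply, ← NatTrans.naturality_apply, hx g₁ g₂ h₁ h₂ e]
  -- `y` is the section of `X` over which the glued section has to lie
  set y := (hX R hR).amalgamate _ hy
  have hyv : ∀ ⦃U : C⦄ (f : U ⟶ T) (hf : R f), X.obj.map f.op y = P.proj.hom.app _ (x f hf) :=
    fun U f hf => (hX R hR).valid_glue hy f hf
  have hls := hP.isLocallySurjective
  have hmem : ∀ {U : C} (f : U ⟶ T), R.pullback f ∈ K U := fun f => K.pullback_stable f hR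
  -- `J`-locally `P` has a section `q` over `y`; there the section to be found is `γ • q`, with `γ`
  -- glued for the topology `K`
  obtain ⟨r, hr⟩ := exists_of_locally_unique hPJ
    (fun U f s => ∀ ⦃V : C⦄ (g : V ⟶ U) (h : R (g ≫ f)),
      P.sheaf.obj.map g.op s = x (g ≫ f) h) (T := T) (by
      intro U V f g s hs W i h
      have h' : R ((i ≫ g) ≫ f) := by rwa [Category.assoc]
      have := hs (i ≫ g) h'
      rw [op_comp, Functor.map_comp_apply] at this
      rw [this]
      congr 1
      rw [Category.assoc]) (by
      intro U f s t hs ht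
      exact sep s t _ (hmem f) fun V g hg => (hs g hg).trans (ht g hg).symm)
    (Presheaf.imageSieve_mem J P.proj.hom y) (by
      rintro U f ⟨q, hq⟩
      obtain ⟨γ, hγ⟩ := exists_of_locally_unique hG
        (fun V g (γ : G.obj.obj (op V)) => ∃ h : R (g ≫ f),
          P.smul γ (P.sheaf.obj.map g.op q) = x (g ≫ f) h) (by
          rintro V W g i γ ⟨h, e⟩
          have h' : R ((i ≫ g) ≫ f) := by
            rw [Category.assoc]; exact R.downward_closed h i
          refine ⟨h', ?_⟩
          rw [op_comp, Functor.map_comp_apply]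
          refine (P.map_smul i.op γ _).symm.trans ?_
          rw [e]
          have := hx i (𝟙 W) h h' (by simp)
          rw [this]
          simp) (by
          rintro V g γ γ' ⟨h, e⟩ ⟨h', e'⟩
          exact hP.smul_injective _ _ _ (e.trans e'.symm)) (hmem f) (by
          intro V g hg
          obtain ⟨γ, e⟩ := hP.exists_smul (x (g ≫ f) hg) (P.sheaf.obj.map g.op q) (by
            rw [NatTrans.naturality_apply, hq, ← hyv (g ≫ f) hg, op_comp,
              Functor.map_comp_apply])
          exact ⟨γ, hg, e⟩)
      refine ⟨P.smul γ q, fun V g hg => ?_⟩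
      obtain ⟨h, e⟩ := hγ g hg
      rw [P.map_smul]
      exact e)
  have key : ∀ ⦃U : C⦄ (f : U ⟶ T) (hf : R f), P.sheaf.obj.map f.op r = x f hf := by
    intro U f hf
    refine eq_of_locally_eq hPJ (J.pullback_stable f (Presheaf.imageSieve_mem J P.proj.hom y))
      fun V g hg => ?_
    have h' : R (𝟙 V ≫ g ≫ f) := by
      rw [Category.id_comp]; exact R.downward_closed hf g
    have h₁ := hr (g ≫ f) hg (𝟙 V) h'
    have h₂ := hx (𝟙 V) g h' hf (by simp)
    rw [op_id, Functor.map_id_apply, op_comp, Functor.map_comp_apply] at h₁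
    rw [op_id, Functor.map_id_apply] at h₂
    exact h₁.trans h₂
  exact ⟨r, key, fun t ht => sep _ _ R hR fun U f hf => (ht f hf).trans (key f hf).symm⟩

end GObj

namespace GObj

variable {X : Sheaf J (Type (max u v))}

/-- A morphism of torsors is bijective on sections. -/
theorem IsTorsor.bijective_app {P R : GObj G X} (hP : P.IsTorsor) (hR : R.IsTorsor) (a : P ⟶ R)
    (T : C) : Function.Bijective (a.hom.hom.app (op T)) := by
  have inj : ∀ T : C, Function.Injective (a.hom.hom.app (op T)) := by
    intro T p q e
    obtain ⟨g, rfl⟩ := hP.exists_smul p q (by rw [← a.proj, ← a.proj, e])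
    rw [a.map_smul] at e
    rw [hR.smul_injective _ _ _ (e.trans (R.one_smul _).symm), P.one_smul]
  refine ⟨inj T, fun r => ?_⟩
  have hls := hP.isLocallySurjective
  have hcov := Presheaf.imageSieve_mem J P.proj.hom (R.proj.hom.app _ r)
  obtain ⟨p, hp⟩ := exists_of_locally_unique
    ((isSheaf_iff_isSheaf_of_type J _).1 P.sheaf.property)
    (fun U f p => a.hom.hom.app _ p = R.sheaf.obj.map f.op r) (T := T) (by
      intro U V f g p e
      rw [NatTrans.naturality_apply, e, op_comp, Functor.map_comp_apply])
    (fun U f p q e e' => inj _ (e.trans e'.symm)) hcov (by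
      rintro U f ⟨p, hp⟩
      obtain ⟨g, hg⟩ := hR.exists_smul (R.sheaf.obj.map f.op r) (a.hom.hom.app _ p) (by
        rw [NatTrans.naturality_apply, a.proj, hp])
      exact ⟨P.smul g p, (a.map_smul g p).trans hg⟩)
  refine ⟨p, eq_of_locally_eq ((isSheaf_iff_isSheaf_of_type J _).1 R.sheaf.property) hcov
    fun U f hf => ?_⟩
  rw [← NatTrans.naturality_apply, hp f hf]

theorem IsTorsor.isIso_hom {P R : GObj G X} (hP : P.IsTorsor) (hR : R.IsTorsor) (a : P ⟶ R) :
    IsIso a.hom := by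
  rw [← isIso_iff_of_reflects_iso _ (sheafToPresheaf J (Type (max u v))),
    NatTrans.isIso_iff_isIso_app]
  exact fun T => (isIso_iff_bijective _).2 (hP.bijective_app hR a T.unop)

end GObj

namespace MultTorsor

variable {M Q : CommSemigroupSheaf J}

/-- Every morphism of multiplicative torsors is an isomorphism. -/
theorem isIso_of_hom {A B : MultTorsor G Q} (a : A ⟶ B) : IsIso a := by
  have h := A.isTorsor.isIso_hom B.isTorsor a.hom
  let e := GObj.isoOfIsIso a.hom h
  have h1 : ∀ {T : Cᵒᵖ} (r : B.P.sheaf.obj.obj T),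
      a.hom.hom.hom.app T (e.inv.hom.hom.app T r) = r := fun {T} r =>
    congrArg (fun u : B.P ⟶ B.P => u.hom.hom.app T r) e.inv_hom_id
  let b : B ⟶ A :=
    { hom := e.inv
      map_mul := fun {T} p q => by
        refine (A.isTorsor.bijective_app B.isTorsor a.hom T.unop).1 ?_
        refine (h1 _).trans ((a.map_mul _ _).trans ?_).symm
        exact congrArg₂ B.mul (h1 p) (h1 q) }
  exact ⟨b, Hom.ext e.hom_inv_id, Hom.ext e.inv_hom_id⟩

theorem mul_assoc (A : MultTorsor G Q) {T : Cᵒᵖ} (p q r : A.P.sheaf.obj.obj T) :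
    A.mul (A.mul p q) r = A.mul p (A.mul q r) := A.associativity p q r

theorem mul_comm (A : MultTorsor G Q) {T : Cᵒᵖ} (p q : A.P.sheaf.obj.obj T) :
    A.mul p q = A.mul q p := A.symmetry p q

/-- Cancellation in a multiplicative torsor over a semigroup with cancellation. -/
theorem mul_right_cancel (A : MultTorsor G Q)
    (hQ : ∀ {T : Cᵒᵖ} (x y z : Q.sheaf.obj.obj T), Q.mul x z = Q.mul y z → x = y)
    {T : Cᵒᵖ} {p q r : A.P.sheaf.obj.obj T} (h : A.mul p r = A.mul q r) : p = q := by
  obtain ⟨g, rfl⟩ := A.isTorsor.exists_smul p q (hQ _ _ (A.P.proj.hom.app T r) (by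
    rw [← A.proj_mul, h, A.proj_mul]))
  rw [A.smul_mul] at h
  rw [A.isTorsor.smul_injective _ _ _ (h.trans (A.P.one_smul _).symm), A.P.one_smul]

/-! ### Full faithfulness of the restriction functor -/

section FullyFaithful

variable (K) in
/-- The morphism `M × M ⟶ Q`, `(x, y) ↦ x y⁻¹`, is locally surjective for `K`: every section
`z` of `Q` satisfies `K`-locally an equation `z * f(n) = f(m)` with sections `m`, `n` of `M`. -/
def LocallyGenerates (f : SemigroupHom M Q) : Prop :=
  ∀ {T : C} (z : Q.sheaf.obj.obj (op T)), ∃ R ∈ K T, ∀ ⦃U : C⦄ (i : U ⟶ T), R i →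
    ∃ m n : M.sheaf.obj.obj (op U),
      Q.mul (Q.sheaf.obj.map i.op z) (f.hom.hom.app _ n) = f.hom.hom.app _ m

variable {f : SemigroupHom M Q}

/-- Every section `z` of `Q` satisfies locally `z * f(n) = f(m)`, where moreover the torsor `A`
has a section over `f(n)`. -/
theorem LocallyGenerates.exists_section (hJK : J ≤ K) (hf : LocallyGenerates K f)
    (A : MultTorsor G Q) {T : C} (z : Q.sheaf.obj.obj (op T)) :
    ∃ R ∈ K T, ∀ ⦃U : C⦄ (i : U ⟶ T), R i →
      ∃ (q : A.P.sheaf.obj.obj (op U)) (m n : M.sheaf.obj.obj (op U)),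
        A.P.proj.hom.app _ q = f.hom.hom.app _ n ∧
        Q.mul (Q.sheaf.obj.map i.op z) (f.hom.hom.app _ n) = f.hom.hom.app _ m := by
  obtain ⟨R, hR, h⟩ := hf z
  refine ⟨Sieve.mk (fun U i => ∃ (q : A.P.sheaf.obj.obj (op U)) (m n : M.sheaf.obj.obj (op U)),
    A.P.proj.hom.app _ q = f.hom.hom.app _ n ∧
    Q.mul (Q.sheaf.obj.map i.op z) (f.hom.hom.app _ n) = f.hom.hom.app _ m) ?_, ?_,
    fun U i hi => hi⟩
  · rintro U V i ⟨q, m, n, h₁, h₂⟩ j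
    refine ⟨A.P.sheaf.obj.map j.op q, M.sheaf.obj.map j.op m, M.sheaf.obj.map j.op n, ?_, ?_⟩
    · rw [NatTrans.naturality_apply, NatTrans.naturality_apply, h₁]
    · rw [NatTrans.naturality_apply, NatTrans.naturality_apply, ← h₂, Q.map_mul, op_comp,
        Functor.map_comp_apply]
  · refine K.transitive hR _ fun U i hi => ?_
    obtain ⟨m, n, h₂⟩ := h i hi
    have hls := A.isTorsor.isLocallySurjective
    refine K.superset_covering ?_
      (hJK _ (Presheaf.imageSieve_mem J A.P.proj.hom (f.hom.hom.app _ n)))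
    rintro V j ⟨q, hq⟩
    refine ⟨q, M.sheaf.obj.map j.op m, M.sheaf.obj.map j.op n, ?_, ?_⟩
    · rw [hq, NatTrans.naturality_apply]
    · rw [NatTrans.naturality_apply, NatTrans.naturality_apply, ← h₂, Q.map_mul, op_comp,
        Functor.map_comp_apply]

variable {A B : MultTorsor G Q}

/-- A morphism between restrictions to `M`, on the sections of `A` lying over `M`. -/
noncomputable def restr (w : pullback f A ⟶ pullback f B) {T : Cᵒᵖ} (p : A.P.sheaf.obj.obj T)
    (m : M.sheaf.obj.obj T) (h : A.P.proj.hom.app T p = f.hom.hom.app T m) :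
    B.P.sheaf.obj.obj T :=
  (w.hom.hom.hom.app T (A.P.pullbackMk f.hom p m h)).1.1

section restr

variable (w : pullback f A ⟶ pullback f B) {T : Cᵒᵖ}

theorem app_pullbackMk (p : A.P.sheaf.obj.obj T) (m : M.sheaf.obj.obj T)
    (h : A.P.proj.hom.app T p = f.hom.hom.app T m) :
    (w.hom.hom.hom.app T (A.P.pullbackMk f.hom p m h)).1 = (restr w p m h, m) :=
  Prod.ext rfl (w.hom.proj (A.P.pullbackMk f.hom p m h))

theorem proj_restr (p : A.P.sheaf.obj.obj T) (m : M.sheaf.obj.obj T)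
    (h : A.P.proj.hom.app T p = f.hom.hom.app T m) :
    B.P.proj.hom.app T (restr w p m h) = f.hom.hom.app T m :=
  (w.hom.hom.hom.app T (A.P.pullbackMk f.hom p m h)).2.trans
    (congrArg (f.hom.hom.app T) (congrArg Prod.snd (app_pullbackMk w p m h)))

theorem map_restr {T' : Cᵒᵖ} (i : T ⟶ T') (p : A.P.sheaf.obj.obj T) (m : M.sheaf.obj.obj T)
    (h : A.P.proj.hom.app T p = f.hom.hom.app T m)
    (h' : A.P.proj.hom.app T' (A.P.sheaf.obj.map i p) = f.hom.hom.app T' (M.sheaf.obj.map i m)) :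
    B.P.sheaf.obj.map i (restr w p m h) =
      restr w (A.P.sheaf.obj.map i p) (M.sheaf.obj.map i m) h' :=
  (congrArg (fun s => s.1.1)
    (NatTrans.naturality_apply w.hom.hom.hom i (A.P.pullbackMk f.hom p m h))).symm

theorem restr_smul (g : G.obj.obj T) (p : A.P.sheaf.obj.obj T) (m : M.sheaf.obj.obj T)
    (h : A.P.proj.hom.app T p = f.hom.hom.app T m)
    (h' : A.P.proj.hom.app T (A.P.smul g p) = f.hom.hom.app T m) :
    restr w (A.P.smul g p) m h' = B.P.smul g (restr w p m h) :=
  congrArg (fun s => s.1.1) (w.hom.map_smul g (A.P.pullbackMk f.hom p m h))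

theorem restr_congr {p p' : A.P.sheaf.obj.obj T} {m m' : M.sheaf.obj.obj T} (e : p = p')
    (e' : m = m') (h h') : restr w p m h = restr w p' m' h' := by
  subst e e'; rfl

theorem restr_mul (p p' : A.P.sheaf.obj.obj T) (m m' : M.sheaf.obj.obj T)
    (h : A.P.proj.hom.app T p = f.hom.hom.app T m)
    (h' : A.P.proj.hom.app T p' = f.hom.hom.app T m')
    (h'' : A.P.proj.hom.app T (A.mul p p') = f.hom.hom.app T (M.mul m m')) :
    restr w (A.mul p p') (M.mul m m') h'' = B.mul (restr w p m h) (restr w p' m' h') := by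
  have e := w.map_mul (A.P.pullbackMk f.hom p m h) (A.P.pullbackMk f.hom p' m' h')
  have e' := congrArg (fun s => s.1.1) e
  refine Eq.trans ?_ (e'.trans (congrArg Prod.fst (pullback_mul f B _ _)))
  refine congrArg (fun s => (w.hom.hom.hom.app T s).1.1) ?_
  exact Subtype.ext (pullback_mul f A (A.P.pullbackMk f.hom p m h)
    (A.P.pullbackMk f.hom p' m' h')).symm

end restr
end FullyFaithful
end MultTorsor

namespace MultTorsor
variable {M Q : CommSemigroupSheaf J} {f : SemigroupHom M Q} {A B : MultTorsor G Q}

theorem mul_mul_mul_comm (A : MultTorsor G Q) {T : Cᵒᵖ} (p q r s : A.P.sheaf.obj.obj T) :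
    A.mul (A.mul p q) (A.mul r s) = A.mul (A.mul p r) (A.mul q s) := by
  rw [A.mul_assoc, A.mul_assoc, ← A.mul_assoc q, A.mul_comm q, A.mul_assoc r]

/-- There is a section `q` of `A` such that `q` and `a * q` lie over `M` and
`b * w(q) = w(a * q)`. -/
def ExtendsVia (w : pullback f A ⟶ pullback f B) {T : Cᵒᵖ} (a : A.P.sheaf.obj.obj T)
    (b : B.P.sheaf.obj.obj T) : Prop :=
  ∃ (q : A.P.sheaf.obj.obj T) (m n : M.sheaf.obj.obj T)
    (hq : A.P.proj.hom.app T q = f.hom.hom.app T n)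
    (hm : A.P.proj.hom.app T (A.mul a q) = f.hom.hom.app T m),
    B.mul b (restr w q n hq) = restr w (A.mul a q) m hm

theorem ExtendsVia.map {w : pullback f A ⟶ pullback f B} {T T' : Cᵒᵖ}
    {a : A.P.sheaf.obj.obj T} {b : B.P.sheaf.obj.obj T} (h : ExtendsVia w a b) (i : T ⟶ T') :
    ExtendsVia w (A.P.sheaf.obj.map i a) (B.P.sheaf.obj.map i b) := by
  obtain ⟨q, m, n, hq, hm, e⟩ := h
  have hq' : A.P.proj.hom.app T' (A.P.sheaf.obj.map i q) =
      f.hom.hom.app T' (M.sheaf.obj.map i n) := by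
    rw [NatTrans.naturality_apply, NatTrans.naturality_apply, hq]
  have hm' : A.P.proj.hom.app T' (A.P.sheaf.obj.map i (A.mul a q)) =
      f.hom.hom.app T' (M.sheaf.obj.map i m) := by
    rw [NatTrans.naturality_apply, NatTrans.naturality_apply, hm]
  refine ⟨_, _, _, hq', (congrArg _ (A.map_mul i a q)).symm.trans hm', ?_⟩
  rw [← map_restr w i q n hq, ← B.map_mul, e, map_restr w i _ m hm hm']
  exact restr_congr w (A.map_mul i a q) rfl _ _

variable (K) in
/-- The relation `b = W(a)` between sections of `A` and `B`, where `W : A ⟶ B` is the extension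
of a morphism `w` between the restrictions to `M`: locally `b * w(q) = w(a * q)` for a section `q`
of `A` such that `q` and `a * q` lie over `M`. -/
def ExtendsTo (w : pullback f A ⟶ pullback f B) {T : C} (a : A.P.sheaf.obj.obj (op T))
    (b : B.P.sheaf.obj.obj (op T)) : Prop :=
  B.P.proj.hom.app _ b = A.P.proj.hom.app _ a ∧
    ∃ R ∈ K T, ∀ ⦃U : C⦄ (i : U ⟶ T), R i →
      ExtendsVia w (A.P.sheaf.obj.map i.op a) (B.P.sheaf.obj.map i.op b)

variable {w : pullback f A ⟶ pullback f B}

theorem ExtendsTo.map {T : C} {a : A.P.sheaf.obj.obj (op T)} {b : B.P.sheaf.obj.obj (op T)}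
    (h : ExtendsTo K w a b) {U : C} (i : U ⟶ T) :
    ExtendsTo K w (A.P.sheaf.obj.map i.op a) (B.P.sheaf.obj.map i.op b) := by
  obtain ⟨h₁, R, hR, h₂⟩ := h
  refine ⟨by rw [NatTrans.naturality_apply, NatTrans.naturality_apply, h₁], R.pullback i,
    K.pullback_stable i hR, fun V j hj => ?_⟩
  have := h₂ (j ≫ i) hj
  rw [op_comp, Functor.map_comp_apply, Functor.map_comp_apply] at this
  exact this

theorem ExtendsTo.smul {T : C} {a : A.P.sheaf.obj.obj (op T)} {b : B.P.sheaf.obj.obj (op T)}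
    (h : ExtendsTo K w a b) (g : G.obj.obj (op T)) :
    ExtendsTo K w (A.P.smul g a) (B.P.smul g b) := by
  obtain ⟨h₁, R, hR, h₂⟩ := h
  refine ⟨by rw [A.P.proj_smul, B.P.proj_smul, h₁], R, hR, fun U i hi => ?_⟩
  obtain ⟨q, m, n, hq, hm, e⟩ := h₂ i hi
  have e₁ : A.mul (A.P.sheaf.obj.map i.op (A.P.smul g a)) q =
      A.P.smul (G.obj.map i.op g) (A.mul (A.P.sheaf.obj.map i.op a) q) := by
    rw [A.P.map_smul, A.smul_mul]
  have hm' := (A.P.proj_smul (G.obj.map i.op g) (A.mul (A.P.sheaf.obj.map i.op a) q)).trans hm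
  refine ⟨q, m, n, hq, (congrArg _ e₁).trans hm', ?_⟩
  rw [restr_congr w e₁ rfl _ hm', restr_smul w _ _ _ hm, B.P.map_smul, B.smul_mul, e]

theorem ExtendsTo.mul {T : C} {a a' : A.P.sheaf.obj.obj (op T)}
    {b b' : B.P.sheaf.obj.obj (op T)} (h : ExtendsTo K w a b) (h' : ExtendsTo K w a' b') :
    ExtendsTo K w (A.mul a a') (B.mul b b') := by
  obtain ⟨h₁, R, hR, h₂⟩ := h
  obtain ⟨h₁', R', hR', h₂'⟩ := h'
  refine ⟨by rw [A.proj_mul, B.proj_mul, h₁, h₁'], R ⊓ R', K.intersection_covering hR hR',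
    fun U i hi => ?_⟩
  obtain ⟨q, m, n, hq, hm, e⟩ := h₂ i hi.1
  obtain ⟨q', m', n', hq', hm', e'⟩ := h₂' i hi.2
  have e₁ : A.mul (A.P.sheaf.obj.map i.op (A.mul a a')) (A.mul q q') =
      A.mul (A.mul (A.P.sheaf.obj.map i.op a) q) (A.mul (A.P.sheaf.obj.map i.op a') q') := by
    rw [A.map_mul]
    exact A.mul_mul_mul_comm _ _ _ _
  have h₃ : A.P.proj.hom.app _ (A.mul q q') = f.hom.hom.app _ (M.mul n n') := by
    rw [A.proj_mul, hq, hq', f.map_mul]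
  have h₄ : A.P.proj.hom.app _ (A.mul (A.mul (A.P.sheaf.obj.map i.op a) q)
      (A.mul (A.P.sheaf.obj.map i.op a') q')) = f.hom.hom.app _ (M.mul m m') := by
    rw [A.proj_mul, hm, hm', f.map_mul]
  refine ⟨A.mul q q', M.mul m m', M.mul n n', h₃, (congrArg _ e₁).trans h₄, ?_⟩
  rw [restr_congr w e₁ rfl _ h₄, restr_mul w _ _ _ _ hm hm', restr_mul w _ _ _ _ hq hq', ← e, ← e',
    B.map_mul]
  exact B.mul_mul_mul_comm _ _ _ _

theorem extendsTo_restr {T : C} {p : A.P.sheaf.obj.obj (op T)} {m : M.sheaf.obj.obj (op T)}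
    (h : A.P.proj.hom.app _ p = f.hom.hom.app _ m) : ExtendsTo K w p (restr w p m h) := by
  refine ⟨(proj_restr w p m h).trans h.symm, ⊤, K.top_mem T, fun U i _ => ?_⟩
  have h' : A.P.proj.hom.app (op U) (A.P.sheaf.obj.map i.op p) =
      f.hom.hom.app (op U) (M.sheaf.obj.map i.op m) := by
    rw [NatTrans.naturality_apply, NatTrans.naturality_apply, h]
  refine ⟨A.P.sheaf.obj.map i.op p, M.mul (M.sheaf.obj.map i.op m) (M.sheaf.obj.map i.op m),
    M.sheaf.obj.map i.op m, h', by rw [A.proj_mul, f.map_mul, h'], ?_⟩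
  rw [restr_mul w _ _ _ _ h' h', map_restr w i.op p m h h']

section

variable (hQ : ∀ {T : Cᵒᵖ} (x y z : Q.sheaf.obj.obj T), Q.mul x z = Q.mul y z → x = y)
  (hinj : ∀ T : Cᵒᵖ, Function.Injective (f.hom.hom.app T))

include hQ hinj in
/-- The equations `b * w(q) = w(a * q)` for two sections `q`, `q'` are equivalent: multiply by
`w(q')`, respectively by `w(q)`, and cancel. -/
theorem eq_of_mul_restr_eq {T : Cᵒᵖ} {a q q' : A.P.sheaf.obj.obj T} {b b' : B.P.sheaf.obj.obj T}
    {m n m' n' : M.sheaf.obj.obj T}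
    (hq : A.P.proj.hom.app _ q = f.hom.hom.app _ n)
    (hm : A.P.proj.hom.app _ (A.mul a q) = f.hom.hom.app _ m)
    (hq' : A.P.proj.hom.app _ q' = f.hom.hom.app _ n')
    (hm' : A.P.proj.hom.app _ (A.mul a q') = f.hom.hom.app _ m')
    (e : B.mul b (restr w q n hq) = restr w (A.mul a q) m hm)
    (e' : B.mul b' (restr w q' n' hq') = restr w (A.mul a q') m' hm') : b = b' := by
  have h₁ : A.P.proj.hom.app _ (A.mul (A.mul a q) q') = f.hom.hom.app _ (M.mul m n') := by
    rw [A.proj_mul, hm, hq', f.map_mul]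
  have h₂ : A.P.proj.hom.app _ (A.mul (A.mul a q') q) = f.hom.hom.app _ (M.mul m' n) := by
    rw [A.proj_mul, hm', hq, f.map_mul]
  have e₁ : A.mul (A.mul a q) q' = A.mul (A.mul a q') q := by
    rw [A.mul_assoc, A.mul_comm q, A.mul_assoc]
  have e₂ : M.mul m n' = M.mul m' n := hinj T (h₁.symm.trans ((congrArg _ e₁).trans h₂))
  refine B.mul_right_cancel hQ (r := B.mul (restr w q n hq) (restr w q' n' hq')) ?_
  rw [← B.mul_assoc, e, B.mul_comm (restr w q n hq), ← B.mul_assoc, e',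
    ← restr_mul w _ _ _ _ hm hq' h₁, ← restr_mul w _ _ _ _ hm' hq h₂]
  exact restr_congr w e₁ e₂ _ _

include hQ hinj in
theorem ExtendsTo.unique (hB : Presieve.IsSheaf K B.P.sheaf.obj) {T : C}
    {a : A.P.sheaf.obj.obj (op T)} {b b' : B.P.sheaf.obj.obj (op T)}
    (h : ExtendsTo K w a b) (h' : ExtendsTo K w a b') : b = b' := by
  obtain ⟨-, R, hR, h₂⟩ := h
  obtain ⟨-, R', hR', h₂'⟩ := h'
  refine eq_of_locally_eq hB (K.intersection_covering hR hR') fun U i hi => ?_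
  obtain ⟨q, m, n, hq, hm, e⟩ := h₂ i hi.1
  obtain ⟨q', m', n', hq', hm', e'⟩ := h₂' i hi.2
  exact eq_of_mul_restr_eq hQ hinj hq hm hq' hm' e e'

include hQ hinj in
/-- The image `W(a)` exists: `K`-locally on the base it is the solution `b` of
`b * w(q) = w(a * q)`, and these solutions glue by uniqueness. -/
theorem exists_extendsTo (hJK : J ≤ K) (hf : LocallyGenerates K f)
    (hQK : Presieve.IsSheaf K Q.sheaf.obj)
    (hB : Presieve.IsSheaf K B.P.sheaf.obj) (w : pullback f A ⟶ pullback f B) {T : C}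
    (a : A.P.sheaf.obj.obj (op T)) : ∃ b, ExtendsTo K w a b := by
  obtain ⟨R, hR, h⟩ := hf.exists_section hJK A (A.P.proj.hom.app _ a)
  have hls := B.isTorsor.isLocallySurjective
  have hR' := hJK _ (Presheaf.imageSieve_mem J B.P.proj.hom (A.P.proj.hom.app _ a))
  have hcov := K.intersection_covering hR hR'
  obtain ⟨b, hb⟩ := exists_of_locally_unique hB
    (fun U i b => ExtendsTo K w (A.P.sheaf.obj.map i.op a) b) (by
      intro U V i j b hb
      rw [op_comp, Functor.map_comp_apply]
      exact hb.map j) (fun U i b b' hb hb' => hb.unique hQ hinj hB hb') hcov (by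
      rintro U i ⟨hi, b, hb⟩
      obtain ⟨q, m, n, hq, hm⟩ := h i hi
      have hm' : A.P.proj.hom.app _ (A.mul (A.P.sheaf.obj.map i.op a) q) =
          f.hom.hom.app _ m := by
        rw [A.proj_mul, hq, NatTrans.naturality_apply, hm]
      obtain ⟨g, hg⟩ := B.isTorsor.exists_smul (restr w _ m hm') (B.mul b (restr w q n hq)) (by
        rw [proj_restr, B.proj_mul, proj_restr, hb, hm])
      refine ⟨B.P.smul g b, ?_, ⊤, K.top_mem U, fun V j _ => ?_⟩
      · rw [B.P.proj_smul, hb, NatTrans.naturality_apply]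
      refine ExtendsVia.map ⟨q, m, n, hq, hm', ?_⟩ j.op
      rw [B.smul_mul, hg])
  refine ⟨b, ?_, ?_⟩
  · refine eq_of_locally_eq hQK hcov fun U i hi => ?_
    rw [← NatTrans.naturality_apply, ← NatTrans.naturality_apply]
    exact (hb i hi).1
  · let R₀ : Sieve T :=
      { arrows U i := ExtendsVia w (A.P.sheaf.obj.map i.op a) (B.P.sheaf.obj.map i.op b)
        downward_closed := by
          intro U V i hi j
          rw [op_comp, Functor.map_comp_apply, Functor.map_comp_apply]
          exact hi.map j.op }
    refine ⟨R₀, K.transitive hcov R₀ fun U i hi => ?_, fun U i hi => hi⟩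
    obtain ⟨-, R₁, hR₁, h₁⟩ := hb i hi
    refine K.superset_covering (fun V j hj => ?_) hR₁
    have := h₁ j hj
    rw [← Functor.map_comp_apply, ← Functor.map_comp_apply, ← op_comp] at this
    exact this

include hinj hQ in
/-- Restriction of multiplicative torsors to `M` is fully faithful: a section `a` of `A` satisfies
`W(a) = w(a * q) w(q)⁻¹`, locally, for every extension `W` of `w`. -/
theorem pullbackFunctor_full (hJK : J ≤ K) (hf : LocallyGenerates K f)
    (hQK : Presieve.IsSheaf K Q.sheaf.obj)
    (hG : Presieve.IsSheaf K (G.obj ⋙ forget CommGrpCat)) : (pullbackFunctor G f).Full where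
  map_surjective {A B} w := by
    have hB := B.isTorsor.isSheaf_of_le hG hQK
    have uniq : ∀ {T : Cᵒᵖ} {a : A.P.sheaf.obj.obj T} {b b' : B.P.sheaf.obj.obj T},
      ExtendsTo K (T := T.unop) w a b → ExtendsTo K (T := T.unop) w a b' → b = b' :=
        fun h h' => h.unique hQ hinj hB h'
    choose W hW using fun (T : Cᵒᵖ) (a : A.P.sheaf.obj.obj T) =>
      exists_extendsTo (T := T.unop) hQ hinj hJK hf hQK hB w a
    refine ⟨{ hom :=
      { hom := ObjectProperty.homMk
          { app := fun T => ↾(W T)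
            naturality := fun T T' i => by
              ext a
              exact uniq (hW T' _) ((hW T a).map i.unop) }
        proj := fun {T} a => (hW T a).1
        map_smul := fun {T} g a => uniq (hW T _) ((hW T a).smul g) }
              map_mul := fun {T} a a' => uniq (hW T _) ((hW T a).mul (hW T a')) }, ?_⟩
    refine Hom.ext (GObj.hom_ext fun {T} s => Subtype.ext ?_)
    refine Eq.trans ?_ (app_pullbackMk w s.1.1 s.1.2 s.2).symm
    exact Prod.ext (uniq (hW T s.1.1) (extendsTo_restr (T := T.unop) s.2)) rfl

include hQ in
theorem pullbackFunctor_faithful (hJK : J ≤ K) (hf : LocallyGenerates K f)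
    (hQK : Presieve.IsSheaf K Q.sheaf.obj)
    (hG : Presieve.IsSheaf K (G.obj ⋙ forget CommGrpCat)) : (pullbackFunctor G f).Faithful where
  map_injective {A B} a b e := by
    have hB := B.isTorsor.isSheaf_of_le hG hQK
    have key : ∀ {T : Cᵒᵖ} (p : A.P.sheaf.obj.obj T) (m : M.sheaf.obj.obj T),
        A.P.proj.hom.app T p = f.hom.hom.app T m →
        a.hom.hom.hom.app T p = b.hom.hom.hom.app T p := fun {T} p m h =>
      congrArg (fun u : pullback f A ⟶ pullback f B =>
        (u.hom.hom.hom.app T (A.P.pullbackMk f.hom p m h)).1.1) e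
    refine Hom.ext (GObj.hom_ext fun {T} p => ?_)
    obtain ⟨R, hR, h⟩ := hf.exists_section hJK A (T := T.unop) (A.P.proj.hom.app _ p)
    refine eq_of_locally_eq (T := T.unop) hB hR fun U i hi => ?_
    obtain ⟨q, m, n, hq, hm⟩ := h i hi
    refine B.mul_right_cancel hQ (r := a.hom.hom.hom.app _ q) ?_
    rw [← NatTrans.naturality_apply, ← NatTrans.naturality_apply, ← a.map_mul,
      key q n hq, ← b.map_mul]
    refine key _ m ?_
    rw [A.proj_mul, hq, NatTrans.naturality_apply]
    exact hm
end
end MultTorsor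

/-! ### Group completion of a multiplicative torsor -/

instance : Limits.HasColimitsOfSize.{w, w} CommGrpCat.{w} :=
  Adjunction.has_colimits_of_equivalence commGroupAddCommGroupEquivalence.functor

theorem exists_eq_of_div_of_grothendieckGroup {N : Type w} [CommMonoid N]
    (x : Algebra.GrothendieckGroup N) :
    ∃ a b : N, x = Algebra.GrothendieckGroup.of a / Algebra.GrothendieckGroup.of b := by
  induction x using Localization.induction_on with | _ y
  refine ⟨y.1, y.2, ?_⟩
  rw [eq_div_iff_mul_eq', Localization.mk_eq_monoidOf_mk']
  exact (Submonoid.LocalizationMap.mk'_spec (Localization.monoidOf _) y.1 y.2)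

theorem grothendieckGroup_lift_of {N : Type w} [CommMonoid N] {H : Type*} [CommGroup H]
    (φ : N →* H) (x : N) :
    Algebra.GrothendieckGroup.lift φ (Algebra.GrothendieckGroup.of x) = φ x :=
  DFunLike.congr_fun (Algebra.GrothendieckGroup.lift.symm_apply_apply φ) x

theorem grothendieckGroup_of_eq_of_iff {N : Type w} [CommMonoid N] {a b : N} :
    Algebra.GrothendieckGroup.of a = Algebra.GrothendieckGroup.of b ↔ ∃ c, c * a = c * b :=
  ((Localization.monoidOf (⊤ : Submonoid N)).eq_iff_exists).trans
    ⟨fun ⟨c, h⟩ => ⟨c, h⟩, fun ⟨c, h⟩ => ⟨⟨c, trivial⟩, h⟩⟩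


/-- The sections of the semigroup `Q` over every object form a group. -/
structure CommSemigroupSheaf.IsGroup (Q : CommSemigroupSheaf J) : Prop where
  nonempty : ∀ T : Cᵒᵖ, Nonempty (Q.sheaf.obj.obj T)
  exists_mul_eq : ∀ {T : Cᵒᵖ} (x y : Q.sheaf.obj.obj T), ∃ z, Q.mul z x = y

namespace CommSemigroupSheaf.IsGroup

variable {Q : CommSemigroupSheaf J}

theorem exists_one (hQ : Q.IsGroup) (T : Cᵒᵖ) : ∃ e : Q.sheaf.obj.obj T, ∀ x, Q.mul e x = x := by
  obtain ⟨x₀⟩ := hQ.nonempty T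
  obtain ⟨e, he⟩ := hQ.exists_mul_eq x₀ x₀
  refine ⟨e, fun x => ?_⟩
  obtain ⟨y, rfl⟩ := hQ.exists_mul_eq x₀ x
  rw [← Q.mul_assoc, Q.mul_comm e, Q.mul_assoc, he]

/-- The group structure on the sections of `Q`. -/
noncomputable abbrev commGroup (hQ : Q.IsGroup) (T : Cᵒᵖ) : CommGroup (Q.sheaf.obj.obj T) where
  mul := Q.mul
  mul_assoc := Q.mul_assoc
  mul_comm := Q.mul_comm
  one := (hQ.exists_one T).choose
  one_mul := (hQ.exists_one T).choose_spec
  mul_one x := (Q.mul_comm _ _).trans ((hQ.exists_one T).choose_spec x)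
  inv x := (hQ.exists_mul_eq x (hQ.exists_one T).choose).choose
  inv_mul_cancel x := (hQ.exists_mul_eq x (hQ.exists_one T).choose).choose_spec

/-- The presheaf of abelian groups given by the sections of `Q`. -/
noncomputable def toPresheaf (hQ : Q.IsGroup) : Cᵒᵖ ⥤ CommGrpCat.{max u v} where
  obj T := @CommGrpCat.of _ (hQ.commGroup T)
  map {T T'} i :=
    let := hQ.commGroup T
    let := hQ.commGroup T'
    CommGrpCat.ofHom (MonoidHom.mk' (Q.sheaf.obj.map i) (Q.map_mul i))
  map_id T := by
    let := hQ.commGroup T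
    ext x
    exact ConcreteCategory.congr_hom (Q.sheaf.obj.map_id T) x
  map_comp {T T' T''} i j := by
    let := hQ.commGroup T
    let := hQ.commGroup T'
    let := hQ.commGroup T''
    ext x
    exact ConcreteCategory.congr_hom (Q.sheaf.obj.map_comp i j) x

theorem mul_right_cancel (hQ : Q.IsGroup) {T : Cᵒᵖ} (x y z : Q.sheaf.obj.obj T)
    (h : Q.mul x z = Q.mul y z) : x = y := by
  let := hQ.commGroup T
  exact _root_.mul_right_cancel (G := Q.sheaf.obj.obj T) (a := x) (b := z) (c := y) h

theorem isSheaf_toPresheaf (hQ : Q.IsGroup) (hQK : Presieve.IsSheaf K Q.sheaf.obj) :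
    Presheaf.IsSheaf K hQ.toPresheaf := by
  apply Presheaf.isSheaf_of_isSheaf_comp _ _ (forget CommGrpCat)
  exact (isSheaf_iff_isSheaf_of_type K _).2 hQK

end CommSemigroupSheaf.IsGroup

namespace MultTorsor

variable {M Q : CommSemigroupSheaf J}

/-- The disjoint union `G ⊔ P` of sections, a commutative monoid for the multiplications of `G`
and `P` and the action of `G` on `P`. -/
def Adjoined (A : MultTorsor G M) (T : Cᵒᵖ) : Type (max u v) :=
  G.obj.obj T ⊕ A.P.sheaf.obj.obj T

namespace Adjoined

variable {A : MultTorsor G M} {T : Cᵒᵖ}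

noncomputable instance : Mul (Adjoined A T) where
  mul
    | .inl g, .inl h => .inl (g * h)
    | .inl g, .inr p => .inr (A.P.smul g p)
    | .inr p, .inl g => .inr (A.P.smul g p)
    | .inr p, .inr q => .inr (A.mul p q)

/-- The inclusion of `G` into `G ⊔ P`. -/
def ofGroup (g : G.obj.obj T) : Adjoined A T := .inl g

/-- The inclusion of `P` into `G ⊔ P`. -/
def ofTorsor (p : A.P.sheaf.obj.obj T) : Adjoined A T := .inr p

theorem cases {motive : Adjoined A T → Prop} (h₁ : ∀ g, motive (ofGroup g))
    (h₂ : ∀ p, motive (ofTorsor p)) (x) : motive x := by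
  cases x with
  | inl g => exact h₁ g
  | inr p => exact h₂ p

theorem mul_comm_adjoined (x y : Adjoined A T) : x * y = y * x := by
  induction x using Adjoined.cases with
  | h₁ g =>
    induction y using Adjoined.cases with
    | h₁ h => exact congrArg ofGroup (_root_.mul_comm g h)
    | h₂ q => rfl
  | h₂ p =>
    induction y using Adjoined.cases with
    | h₁ h => rfl
    | h₂ q => exact congrArg ofTorsor (A.mul_comm p q)

theorem ofGroup_mul_assoc (g : G.obj.obj T) (x y : Adjoined A T) :
    ofGroup g * x * y = ofGroup g * (x * y) := by
  induction x using Adjoined.cases with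
  | h₁ h =>
    induction y using Adjoined.cases with
    | h₁ k => exact congrArg ofGroup (_root_.mul_assoc g h k)
    | h₂ q => exact congrArg ofTorsor (A.P.mul_smul g h q)
  | h₂ p =>
    induction y using Adjoined.cases with
    | h₁ k =>
      refine congrArg ofTorsor ?_
      rw [← A.P.mul_smul, ← A.P.mul_smul, _root_.mul_comm]
    | h₂ q => exact congrArg ofTorsor (A.smul_mul g p q)

noncomputable instance : CommMonoid (Adjoined A T) where
  mul_assoc x y z := by
    induction x using Adjoined.cases with
    | h₁ g => exact ofGroup_mul_assoc g y z
    | h₂ p =>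
      induction y using Adjoined.cases with
      | h₁ h =>
        rw [mul_comm_adjoined (ofTorsor p), ofGroup_mul_assoc]
        induction z using Adjoined.cases with
        | h₁ k => exact congrArg ofTorsor ((A.P.mul_smul h k p).symm)
        | h₂ r =>
          refine congrArg ofTorsor ?_
          rw [A.mul_smul]
      | h₂ q =>
        induction z using Adjoined.cases with
        | h₁ k => exact congrArg ofTorsor (A.mul_smul k p q).symm
        | h₂ r => exact congrArg ofTorsor (A.mul_assoc p q r)
  mul_comm := mul_comm_adjoined
  one := ofGroup 1
  one_mul x := by
    induction x using Adjoined.cases with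
    | h₁ g => exact congrArg ofGroup (one_mul g)
    | h₂ p => exact congrArg ofTorsor (A.P.one_smul p)
  mul_one x := by
    rw [mul_comm_adjoined]
    induction x using Adjoined.cases with
    | h₁ g => exact congrArg ofGroup (one_mul g)
    | h₂ p => exact congrArg ofTorsor (A.P.one_smul p)

variable (A) in
/-- Restriction of sections, on `G ⊔ P`. -/
noncomputable def mapHom {T T' : Cᵒᵖ} (i : T ⟶ T') : Adjoined A T →* Adjoined A T' where
  toFun := Sum.map (G.obj.map i) (A.P.sheaf.obj.map i)
  map_one' := congrArg ofGroup (_root_.map_one (G.obj.map i).hom)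
  map_mul' x y := by
    induction x using Adjoined.cases with
    | h₁ g =>
      induction y using Adjoined.cases with
      | h₁ h => exact congrArg ofGroup (_root_.map_mul (G.obj.map i).hom g h)
      | h₂ q => exact congrArg ofTorsor (A.P.map_smul i g q)
    | h₂ p =>
      induction y using Adjoined.cases with
      | h₁ h => exact congrArg ofTorsor (A.P.map_smul i h p)
      | h₂ q => exact congrArg ofTorsor (A.map_mul i p q)

theorem mapHom_id (x : Adjoined A T) : mapHom A (𝟙 T) x = x := by
  induction x using Adjoined.cases with
  | h₁ g => exact congrArg ofGroup (ConcreteCategory.congr_hom (G.obj.map_id T) g)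
  | h₂ p => exact congrArg ofTorsor (ConcreteCategory.congr_hom (A.P.sheaf.obj.map_id T) p)

theorem mapHom_comp {T' T'' : Cᵒᵖ} (i : T ⟶ T') (j : T' ⟶ T'') (x : Adjoined A T) :
    mapHom A (i ≫ j) x = mapHom A j (mapHom A i x) := by
  induction x using Adjoined.cases with
  | h₁ g => exact congrArg ofGroup (ConcreteCategory.congr_hom (G.obj.map_comp i j) g)
  | h₂ p => exact congrArg ofTorsor (ConcreteCategory.congr_hom (A.P.sheaf.obj.map_comp i j) p)

/-- The projection of `G ⊔ P` to the group `Q`, trivial on `G`. -/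
noncomputable def projHom (f : SemigroupHom M Q) (hQ : Q.IsGroup) (A : MultTorsor G M) (T : Cᵒᵖ) :
    Adjoined A T →* hQ.toPresheaf.obj T where
  toFun := Sum.elim (fun _ => 1) (fun p => f.hom.hom.app T (A.P.proj.hom.app T p))
  map_one' := rfl
  map_mul' x y := by
    induction x using Adjoined.cases with
    | h₁ g =>
      induction y using Adjoined.cases with
      | h₁ h => exact (one_mul (1 : hQ.toPresheaf.obj T)).symm
      | h₂ q =>
        refine Eq.trans ?_ (one_mul (M := hQ.toPresheaf.obj T) _).symm
        exact congrArg (f.hom.hom.app T) (A.P.proj_smul g q)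
    | h₂ p =>
      induction y using Adjoined.cases with
      | h₁ h =>
        refine Eq.trans ?_ (mul_one (M := hQ.toPresheaf.obj T) _).symm
        exact congrArg (f.hom.hom.app T) (A.P.proj_smul h p)
      | h₂ q =>
        exact (congrArg (f.hom.hom.app T) (A.proj_mul p q)).trans (f.map_mul _ _)

theorem eq_of_mul_ofGroup_eq {c : Adjoined A T} {g h : G.obj.obj T}
    (e : c * ofGroup g = c * ofGroup h) : g = h := by
  induction c using Adjoined.cases with
  | h₁ k => exact _root_.mul_left_cancel (Sum.inl_injective e)
  | h₂ p => exact A.isTorsor.smul_injective p g h (Sum.inr_injective e)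

end Adjoined

open Algebra

/-- The presheaf of Grothendieck groups of the monoids `G ⊔ P`. -/
noncomputable def groupPresheaf (A : MultTorsor G M) : Cᵒᵖ ⥤ CommGrpCat.{max u v} where
  obj T := CommGrpCat.of (GrothendieckGroup (Adjoined A T))
  map i := CommGrpCat.ofHom (GrothendieckGroup.lift
    (GrothendieckGroup.of.comp (Adjoined.mapHom A i)))
  map_id T := by
    apply CommGrpCat.hom_ext
    apply GrothendieckGroup.lift.symm.injective
    ext x
    refine (grothendieckGroup_lift_of _ _).trans (congrArg GrothendieckGroup.of ?_)
    exact Adjoined.mapHom_id x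
  map_comp i j := by
    apply CommGrpCat.hom_ext
    apply GrothendieckGroup.lift.symm.injective
    ext x
    refine (grothendieckGroup_lift_of _ _).trans ?_
    refine (congrArg GrothendieckGroup.of (Adjoined.mapHom_comp i j x)).trans ?_
    refine (grothendieckGroup_lift_of
      (GrothendieckGroup.of.comp (Adjoined.mapHom A j)) _).symm.trans ?_
    exact congrArg (GrothendieckGroup.lift (GrothendieckGroup.of.comp (Adjoined.mapHom A j)))
      (grothendieckGroup_lift_of (GrothendieckGroup.of.comp (Adjoined.mapHom A i)) x).symm

theorem groupPresheaf_map_of (A : MultTorsor G M) {T T' : Cᵒᵖ} (i : T ⟶ T') (x : Adjoined A T) :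
    (groupPresheaf A).map i (GrothendieckGroup.of x) =
      GrothendieckGroup.of (Adjoined.mapHom A i x) :=
  grothendieckGroup_lift_of _ _

/-- The projection from the presheaf of Grothendieck groups of `G ⊔ P` to `Q`. -/
noncomputable def groupProj (f : SemigroupHom M Q) (hQ : Q.IsGroup) (A : MultTorsor G M) :
    groupPresheaf A ⟶ hQ.toPresheaf where
  app T := ConcreteCategory.ofHom (C := CommGrpCat) (Y := hQ.toPresheaf.obj T)
    (GrothendieckGroup.lift (Adjoined.projHom f hQ A T))
  naturality T T' i := by
    apply CommGrpCat.hom_ext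
    apply GrothendieckGroup.lift.symm.injective
    ext x
    refine (congrArg (GrothendieckGroup.lift (Adjoined.projHom f hQ A T'))
      (groupPresheaf_map_of A i x)).trans ?_
    refine (grothendieckGroup_lift_of (H := hQ.toPresheaf.obj T') _ _).trans ?_
    refine Eq.trans ?_ (congrArg (hQ.toPresheaf.map i)
      (grothendieckGroup_lift_of (H := hQ.toPresheaf.obj T) (Adjoined.projHom f hQ A T) x)).symm
    induction x using Adjoined.cases with
    | h₁ g => exact (_root_.map_one (hQ.toPresheaf.map i).hom).symm
    | h₂ p =>
      refine (congrArg (f.hom.hom.app T') (NatTrans.naturality_apply A.P.proj.hom i p)).trans ?_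
      exact NatTrans.naturality_apply f.hom.hom i _

theorem groupProj_of (f : SemigroupHom M Q) (hQ : Q.IsGroup) (A : MultTorsor G M) {T : Cᵒᵖ}
    (x : Adjoined A T) : (groupProj f hQ A).app T (GrothendieckGroup.of x) =
      Adjoined.projHom f hQ A T x :=
  grothendieckGroup_lift_of (H := hQ.toPresheaf.obj T) (Adjoined.projHom f hQ A T) x

/-- The homomorphism from `G` to the presheaf of Grothendieck groups of `G ⊔ P`. -/
noncomputable def groupIncl (A : MultTorsor G M) : G.obj ⟶ groupPresheaf A where
  app T := CommGrpCat.ofHom (MonoidHom.mk' (fun g => GrothendieckGroup.of (Adjoined.ofGroup g))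
    fun g h => _root_.map_mul GrothendieckGroup.of (Adjoined.ofGroup g) (Adjoined.ofGroup h))
  naturality T T' i := by
    ext g
    exact (groupPresheaf_map_of A i (Adjoined.ofGroup g)).symm

theorem groupIncl_injective (A : MultTorsor G M) (T : Cᵒᵖ) :
    Function.Injective ((groupIncl A).app T) := by
  intro g h e
  obtain ⟨c, hc⟩ := grothendieckGroup_of_eq_of_iff.1 e
  exact Adjoined.eq_of_mul_ofGroup_eq hc

/-- The kernel of the projection to `Q` is `G`. -/
theorem exists_groupIncl_eq (f : SemigroupHom M Q)
    (hinj : ∀ T, Function.Injective (f.hom.hom.app T)) (hQ : Q.IsGroup)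
    (A : MultTorsor G M) {T : Cᵒᵖ} (x : (groupPresheaf A).obj T)
    (hx : (groupProj f hQ A).app T x = 1) : ∃ g, (groupIncl A).app T g = x := by
  -- a section of `P` over the identity of `Q` is identified with a section of `G`
  have aux : ∀ p : A.P.sheaf.obj.obj T, Adjoined.projHom f hQ A T (Adjoined.ofTorsor p) = 1 →
      ∃ g, (groupIncl A).app T g = GrothendieckGroup.of (Adjoined.ofTorsor p) := by
    intro p hp
    obtain ⟨g, hg⟩ := A.isTorsor.exists_smul (A.mul p p) p (by
      apply hinj
      rw [A.proj_mul, f.map_mul]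
      exact (congrArg₂ (fun a b : hQ.toPresheaf.obj T => a * b) hp hp).trans
        ((mul_one (M := hQ.toPresheaf.obj T) _).trans hp.symm))
    refine ⟨g, _root_.mul_right_cancel (b := GrothendieckGroup.of (Adjoined.ofTorsor p)) ?_⟩
    refine (_root_.map_mul GrothendieckGroup.of _ _).symm.trans
      (Eq.trans ?_ (_root_.map_mul GrothendieckGroup.of _ _))
    exact congrArg GrothendieckGroup.of (congrArg Adjoined.ofTorsor hg)
  obtain ⟨a, b, rfl⟩ := exists_eq_of_div_of_grothendieckGroup x
  have hab : Adjoined.projHom f hQ A T a = Adjoined.projHom f hQ A T b := by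
    have := (_root_.map_div ((groupProj f hQ A).app T).hom (GrothendieckGroup.of a)
      (GrothendieckGroup.of b)).symm.trans hx
    have h := div_eq_one.1 this
    exact (groupProj_of f hQ A a).symm.trans (h.trans (groupProj_of f hQ A b))
  have hdiv : ∀ g h : G.obj.obj T, (groupIncl A).app T (g / h) =
      (groupIncl A).app T g / (groupIncl A).app T h :=
    fun g h => _root_.map_div ((groupIncl A).app T).hom g h
  induction a using Adjoined.cases with
  | h₁ g =>
    obtain ⟨h, hh⟩ : ∃ h, (groupIncl A).app T h = GrothendieckGroup.of b := by
      induction b using Adjoined.cases with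
      | h₁ h => exact ⟨h, rfl⟩
      | h₂ q => exact aux q hab.symm
    exact ⟨g / h, by rw [hdiv, hh]; rfl⟩
  | h₂ p =>
    induction b using Adjoined.cases with
    | h₁ h =>
      obtain ⟨g, hg⟩ := aux p hab
      exact ⟨g / h, by rw [hdiv, hg]; rfl⟩
    | h₂ q =>
      obtain ⟨g, rfl⟩ := A.isTorsor.exists_smul p q (hinj T hab)
      refine ⟨g, ?_⟩
      refine eq_div_iff_mul_eq'.2 ((_root_.map_mul GrothendieckGroup.of
        (Adjoined.ofTorsor q) (Adjoined.ofGroup g)).symm)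

end MultTorsor

/-! ### The equivalence for two topologies on a site -/

namespace MultTorsor

variable {M Q : CommSemigroupSheaf J} (f : SemigroupHom M Q) (hQ : Q.IsGroup)
  (hQK : Presieve.IsSheaf K Q.sheaf.obj) (A : MultTorsor G M)
open Algebra

variable (K) in
/-- The group completion of `G ⊔ P` as a sheaf of abelian groups for the topology `K`: an extension
of `Q` by `G`, whose restriction to `M` is `P`. -/
noncomputable def completion : Cᵒᵖ ⥤ CommGrpCat.{max u v} := sheafify K (groupPresheaf A)

variable (K) in
theorem isSheaf_completion : Presheaf.IsSheaf K (completion K A) :=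
  ((presheafToSheaf K _).obj (groupPresheaf A)).property

variable (K) in
/-- The canonical homomorphism from the presheaf of Grothendieck groups to its sheafification. -/
noncomputable def toCompletion : groupPresheaf A ⟶ completion K A := toSheafify K _

variable (K) in
/-- The homomorphism from `G` to the group completion of `G ⊔ P`. -/
noncomputable def completionIncl : G.obj ⟶ completion K A := groupIncl A ≫ toCompletion K A

/-- The projection from the group completion of `G ⊔ P` to `Q`. -/
noncomputable def completionProj : completion K A ⟶ hQ.toPresheaf :=
  sheafifyLift K (groupProj f hQ A) (hQ.isSheaf_toPresheaf hQK)

theorem completionProj_toCompletion {T : Cᵒᵖ} (x : (groupPresheaf A).obj T) :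
    (completionProj f hQ hQK A).app T ((toCompletion K A).app T x) = (groupProj f hQ A).app T x :=
  ConcreteCategory.congr_hom (NatTrans.congr_app
    (toSheafify_sheafifyLift K (groupProj f hQ A) (hQ.isSheaf_toPresheaf hQK)) T) x

theorem presieveIsSheaf_completion :
    Presieve.IsSheaf K (completion K A ⋙ forget CommGrpCat) :=
  (isSheaf_iff_isSheaf_of_type K _).1
    (GrothendieckTopology.HasSheafCompose.isSheaf _ (isSheaf_completion K A))

instance : Presheaf.IsLocallyInjective K (toCompletion K A) :=
  inferInstanceAs (Presheaf.IsLocallyInjective K (toSheafify K (groupPresheaf A)))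

instance : Presheaf.IsLocallySurjective K (toCompletion K A) :=
  inferInstanceAs (Presheaf.IsLocallySurjective K (toSheafify K (groupPresheaf A)))

theorem completionProj_completionIncl {T : Cᵒᵖ} (g : G.obj.obj T) :
    (completionProj f hQ hQK A).app T ((completionIncl K A).app T g) = 1 :=
  (completionProj_toCompletion f hQ hQK A _).trans (groupProj_of f hQ A (Adjoined.ofGroup g))

theorem completionIncl_injective (hG : Presieve.IsSheaf K (G.obj ⋙ forget CommGrpCat)) (T : Cᵒᵖ) :
    Function.Injective ((completionIncl K A).app T) := by
  intro g h e
  have hcov := Presheaf.equalizerSieve_mem K (toCompletion K A) _ _ e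
  refine eq_of_locally_eq (T := T.unop) hG hcov fun U i hi => ?_
  refine groupIncl_injective A _ ?_
  refine (NatTrans.naturality_apply (groupIncl A) i.op g).trans (Eq.trans hi ?_)
  exact (NatTrans.naturality_apply (groupIncl A) i.op h).symm

/-- The kernel of the projection of the group completion to `Q` is `G`. -/
theorem exists_completionIncl_eq (hinj : ∀ T, Function.Injective (f.hom.hom.app T))
    (hG : Presieve.IsSheaf K (G.obj ⋙ forget CommGrpCat)) {T : C} (a : (completion K A).obj (op T))
    (ha : (completionProj f hQ hQK A).app _ a = 1) : ∃ g, (completionIncl K A).app _ g = a := by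
  have hcov := Presheaf.imageSieve_mem K (toCompletion K A) a
  obtain ⟨g, hg⟩ := exists_of_locally_unique hG
    (fun U i g => (completionIncl K A).app _ g = (completion K A).map i.op a) (T := T) (by
      intro U V i j g hg
      refine (NatTrans.naturality_apply (completionIncl K A) j.op g).trans ?_
      rw [hg, op_comp, Functor.map_comp_apply]) (by
      intro U i g h hg hh
      exact completionIncl_injective A hG _ (hg.trans hh.symm)) hcov (by
      rintro U i ⟨x, hx⟩
      obtain ⟨g, hg⟩ := exists_groupIncl_eq f hinj hQ A x (by
        rw [← completionProj_toCompletion f hQ hQK A x, hx, NatTrans.naturality_apply, ha]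
        exact _root_.map_one (hQ.toPresheaf.map i.op).hom)
      refine ⟨g, ?_⟩
      rw [← hx, ← hg]
      rfl)
  refine ⟨g, eq_of_locally_eq (presieveIsSheaf_completion A) hcov fun U i hi => ?_⟩
  exact (NatTrans.naturality_apply (completionIncl K A) i.op g).symm.trans (hg i hi)

/-- The map from `P` to the group completion of `G ⊔ P`. -/
noncomputable def completionOf {T : Cᵒᵖ} (p : A.P.sheaf.obj.obj T) : (completion K A).obj T :=
  (toCompletion K A).app T (GrothendieckGroup.of (Adjoined.ofTorsor p))

theorem completionOf_mul {T : Cᵒᵖ} (p q : A.P.sheaf.obj.obj T) :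
    completionOf (K := K) A (A.mul p q) = completionOf A p * completionOf A q :=
  (congrArg ((toCompletion K A).app T) (_root_.map_mul GrothendieckGroup.of
    (Adjoined.ofTorsor p) (Adjoined.ofTorsor q))).trans
    (_root_.map_mul ((toCompletion K A).app T).hom _ _)

theorem completionOf_smul {T : Cᵒᵖ} (g : G.obj.obj T) (p : A.P.sheaf.obj.obj T) :
    completionOf (K := K) A (A.P.smul g p) = (completionIncl K A).app T g * completionOf A p :=
  (congrArg ((toCompletion K A).app T) (_root_.map_mul GrothendieckGroup.of
    (Adjoined.ofGroup g) (Adjoined.ofTorsor p))).trans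
    (_root_.map_mul ((toCompletion K A).app T).hom _ _)

theorem map_completionOf {T T' : Cᵒᵖ} (i : T ⟶ T') (p : A.P.sheaf.obj.obj T) :
    (completion K A).map i (completionOf A p) = completionOf A (A.P.sheaf.obj.map i p) :=
  (NatTrans.naturality_apply (toCompletion K A) i _).symm.trans
    (congrArg ((toCompletion K A).app T') (groupPresheaf_map_of A i (Adjoined.ofTorsor p)))

theorem completionProj_completionOf {T : Cᵒᵖ} (p : A.P.sheaf.obj.obj T) :
    (completionProj f hQ hQK A).app T (completionOf A p) =
      f.hom.hom.app T (A.P.proj.hom.app T p) :=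
  (completionProj_toCompletion f hQ hQK A _).trans (groupProj_of f hQ A (Adjoined.ofTorsor p))

/-- The multiplication of sections of the group completion of `G ⊔ P`. -/
noncomputable def completionMul {T : Cᵒᵖ} (a b : (completion K A).obj T) :
    (completion K A).obj T := a * b

theorem map_completionMul {T T' : Cᵒᵖ} (i : T ⟶ T') (a b : (completion K A).obj T) :
    (completion K A).map i (completionMul A a b) =
      completionMul A ((completion K A).map i a) ((completion K A).map i b) :=
  _root_.map_mul ((completion K A).map i).hom a b

theorem completionProj_completionMul {T : Cᵒᵖ} (a b : (completion K A).obj T) :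
    (completionProj f hQ hQK A).app T (completionMul A a b) =
      (completionProj f hQ hQK A).app T a * (completionProj f hQ hQK A).app T b :=
  _root_.map_mul ((completionProj f hQ hQK A).app T).hom a b

theorem exists_completionMul_eq (hinj : ∀ T, Function.Injective (f.hom.hom.app T))
    (hG : Presieve.IsSheaf K (G.obj ⋙ forget CommGrpCat)) {T : Cᵒᵖ} (a b : (completion K A).obj T)
    (e : (completionProj f hQ hQK A).app T a = (completionProj f hQ hQK A).app T b) :
    ∃ g, completionMul A ((completionIncl K A).app T g) b = a := by
  obtain ⟨g, hg⟩ := exists_completionIncl_eq f hQ hQK A hinj hG (T := T.unop) (a / b)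
    ((_root_.map_div ((completionProj f hQ hQK A).app T).hom a b).trans
      ((div_eq_one (G := hQ.toPresheaf.obj T)).2 e))
  exact ⟨g, (congrArg (fun z => completionMul A z b) hg).trans (div_mul_cancel a b)⟩

/-- The group completion of `G ⊔ P`, as a sheaf over `Q` with an action of `G`. -/
noncomputable def completionObj (hJK : J ≤ K) : GObj G Q.sheaf where
  sheaf := ⟨completion K A ⋙ forget CommGrpCat,
    (isSheaf_iff_isSheaf_of_type J _).2
      (Presieve.isSheaf_of_le _ hJK (presieveIsSheaf_completion A))⟩
  proj := ObjectProperty.homMk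
    { app := fun T => ↾fun a => (completionProj f hQ hQK A).app T a
      naturality := fun T T' i => by
        ext a
        exact NatTrans.naturality_apply (completionProj f hQ hQK A) i a }
  smul {T} g a := completionMul A ((completionIncl K A).app T g) a
  map_smul {T T'} i g a := (_root_.map_mul ((completion K A).map i).hom _ _).trans
    (congrArg (fun z => completionMul A z ((completion K A).map i a))
      (NatTrans.naturality_apply (completionIncl K A) i g).symm)
  one_smul {T} a := (congrArg (fun z => completionMul A z a)
    (_root_.map_one ((completionIncl K A).app T).hom)).trans
      (one_mul (M := (completion K A).obj T) a)
  mul_smul {T} g h a := (congrArg (fun z => completionMul A z a)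
    (_root_.map_mul ((completionIncl K A).app T).hom g h)).trans
      (_root_.mul_assoc (G := (completion K A).obj T) _ _ _)
  proj_smul {T} g a := (_root_.map_mul ((completionProj f hQ hQK A).app T).hom _ _).trans
    ((congrArg (fun z : hQ.toPresheaf.obj T => z * (completionProj f hQ hQK A).app T a)
      (completionProj_completionIncl f hQ hQK A g)).trans
        (one_mul (M := hQ.toPresheaf.obj T) _))

theorem bijective_shear_completionObj (hJK : J ≤ K)
    (hinj : ∀ T, Function.Injective (f.hom.hom.app T))
    (hG : Presieve.IsSheaf K (G.obj ⋙ forget CommGrpCat)) (T : Cᵒᵖ) :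
    Function.Bijective ((completionObj f hQ hQK A hJK).shear T) := by
  constructor
  · rintro ⟨g, a⟩ ⟨h, b⟩ e
    have e₁ := congrArg (fun z => z.1) e
    obtain ⟨e₂, rfl⟩ := Prod.ext_iff.1 e₁
    exact Prod.ext (completionIncl_injective A hG T
      (_root_.mul_right_cancel (G := (completion K A).obj T) e₂)) rfl
  · rintro ⟨⟨a, b⟩, e⟩
    obtain ⟨g, hg⟩ := exists_completionMul_eq f hQ hQK A hinj hG a b e
    exact ⟨(g, b), Subtype.ext (Prod.ext hg rfl)⟩

/-- Locally for `K`, a section of `Q` is a quotient `m n⁻¹` of sections of `M` which lift to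
sections `p` and `q` of `P`; it is the image of `p q⁻¹`. -/
theorem isLocallySurjective_completionObj (hJK : J ≤ K) (hf : LocallyGenerates K f) :
    Presheaf.IsLocallySurjective K (completionObj f hQ hQK A hJK).proj.hom where
  imageSieve_mem {T} x := by
    obtain ⟨R, hR, h⟩ := hf x
    refine K.transitive hR _ fun U i hi => ?_
    obtain ⟨m, n, hmn⟩ := h i hi
    have hls := A.isTorsor.isLocallySurjective
    refine K.superset_covering ?_ (K.intersection_covering
      (hJK _ (Presheaf.imageSieve_mem J A.P.proj.hom m))
      (hJK _ (Presheaf.imageSieve_mem J A.P.proj.hom n)))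
    rintro V j ⟨⟨p, hp⟩, ⟨q, hq⟩⟩
    refine ⟨(completionOf A p / completionOf A q : (completion K A).obj (op V)), ?_⟩
    refine (_root_.map_div ((completionProj f hQ hQK A).app (op V)).hom _ _).trans ?_
    refine (div_eq_iff_eq_mul (G := hQ.toPresheaf.obj (op V))).2 ?_
    refine (completionProj_completionOf f hQ hQK A p).trans ?_
    refine Eq.trans ?_ (congrArg (Q.mul (Q.sheaf.obj.map (j ≫ i).op x))
      (completionProj_completionOf f hQ hQK A q)).symm
    rw [hp, hq, NatTrans.naturality_apply, NatTrans.naturality_apply, ← hmn, Q.map_mul, op_comp,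
      Functor.map_comp_apply]

/-- The group completion of `G ⊔ P`, as a multiplicative torsor over `Q`. -/
noncomputable def completionTorsor (hJK : J ≤ K) (h : (completionObj f hQ hQK A hJK).IsTorsor) :
    MultTorsor G Q :=
  ofMul (completionObj f hQ hQK A hJK) h
    (fun a b => completionMul A a b)
    (fun i a b => map_completionMul A i a b)
    (fun a b => completionProj_completionMul f hQ hQK A a b)
    (fun {T} _ _ _ => _root_.mul_assoc (G := (completion K A).obj T) _ _ _)
    (fun {T} _ _ _ => mul_left_comm (G := (completion K A).obj T) _ _ _)
    (fun {T} _ _ => _root_.mul_comm (G := (completion K A).obj T) _ _)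
    (fun {T} _ _ _ => _root_.mul_assoc (G := (completion K A).obj T) _ _ _)

/-- The morphism from `P` to the restriction to `M` of the group completion of `G ⊔ P`. -/
noncomputable def toPullbackCompletion (hJK : J ≤ K)
    (h : (completionObj f hQ hQK A hJK).IsTorsor) :
    A ⟶ pullback f (completionTorsor f hQ hQK A hJK h) where
  hom :=
    { hom := ObjectProperty.homMk
        { app := fun T => ↾fun p => (completionObj f hQ hQK A hJK).pullbackMk f.hom
            (completionOf A p) (A.P.proj.hom.app T p) (completionProj_completionOf f hQ hQK A p)
          naturality := fun T T' i => by
            ext p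
            exact GObj.pullbackMk_congr (completionObj f hQ hQK A hJK) f.hom _ _
              (map_completionOf A i p).symm (NatTrans.naturality_apply A.P.proj.hom i p) }
      proj := fun _ => rfl
      map_smul := fun g p => GObj.pullbackMk_congr (completionObj f hQ hQK A hJK) f.hom _ _
        (completionOf_smul A g p) (A.P.proj_smul g p) }
  map_mul {T} p q := by
    refine Subtype.ext (Eq.trans ?_
      (pullback_mul f (completionTorsor f hQ hQK A hJK h) _ _).symm)
    refine Prod.ext ((completionOf_mul A p q).trans ?_) (A.proj_mul p q)
    exact (ofMul_mul (completionObj f hQ hQK A hJK) h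
      (fun a b => completionMul A a b) _ _ _ _ _ _ _ _).symm

/-- Let `K` be a topology finer than `J` for which `Q` and `G` are sheaves, and let `M ⊆ Q` be a
subsemigroup whose quotients `x y⁻¹` generate `Q` locally for `K`. If `K`-torsors under `G` over `Q`
are `J`-torsors, then the restriction functor from `Q` to `M` is an equivalence on multiplicative
`J`-torsors. -/
theorem pullbackFunctor_isEquivalence (f : SemigroupHom M Q) (hQ : Q.IsGroup)
    (hQK : Presieve.IsSheaf K Q.sheaf.obj)
    (hG : Presieve.IsSheaf K (G.obj ⋙ forget CommGrpCat)) (hJK : J ≤ K)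
    (hf : LocallyGenerates K f) (hinj : ∀ T, Function.Injective (f.hom.hom.app T))
    (hdesc : ∀ P : GObj G Q.sheaf, Presieve.IsSheaf K P.sheaf.obj →
      Presheaf.IsLocallySurjective K P.proj.hom →
      (∀ T, Function.Bijective (P.shear T)) → Presheaf.IsLocallySurjective J P.proj.hom) :
    (pullbackFunctor G f).IsEquivalence := by
  have hfull := pullbackFunctor_full hQ.mul_right_cancel hinj hJK hf hQK hG
  have hfaithful := pullbackFunctor_faithful (G := G) hQ.mul_right_cancel hJK hf hQK hG
  have : (pullbackFunctor G f).EssSurj := ⟨fun A => by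
    have hshear := bijective_shear_completionObj f hQ hQK A hJK hinj hG
    have h : (completionObj f hQ hQK A hJK).IsTorsor :=
      ⟨(Sheaf.isLocallySurjective_iff_epi _).1 (hdesc _ (presieveIsSheaf_completion A)
        (isLocallySurjective_completionObj f hQ hQK A hJK hf) hshear), hshear⟩
    have := isIso_of_hom (toPullbackCompletion f hQ hQK A hJK h)
    exact ⟨completionTorsor f hQ hQK A hJK h,
      ⟨(asIso (toPullbackCompletion f hQ hQK A hJK h)).symm⟩⟩⟩
  exact {}

end MultTorsor

end TwoTopologies

/-! ### Faithfully flat descent of torsors under a finite group -/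

section Algebra

open TensorProduct
variable {A B : Type u} [CommRing A] [CommRing B] [Algebra A B] {Γ : Type*}

/-- The morphism `f ↦ (g ↦ 1 ⊗ f g)`. -/
noncomputable def constHom : (Γ → B) →ₐ[A] (Γ → B ⊗[A] B) :=
  AlgHom.pi fun g => (Algebra.TensorProduct.includeRight).comp (Pi.evalAlgHom A _ g)

theorem constHom_apply (f : Γ → B) (g : Γ) : constHom (A := A) f g = 1 ⊗ₜ f g := rfl

variable [Fintype Γ] [CommGroup Γ] {e : Γ → B ⊗[A] B}

/-- The morphism `f ↦ (g ↦ ∑ h, e h * (f (g h) ⊗ 1))`: if `e` corresponds to the locally constant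
function `c`, it sends `f` to the function `(f ∘ p₁)(g c)`. -/
noncomputable def coaction (he : CompleteOrthogonalIdempotents e) :
    (Γ → B) →ₐ[A] (Γ → B ⊗[A] B) where
  toFun f g := ∑ h, e h * (f (g * h) ⊗ₜ 1)
  map_one' := by
    ext g
    simp [← Algebra.TensorProduct.one_def, he.complete]
  map_mul' f f' := by
    ext g
    simp only [Pi.mul_apply]
    rw [Finset.sum_mul_sum]
    refine Finset.sum_congr rfl fun h _ => ?_
    rw [Finset.sum_eq_single h]
    · rw [mul_mul_mul_comm, (he.idem h).eq, Algebra.TensorProduct.tmul_mul_tmul, one_mul]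
    · intro k _ hk
      rw [mul_mul_mul_comm, he.ortho hk.symm, zero_mul]
    · simp
  map_zero' := by ext; simp
  map_add' f f' := by
    ext g
    simp [add_tmul, mul_add, Finset.sum_add_distrib]
  commutes' a := by
    ext g
    simp only [Pi.algebraMap_apply]
    rw [← Finset.sum_mul, he.complete, one_mul]
    simp [Algebra.TensorProduct.algebraMap_apply]

theorem coaction_apply (he : CompleteOrthogonalIdempotents e) (f : Γ → B) (g : Γ) :
    coaction he f g = ∑ h, e h * (f (g * h) ⊗ₜ 1) := rfl

/-- The `A`-algebra of functions on the `Γ`-torsor over `Spec A` obtained from the trivial torsor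
over `Spec B` by descent along the cocycle given by `e`. -/
noncomputable def descentRing (he : CompleteOrthogonalIdempotents e) : Subalgebra A (Γ → B) :=
  AlgHom.equalizer (coaction he) constHom

theorem sum_of_mem_descentRing (he : CompleteOrthogonalIdempotents e) (f : descentRing he)
    (g : Γ) : ∑ h, e h * (f.1 (g * h) ⊗ₜ 1) = 1 ⊗ₜ f.1 g :=
  congrFun ((AlgHom.mem_equalizer _ _ _).1 f.2) g

/-- The morphism `B ⊗ C → B^Γ` which exhibits the torsor `Spec C` as trivial over `Spec B`. -/
noncomputable def comparison (he : CompleteOrthogonalIdempotents e) :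
    B ⊗[A] descentRing he →ₐ[B] (Γ → B) :=
  Algebra.TensorProduct.lift (Algebra.ofId B _) (descentRing he).val fun _ _ => Commute.all _ _

theorem comparison_tmul (he : CompleteOrthogonalIdempotents e) (b : B) (f : descentRing he)
    (g : Γ) : comparison he (b ⊗ₜ f) g = b * f.1 g := by
  simp [comparison, Algebra.ofId_apply]

variable [DecidableEq Γ]

variable (e) in
/-- A complete family of orthogonal idempotents `e` of `B ⊗ B` indexed by the group `Γ`, that is,
a locally constant function `c : Spec (B ⊗ B) → Γ`, which satisfies the cocycle identity
`c₁₃ = c₂₃ c₁₂` on `Spec (B ⊗ B ⊗ B)` and is trivial on the diagonal. -/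
structure IsIdempotentCocycle : Prop where
  complete : CompleteOrthogonalIdempotents e
  diag : ∀ g, Algebra.TensorProduct.lmul' A (S := B) (e g) = if g = 1 then 1 else 0
  cocycle : ∀ g, Algebra.TensorProduct.map (.id A B)
      (Algebra.TensorProduct.includeRight (R := A) (A := B) (B := B)) (e g) =
    ∑ h, Algebra.TensorProduct.includeRight (R := A) (A := B) (e h) *
      Algebra.TensorProduct.map (.id A B) (Algebra.TensorProduct.includeLeft (R := A) (S := A)
        (A := B) (B := B)) (e (h⁻¹ * g))

/-- The coaction on `B ⊗ C ≃ B^Γ` is induced by the inclusion of `C` in `B^Γ`. -/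
theorem coaction_comparison (he : CompleteOrthogonalIdempotents e) (x : B ⊗[A] descentRing he) :
    coaction he (comparison he x) =
      piRight A A B (fun _ : Γ => B) ((descentRing he).val.toLinearMap.lTensor B x) := by
  induction x with
  | zero => simp only [map_zero]
  | add x y hx hy => simp only [map_add, hx, hy]
  | tmul b f =>
    ext g
    rw [coaction_apply]
    simp only [comparison_tmul, LinearMap.lTensor_tmul, piRight_apply, piRightHom_tmul]
    have h : ∀ k, e k * ((b * f.1 (g * k)) ⊗ₜ[A] (1 : B)) =
        (b ⊗ₜ 1) * (e k * (f.1 (g * k) ⊗ₜ 1)) := fun k => by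
      rw [mul_left_comm, Algebra.TensorProduct.tmul_mul_tmul, one_mul]
    simp only [h]
    rw [← Finset.mul_sum, sum_of_mem_descentRing, Algebra.TensorProduct.tmul_mul_tmul, mul_one,
      one_mul]
    rfl

/-- Restriction to the diagonal is a retraction of the coaction. -/
theorem coaction_injective (he : IsIdempotentCocycle e) :
    Function.Injective (coaction he.complete) := by
  have key : ∀ (f : Γ → B) (g : Γ),
      Algebra.TensorProduct.lmul' A (S := B) (coaction he.complete f g) = f g := by
    intro f g
    rw [coaction_apply, map_sum, Finset.sum_eq_single 1]
    · simp [he.diag]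
    · intro h _ hh
      rw [map_mul, he.diag, if_neg hh, zero_mul]
    · simp
  intro f f' h
  ext g
  rw [← key f, ← key f', h]

/-- The cocycle identity: the image of the coaction satisfies the equation defining
`B ⊗ C` in `B ⊗ B^Γ`. -/
theorem lTensor_coaction_eq (he : IsIdempotentCocycle e) (f : Γ → B) :
    (coaction he.complete).toLinearMap.lTensor B
        ((piRight A A B (fun _ : Γ => B)).symm (coaction he.complete f)) =
      (constHom (A := A) (B := B) (Γ := Γ)).toLinearMap.lTensor B
        ((piRight A A B (fun _ : Γ => B)).symm (coaction he.complete f)) := by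
  have h₁ : ∀ (z : B ⊗[A] (Γ → B)) (g : Γ), piRight A A B (fun _ : Γ => B ⊗[A] B)
      ((coaction he.complete).toLinearMap.lTensor B z) g =
      ∑ h, Algebra.TensorProduct.includeRight (R := A) (A := B) (e h) *
        Algebra.TensorProduct.map (.id A B) (Algebra.TensorProduct.includeLeft (R := A) (S := A)
          (A := B) (B := B)) (piRight A A B (fun _ : Γ => B) z (g * h)) := by
    intro z g
    induction z with
    | zero => simp
    | add x y hx hy =>
      simp only [map_add, Pi.add_apply, hx, hy, mul_add, Finset.sum_add_distrib]
    | tmul b f =>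
      simp [coaction_apply, tmul_sum]
  have h₂ : ∀ (z : B ⊗[A] (Γ → B)) (g : Γ), piRight A A B (fun _ : Γ => B ⊗[A] B)
      ((constHom (A := A) (B := B) (Γ := Γ)).toLinearMap.lTensor B z) g =
      Algebra.TensorProduct.map (.id A B) (Algebra.TensorProduct.includeRight (R := A)
        (A := B) (B := B)) (piRight A A B (fun _ : Γ => B) z g) := by
    intro z g
    induction z with
    | zero => simp
    | add x y hx hy => simp only [map_add, Pi.add_apply, hx, hy]
    | tmul b f => simp [constHom_apply]
  apply (piRight A A B (fun _ : Γ => B ⊗[A] B)).injective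
  ext g
  rw [h₁, h₂]
  simp only [LinearEquiv.apply_symm_apply, coaction_apply, map_sum, map_mul, he.cocycle]
  simp only [Finset.mul_sum, Finset.sum_mul]
  conv_rhs => rw [Finset.sum_comm]
  refine Finset.sum_congr rfl fun h _ => ?_
  refine Fintype.sum_equiv (Equiv.mulLeft h) _ _ fun k => ?_
  simp [mul_assoc]

/-- By flatness, `B ⊗ C` is the equalizer in `B ⊗ B^Γ` of the two morphisms defining `C`; the
coaction identifies `B^Γ` with it. -/
theorem comparison_bijective [Module.Flat A B] (he : IsIdempotentCocycle e) :
    Function.Bijective (comparison he.complete) := by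
  set C := descentRing he.complete
  constructor
  · have hinj := Module.Flat.lTensor_preserves_injective_linearMap (M := B)
      C.val.toLinearMap Subtype.val_injective
    intro x y h
    apply hinj
    apply (piRight A A B (fun _ : Γ => B)).injective
    rw [← coaction_comparison, ← coaction_comparison, h]
  · intro f
    have hex : Function.Exact C.val.toLinearMap
        ((coaction he.complete).toLinearMap -
          (constHom (A := A) (B := B) (Γ := Γ)).toLinearMap) := by
      intro x
      constructor
      · intro h
        exact ⟨⟨x, (AlgHom.mem_equalizer _ _ _).2 (sub_eq_zero.1 h)⟩, rfl⟩
      · rintro ⟨y, rfl⟩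
        exact sub_eq_zero.2 ((AlgHom.mem_equalizer _ _ _).1 y.2)
    obtain ⟨x, hx⟩ := (Module.Flat.lTensor_exact B hex
      ((piRight A A B (fun _ : Γ => B)).symm (coaction he.complete f))).1 (by
        rw [LinearMap.lTensor_sub, LinearMap.sub_apply, lTensor_coaction_eq he, sub_self])
    refine ⟨x, coaction_injective he ?_⟩
    rw [coaction_comparison, hx, LinearEquiv.apply_symm_apply]

/-- The algebra obtained by descent becomes isomorphic to `B^Γ`, hence étale, over the faithfully
flat algebra `B`. -/
theorem etale_descentRing [Module.FaithfullyFlat A B] (he : IsIdempotentCocycle e) :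
    Algebra.Etale A (descentRing he.complete) := by
  have : Algebra.Etale B (B ⊗[A] descentRing he.complete) :=
    .of_equiv (AlgEquiv.ofBijective _ (comparison_bijective he)).symm
  exact .of_etale_tensorProduct_of_faithfullyFlat B

/-- The isomorphism `C ⊗ B ≃ B^Γ`. -/
noncomputable def comparisonEquiv [Module.Flat A B] (he : IsIdempotentCocycle e) :
    descentRing he.complete ⊗[A] B ≃ₐ[A] (Γ → B) :=
  (Algebra.TensorProduct.comm A _ B).trans
    ((AlgEquiv.ofBijective _ (comparison_bijective he)).restrictScalars A)

theorem comparisonEquiv_tmul [Module.Flat A B] (he : IsIdempotentCocycle e)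
    (f : descentRing he.complete) (b : B) (g : Γ) :
    comparisonEquiv he (f ⊗ₜ b) g = b * f.1 g :=
  comparison_tmul he.complete b f g

/-- The idempotents of `C ⊗ B` which define the tautological section of the torsor
over `Spec (C ⊗ B)`. -/
noncomputable def tautIdem [Module.Flat A B] (he : IsIdempotentCocycle e) (g : Γ) :
    descentRing he.complete ⊗[A] B :=
  (comparisonEquiv he).symm (Pi.single g 1)

theorem completeOrthogonalIdempotents_tautIdem [Module.Flat A B] (he : IsIdempotentCocycle e) :
    CompleteOrthogonalIdempotents (tautIdem he) :=
  (CompleteOrthogonalIdempotents.single (fun _ : Γ => B)).map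
    (comparisonEquiv he).symm.toRingEquiv.toRingHom

theorem sum_tautIdem [Module.Flat A B] (he : IsIdempotentCocycle e)
    (x : descentRing he.complete ⊗[A] B) :
    x = ∑ g, Algebra.TensorProduct.includeRight (comparisonEquiv he x g) * tautIdem he g := by
  apply (comparisonEquiv he).injective
  ext g
  simp [tautIdem, comparisonEquiv_tmul, Pi.single_apply]

/-- For two homomorphisms `k₁`, `k₂` from `C ⊗ B` which agree on `C`, the pullbacks of the
tautological section `b : Spec (C ⊗ B) → Γ` satisfy `b₁ = c₁₂ b₂`, where `c₁₂` is the pullback of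
the cocycle by the homomorphism `B ⊗ B → E` with components the restrictions of `k₁` and `k₂`. -/
theorem map_tautIdem [Module.Flat A B] (he : IsIdempotentCocycle e) {E : Type*} [CommRing E]
    [Algebra A E] (k₁ k₂ : descentRing he.complete ⊗[A] B →ₐ[A] E)
    (hk : ∀ f, k₁ (f ⊗ₜ 1) = k₂ (f ⊗ₜ 1)) (g : Γ) :
    k₁ (tautIdem he g) = ∑ h, Algebra.TensorProduct.lift
      (k₁.comp Algebra.TensorProduct.includeRight) (k₂.comp Algebra.TensorProduct.includeRight)
      (fun _ _ => Commute.all _ _) (e h) * k₂ (tautIdem he (g * h⁻¹)) := by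
  set m := Algebra.TensorProduct.lift (R := A) (S := A) (A := B) (B := B)
      (k₁.comp Algebra.TensorProduct.includeRight) (k₂.comp Algebra.TensorProduct.includeRight)
      (fun _ _ => Commute.all _ _) with hm
  -- the difference of the two sides is annihilated by all values of elements of `C ⊗ B ≃ B^Γ`
  have key : ∀ x : descentRing he.complete ⊗[A] B,
      ∑ l, k₁ (1 ⊗ₜ comparisonEquiv he x l) *
        (k₁ (tautIdem he l) - ∑ h, m (e h) * k₂ (tautIdem he (l * h⁻¹))) = 0 := by
    intro x
    induction x with
    | zero => simp
    | add x y hx hy =>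
      simp only [map_add, Pi.add_apply, tmul_add, add_mul, Finset.sum_add_distrib, hx, hy, add_zero]
    | tmul f b =>
      have h₁ := congrArg k₁ (sum_tautIdem he (f ⊗ₜ 1))
      have h₂ := congrArg k₂ (sum_tautIdem he (f ⊗ₜ 1))
      rw [← hk, h₁] at h₂
      simp only [map_sum, map_mul, comparisonEquiv_tmul, one_mul,
        Algebra.TensorProduct.includeRight_apply] at h₂
      have h₃ : ∀ l, k₂ (1 ⊗ₜ f.1 l) = ∑ h, m (e h) * k₁ (1 ⊗ₜ f.1 (l * h)) := by
        intro l
        have := congrArg m (sum_of_mem_descentRing he.complete f l)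
        rw [map_sum] at this
        simpa only [hm, map_mul, Algebra.TensorProduct.lift_tmul, AlgHom.comp_apply,
          Algebra.TensorProduct.includeRight_apply, ← Algebra.TensorProduct.one_def, map_one,
          mul_one, one_mul] using this.symm
      have h₄ : ∑ l, k₂ (1 ⊗ₜ f.1 l) * k₂ (tautIdem he l) =
          ∑ l, k₁ (1 ⊗ₜ f.1 l) * ∑ h, m (e h) * k₂ (tautIdem he (l * h⁻¹)) := by
        simp only [h₃, Finset.mul_sum, Finset.sum_mul]
        rw [Finset.sum_comm]
        conv_rhs => rw [Finset.sum_comm]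
        refine Finset.sum_congr rfl fun h _ => ?_
        refine Fintype.sum_equiv (Equiv.mulRight h) _ _ fun l => ?_
        simp only [Equiv.coe_mulRight, mul_inv_cancel_right]
        ring
      rw [h₄] at h₂
      have h₅ : ∀ l, k₁ (1 ⊗ₜ comparisonEquiv he (f ⊗ₜ b) l) =
          k₁ (1 ⊗ₜ b) * k₁ (1 ⊗ₜ f.1 l) := fun l => by
        rw [comparisonEquiv_tmul, ← map_mul, Algebra.TensorProduct.tmul_mul_tmul, one_mul]
      simp only [h₅, mul_assoc, ← Finset.mul_sum, mul_sub, Finset.sum_sub_distrib]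
      rw [h₂, sub_self]
  have h := key (tautIdem he g)
  rw [Finset.sum_eq_single g] at h
  · simpa [tautIdem, ← Algebra.TensorProduct.one_def, sub_eq_zero] using h
  · intro l _ hl
    simp [tautIdem, hl]
  · simp

end Algebra

/-! ### Locally constant functions on spectra and idempotents -/

section Idempotents

variable {R R' : Type u} [CommRing R] [CommRing R'] {Γ : Type*}

open PrimeSpectrum

theorem eq_of_isIdempotentElem {a b : R} (ha : IsIdempotentElem a) (hb : IsIdempotentElem b)
    (h : ∀ p : PrimeSpectrum R, a ∉ p.asIdeal ↔ b ∉ p.asIdeal) : a = b :=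
  basicOpen_injOn_isIdempotentElem ha hb (TopologicalSpace.Opens.ext (Set.ext h))

theorem exists_idempotent_of_locallyConstant (c : LocallyConstant (PrimeSpectrum R) Γ) (g : Γ) :
    ∃ a : R, IsIdempotentElem a ∧ ∀ p : PrimeSpectrum R, a ∉ p.asIdeal ↔ c p = g := by
  obtain ⟨a, ha, h⟩ := exists_idempotent_basicOpen_eq_of_isClopen
    (c.isLocallyConstant.isClopen_fiber g)
  exact ⟨a, ha, fun p => (Set.ext_iff.1 h p).symm⟩

/-- The idempotent which is `1` where the locally constant function `c` takes the value `g` and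
`0` elsewhere. -/
noncomputable def fiberIdem (c : LocallyConstant (PrimeSpectrum R) Γ) (g : Γ) : R :=
  (exists_idempotent_of_locallyConstant c g).choose

theorem isIdempotentElem_fiberIdem (c : LocallyConstant (PrimeSpectrum R) Γ) (g : Γ) :
    IsIdempotentElem (fiberIdem c g) :=
  (exists_idempotent_of_locallyConstant c g).choose_spec.1

theorem fiberIdem_notMem (c : LocallyConstant (PrimeSpectrum R) Γ) (g : Γ)
    (p : PrimeSpectrum R) : fiberIdem c g ∉ p.asIdeal ↔ c p = g :=
  (exists_idempotent_of_locallyConstant c g).choose_spec.2 p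

/-- The map on spectra defined by a ring homomorphism, as a bundled continuous map. -/
def spectrumMap (φ : R →+* R') : C(PrimeSpectrum R', PrimeSpectrum R) :=
  ⟨PrimeSpectrum.comap φ, PrimeSpectrum.continuous_comap φ⟩

theorem map_fiberIdem (φ : R →+* R') (c : LocallyConstant (PrimeSpectrum R) Γ) (g : Γ) :
    φ (fiberIdem c g) = fiberIdem (c.comap (spectrumMap φ)) g := by
  refine eq_of_isIdempotentElem ((isIdempotentElem_fiberIdem c g).map φ)
    (isIdempotentElem_fiberIdem _ g) fun p => ?_
  rw [fiberIdem_notMem]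
  exact fiberIdem_notMem c g (PrimeSpectrum.comap φ p)

theorem ext_fiberIdem {c d : LocallyConstant (PrimeSpectrum R) Γ}
    (h : ∀ g, fiberIdem c g = fiberIdem d g) : c = d := by
  ext p
  rw [eq_comm, ← fiberIdem_notMem, ← h, fiberIdem_notMem]

theorem fiberIdem_mul_fiberIdem_of_ne (c : LocallyConstant (PrimeSpectrum R) Γ) {g h : Γ}
    (hgh : g ≠ h) : fiberIdem c g * fiberIdem c h = 0 := by
  refine eq_of_isIdempotentElem
    ((isIdempotentElem_fiberIdem c g).mul (isIdempotentElem_fiberIdem c h)) .zero fun p => ?_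
  rw [p.isPrime.mul_mem_iff_mem_or_mem, not_or, fiberIdem_notMem, fiberIdem_notMem]
  simp only [zero_mem, not_true_eq_false, iff_false, not_and]
  rintro rfl h
  exact hgh h

theorem completeOrthogonalIdempotents_fiberIdem [Fintype Γ]
    (c : LocallyConstant (PrimeSpectrum R) Γ) :
    CompleteOrthogonalIdempotents (fiberIdem c) where
  idem := isIdempotentElem_fiberIdem c
  ortho _ _ h := fiberIdem_mul_fiberIdem_of_ne c h
  complete := by
    have ho : OrthogonalIdempotents (fiberIdem c) :=
      ⟨isIdempotentElem_fiberIdem c, fun _ _ h => fiberIdem_mul_fiberIdem_of_ne c h⟩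
    refine eq_of_isIdempotentElem ho.isIdempotentElem_sum .one fun p => ?_
    refine iff_of_true (fun h => ?_) p.isPrime.one_notMem
    refine (fiberIdem_notMem c (c p) p).2 rfl ?_
    have := p.asIdeal.mul_mem_left (fiberIdem c (c p)) h
    rwa [ho.mul_sum_of_mem (Finset.mem_univ _)] at this

/-- A complete family of orthogonal idempotents defines a locally constant function. -/
theorem exists_fiberIdem_eq [Fintype Γ] {e : Γ → R} (he : CompleteOrthogonalIdempotents e) :
    ∃ c : LocallyConstant (PrimeSpectrum R) Γ, ∀ g, fiberIdem c g = e g := by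
  have hex : ∀ p : PrimeSpectrum R, ∃ g, e g ∉ p.asIdeal := by
    intro p
    by_contra! h
    refine p.isPrime.one_notMem ?_
    rw [← he.complete]
    exact sum_mem fun g _ => h g
  choose c hc using hex
  have hc' : ∀ p g, e g ∉ p.asIdeal ↔ c p = g := by
    refine fun p g => ⟨fun h => ?_, fun h => h ▸ hc p⟩
    by_contra hne
    have : e (c p) * e g ∈ p.asIdeal := by
      rw [he.ortho hne]
      exact zero_mem _
    exact (p.isPrime.mem_or_mem this).elim (hc p) h
  refine ⟨⟨c, (IsLocallyConstant.iff_isOpen_fiber).2 fun g => ?_⟩, fun g => ?_⟩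
  · convert (basicOpen (e g)).isOpen using 1
    exact Set.ext fun p => (hc' p g).symm
  · refine eq_of_isIdempotentElem (isIdempotentElem_fiberIdem _ g) (he.idem g) fun p => ?_
    rw [fiberIdem_notMem, hc']
    rfl

theorem fiberIdem_one [DecidableEq Γ] [One Γ] (g : Γ) :
    fiberIdem (1 : LocallyConstant (PrimeSpectrum R) Γ) g = if g = 1 then 1 else 0 := by
  refine eq_of_isIdempotentElem (isIdempotentElem_fiberIdem _ g) ?_ fun p => ?_
  · split_ifs
    exacts [.one, .zero]
  · rw [fiberIdem_notMem]
    split_ifs with h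
    · exact iff_of_true h.symm p.isPrime.one_notMem
    · exact iff_of_false (fun h' => h h'.symm) (not_not.2 (zero_mem _))

theorem fiberIdem_mul [Fintype Γ] [Group Γ] (c d : LocallyConstant (PrimeSpectrum R) Γ) (g : Γ) :
    fiberIdem (c * d) g = ∑ h, fiberIdem c h * fiberIdem d (h⁻¹ * g) := by
  classical
  have key : ∀ h k, fiberIdem c h * fiberIdem d k * fiberIdem (c * d) g =
      if k = h⁻¹ * g then fiberIdem c h * fiberIdem d k else 0 := by
    intro h k
    have hi := (isIdempotentElem_fiberIdem c h).mul (isIdempotentElem_fiberIdem d k)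
    refine eq_of_isIdempotentElem (hi.mul (isIdempotentElem_fiberIdem _ g)) ?_ fun p => ?_
    · split_ifs
      exacts [hi, .zero]
    · rw [p.isPrime.mul_mem_iff_mem_or_mem, not_or, fiberIdem_notMem]
      split_ifs with hk
      · refine and_iff_left_of_imp fun hp => ?_
        rw [p.isPrime.mul_mem_iff_mem_or_mem, not_or, fiberIdem_notMem, fiberIdem_notMem] at hp
        rw [LocallyConstant.mul_apply, hp.1, hp.2, hk, mul_inv_cancel_left]
      · refine iff_of_false (fun ⟨hp, hp'⟩ => hk ?_) (not_not.2 (zero_mem _))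
        rw [p.isPrime.mul_mem_iff_mem_or_mem, not_or, fiberIdem_notMem, fiberIdem_notMem] at hp
        rw [LocallyConstant.mul_apply, hp.1, hp.2] at hp'
        rw [← hp', inv_mul_cancel_left]
  calc fiberIdem (c * d) g
      = (∑ h, fiberIdem c h) * (∑ k, fiberIdem d k) * fiberIdem (c * d) g := by
        rw [(completeOrthogonalIdempotents_fiberIdem c).complete,
          (completeOrthogonalIdempotents_fiberIdem d).complete, one_mul, one_mul]
    _ = _ := by
        rw [Finset.sum_mul_sum, Finset.sum_mul]
        refine Finset.sum_congr rfl fun h _ => ?_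
        rw [Finset.sum_mul]
        simp only [key, Finset.sum_ite_eq', Finset.mem_univ, if_true]

end Idempotents

/-! ### Faithfully flat covers of affine schemes -/

section FaithfullyFlatCovers

open AlgebraicGeometry TensorProduct

universe w

variable {S : Scheme.{u}}

/-- The fpqc topology on the category of `S`-schemes. -/
abbrev bigFpqc (S : Scheme.{u}) : GrothendieckTopology (Over S) :=
  Scheme.fpqcTopology.over S

theorem bigEtale_le_bigFpqc (S : Scheme.{u}) : bigEtale S ≤ bigFpqc S := by
  intro T R hR
  rw [GrothendieckTopology.mem_over_iff] at hR ⊢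
  exact Scheme.etaleTopology_le_proetaleTopology.trans Scheme.proetaleTopology_le_fpqcTopology
    _ hR

theorem generate_singleton_mem_over {C : Type*} [Category* C] {J : GrothendieckTopology C} {S : C}
    {X Y : Over S} (f : Y ⟶ X) (h : Sieve.generate (Presieve.singleton f.left) ∈ J X.left) :
    Sieve.generate (Presieve.singleton f) ∈ J.over S X := by
  rw [GrothendieckTopology.mem_over_iff, Sieve.overEquiv_generate]
  refine J.superset_covering ?_ h
  rw [Sieve.generate_le_iff]
  rintro Z g ⟨⟩
  exact Sieve.le_generate _ _ _
    (Presieve.image_mem_functorPushforward (Over.forget S) _ (Presieve.singleton_self f))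

theorem generate_singleton_mem_bigFpqc {X Y : Over S} (f : Y ⟶ X) [Flat f.left]
    [Surjective f.left] [QuasiCompact f.left] :
    Sieve.generate (Presieve.singleton f) ∈ bigFpqc S X :=
  generate_singleton_mem_over f
    (Precoverage.generate_mem_toGrothendieck f.left.singleton_mem_fpqcPrecoverage)

theorem generate_singleton_mem_bigEtale {X Y : Over S} (f : Y ⟶ X) [Etale f.left]
    [Surjective f.left] :
    Sieve.generate (Presieve.singleton f) ∈ bigEtale S X :=
  generate_singleton_mem_over f
    (Precoverage.generate_mem_toGrothendieck
      ((Scheme.singleton_mem_precoverage_iff _ f.left).2 ⟨f.left.surjective, inferInstance⟩))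

variable {A : Type u} [CommRing A] (t : Spec (.of A) ⟶ S)

/-- The `S`-scheme `Spec R`, for an algebra `R` over a ring `A` with a morphism
`t : Spec A ⟶ S`. -/
noncomputable def affOver (R : Type u) [CommRing R] [Algebra A R] : Over S :=
  Over.mk (Spec.map (CommRingCat.ofHom (algebraMap A R)) ≫ t)

variable {R R' R'' : Type u} [CommRing R] [CommRing R'] [CommRing R''] [Algebra A R]
  [Algebra A R'] [Algebra A R'']

/-- The morphism of `S`-schemes `Spec R' ⟶ Spec R` defined by a homomorphism of `A`-algebras. -/
noncomputable def affMap (φ : R →ₐ[A] R') : affOver t R' ⟶ affOver t R :=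
  Over.homMk (Spec.map (CommRingCat.ofHom φ.toRingHom)) (by
    change Spec.map _ ≫ Spec.map _ ≫ t = Spec.map _ ≫ t
    rw [← Category.assoc, ← Spec.map_comp, ← CommRingCat.ofHom_comp]
    congr 3
    exact φ.comp_algebraMap)

variable (R) in
/-- The structure morphism `Spec R ⟶ Spec A` of `S`-schemes. -/
noncomputable def affStr : affOver t R ⟶ Over.mk t :=
  Over.homMk (Spec.map (CommRingCat.ofHom (algebraMap A R))) rfl

theorem affMap_comp (φ : R →ₐ[A] R') (ψ : R' →ₐ[A] R'') :
    affMap t (ψ.comp φ) = affMap t ψ ≫ affMap t φ := by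
  ext1
  change Spec.map _ = Spec.map _ ≫ Spec.map _
  rw [← Spec.map_comp]
  rfl

theorem affMap_affStr (φ : R →ₐ[A] R') : affMap t φ ≫ affStr t R = affStr t R' := by
  ext1
  change Spec.map _ ≫ Spec.map _ = Spec.map _
  rw [← Spec.map_comp, ← CommRingCat.ofHom_comp]
  congr 2
  exact φ.comp_algebraMap

variable {F : (Over S)ᵒᵖ ⥤ Type w}

theorem map_affMap_comp (φ : R →ₐ[A] R') (ψ : R' →ₐ[A] R'') (s : F.obj (op (affOver t R))) :
    F.map (affMap t ψ).op (F.map (affMap t φ).op s) = F.map (affMap t (ψ.comp φ)).op s := by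
  rw [affMap_comp, op_comp, Functor.map_comp]
  rfl

theorem map_affMap_affStr (φ : R →ₐ[A] R') (s : F.obj (op (Over.mk t))) :
    F.map (affMap t φ).op (F.map (affStr t R).op s) = F.map (affStr t R').op s := by
  rw [← affMap_affStr t φ, op_comp, Functor.map_comp]
  rfl

section Descent

variable {C D : Type u} [CommRing C] [CommRing D] [Algebra A C] [Algebra A D] [Algebra C D]
  [IsScalarTower A C D] [Module.FaithfullyFlat C D]

theorem flat_surjective_affMap :
    Flat (affMap t (IsScalarTower.toAlgHom A C D)).left ∧
      Surjective (affMap t (IsScalarTower.toAlgHom A C D)).left := by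
  refine (flat_and_surjective_SpecMap_iff (CommRingCat.ofHom _)).2 ?_
  change (algebraMap C D).FaithfullyFlat
  rwa [RingHom.faithfullyFlat_algebraMap_iff]

theorem isSheafFor_affMap (hF : Presieve.IsSheaf (bigFpqc S) F) :
    Presieve.IsSheafFor F (Presieve.singleton (affMap t (IsScalarTower.toAlgHom A C D))) := by
  rw [Presieve.isSheafFor_iff_generate]
  apply hF
  have := (flat_surjective_affMap t (C := C) (D := D)).1
  have := (flat_surjective_affMap t (C := C) (D := D)).2
  have : QuasiCompact (affMap t (IsScalarTower.toAlgHom A C D)).left :=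
    inferInstanceAs (QuasiCompact (Spec.map _))
  exact generate_singleton_mem_bigFpqc _

theorem exists_lift_tensor {C D : Type u} [CommRing C] [CommRing D] [Algebra C D] {Z : Scheme.{u}}
    (p₁ p₂ : Z ⟶ Spec (.of D)) (e : p₁ ≫ Spec.map (CommRingCat.ofHom (algebraMap C D)) =
      p₂ ≫ Spec.map (CommRingCat.ofHom (algebraMap C D))) :
    ∃ q : Z ⟶ Spec (.of (D ⊗[C] D)),
      q ≫ Spec.map (CommRingCat.ofHom
        (Algebra.TensorProduct.includeLeftRingHom : D →+* D ⊗[C] D)) = p₁ ∧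
      q ≫ Spec.map (CommRingCat.ofHom
        ((Algebra.TensorProduct.includeRight : D →ₐ[C] D ⊗[C] D) : D →+* D ⊗[C] D)) = p₂ := by
  refine ⟨Limits.pullback.lift p₁ p₂ e ≫ (pullbackSpecIso C D D).hom, ?_, ?_⟩
  · rw [Category.assoc, pullbackSpecIso_hom_fst, Limits.pullback.lift_fst]
  · rw [Category.assoc, pullbackSpecIso_hom_snd, Limits.pullback.lift_snd]

/-- Sections of an fpqc sheaf descend along a faithfully flat homomorphism `C → D` when their
two pullbacks to `D ⊗[C] D` agree. -/
theorem exists_descent (hF : Presieve.IsSheaf (bigFpqc S) F)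
    (s : F.obj (op (affOver t D)))
    (h : F.map (affMap t (Algebra.TensorProduct.includeLeft (R := C) (S := C) (A := D)
        (B := D) |>.restrictScalars A)).op s =
      F.map (affMap t (Algebra.TensorProduct.includeRight (R := C) (A := D) (B := D)
        |>.restrictScalars A)).op s) :
    ∃ s₀ : F.obj (op (affOver t C)),
      F.map (affMap t (IsScalarTower.toAlgHom A C D)).op s₀ = s := by
  refine ((Presieve.isSheafFor_singleton.1 (isSheafFor_affMap t hF)) s ?_).exists
  intro Z p₁ p₂ e
  obtain ⟨q, hq₁, hq₂⟩ := exists_lift_tensor (C := C) (D := D) p₁.left p₂.left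
    (congrArg (fun k => k.left) e)
  have hq : q ≫ (affOver t (D ⊗[C] D)).hom = Z.hom := by
    refine (congrArg (q ≫ ·) (Over.w (affMap t (Algebra.TensorProduct.includeLeft (R := C) (S := C)
      (A := D) (B := D) |>.restrictScalars A))).symm).trans ?_
    refine (Category.assoc _ _ _).symm.trans ?_
    exact (congrArg (· ≫ (affOver t D).hom) hq₁).trans (Over.w p₁)
  let q' : Z ⟶ affOver t (D ⊗[C] D) := Over.homMk q hq
  have h₁ : p₁ = q' ≫ affMap t (Algebra.TensorProduct.includeLeft (R := C) (S := C) (A := D)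
        (B := D) |>.restrictScalars A) := Over.OverMorphism.ext hq₁.symm
  have h₂ : p₂ = q' ≫ affMap t (Algebra.TensorProduct.includeRight (R := C) (A := D) (B := D)
        |>.restrictScalars A) := Over.OverMorphism.ext hq₂.symm
  rw [h₁, h₂, op_comp, op_comp, Functor.map_comp, Functor.map_comp]
  exact congrArg (F.map q'.op) h

theorem injective_map_affMap (hF : Presieve.IsSheaf (bigFpqc S) F) :
    Function.Injective (F.map (affMap t (IsScalarTower.toAlgHom A C D)).op) := by
  intro s s' h
  refine (isSheafFor_affMap t (C := C) (D := D) hF).isSeparatedFor.ext ?_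
  rintro _ _ ⟨⟩
  exact h

end Descent

end FaithfullyFlatCovers

/-! ### Sections of the constant sheaf over affine schemes -/

section FiberIdempotents

open AlgebraicGeometry TensorProduct

variable {S : Scheme.{u}} {A : Type u} [CommRing A] {t : Spec (.of A) ⟶ S} {Γ : Type u}
  [CommGroup Γ] {R R' : Type u} [CommRing R] [CommRing R'] [Algebra A R] [Algebra A R']

/-- The locally constant function on the prime spectrum of `R` underlying a section of the constant
sheaf over `Spec R`. -/
def sectionFun (c : (constantGroup S Γ).obj.obj (op (affOver t R))) :
    LocallyConstant (PrimeSpectrum R) Γ :=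
  LocallyConstant.map ULift.down (show LocallyConstant (PrimeSpectrum R) (ULift.{u + 1} Γ) from c)

theorem sectionFun_injective :
    Function.Injective (sectionFun : (constantGroup S Γ).obj.obj (op (affOver t R)) → _) := by
  intro c d h
  refine LocallyConstant.ext (X := PrimeSpectrum R) (Y := ULift.{u + 1} Γ) fun p => ?_
  exact ULift.down_injective (LocallyConstant.congr_fun h p)

theorem sectionFun_surjective :
    Function.Surjective (sectionFun : (constantGroup S Γ).obj.obj (op (affOver t R)) → _) :=
  fun c => ⟨show LocallyConstant (PrimeSpectrum R) (ULift.{u + 1} Γ) from c.map ULift.up, rfl⟩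

/-- The idempotent of `R` which is `1` where the section `c` of the constant sheaf over `Spec R`
takes the value `g`, and `0` elsewhere. -/
noncomputable def sectionIdem (c : (constantGroup S Γ).obj.obj (op (affOver t R))) (g : Γ) : R :=
  fiberIdem (sectionFun c) g

theorem map_sectionIdem (φ : R →ₐ[A] R') (c : (constantGroup S Γ).obj.obj (op (affOver t R)))
    (g : Γ) : φ (sectionIdem c g) =
      sectionIdem ((constantGroup S Γ).obj.map (affMap t φ).op c) g :=
  map_fiberIdem φ.toRingHom _ _

theorem sectionIdem_ext {c d : (constantGroup S Γ).obj.obj (op (affOver t R))}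
    (h : ∀ g, sectionIdem c g = sectionIdem d g) : c = d :=
  sectionFun_injective (ext_fiberIdem h)

theorem sectionIdem_one [DecidableEq Γ] (g : Γ) :
    sectionIdem (1 : (constantGroup S Γ).obj.obj (op (affOver t R))) g = if g = 1 then 1 else 0 :=
  fiberIdem_one g

theorem sectionIdem_mul [Fintype Γ] (c d : (constantGroup S Γ).obj.obj (op (affOver t R)))
    (g : Γ) : sectionIdem (c * d) g = ∑ h, sectionIdem c h * sectionIdem d (h⁻¹ * g) :=
  fiberIdem_mul (sectionFun c) (sectionFun d) g

theorem exists_sectionIdem_eq [Fintype Γ] {e : Γ → R} (he : CompleteOrthogonalIdempotents e) :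
    ∃ c : (constantGroup S Γ).obj.obj (op (affOver t R)), ∀ g, sectionIdem c g = e g := by
  obtain ⟨c, hc⟩ := exists_fiberIdem_eq he
  obtain ⟨d, rfl⟩ := sectionFun_surjective (t := t) c
  exact ⟨d, hc⟩

theorem completeOrthogonalIdempotents_sectionIdem [Fintype Γ]
    (c : (constantGroup S Γ).obj.obj (op (affOver t R))) :
    CompleteOrthogonalIdempotents (sectionIdem c) :=
  completeOrthogonalIdempotents_fiberIdem _

end FiberIdempotents

/-! ### Étale-local triviality over affine schemes -/

section LocalTriviality

open AlgebraicGeometry TensorProduct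

variable {S : Scheme.{u}} {Γ : Type u} [CommGroup Γ]
  {X : Sheaf (bigEtale S) (Type (u + 1))} {P : GObj (constantGroup S Γ) X}

theorem GObj.exists_smul_of_bijective_shear (hP : ∀ T, Function.Bijective (P.shear T))
    {T : (Over S)ᵒᵖ} (p q : P.sheaf.obj.obj T) (h : P.proj.hom.app T p = P.proj.hom.app T q) :
    ∃ g, P.smul g q = p := by
  obtain ⟨⟨g, r⟩, e⟩ := (hP T).2 ⟨(p, q), h⟩
  have e' : (P.smul g r, r) = (p, q) := congrArg Subtype.val e
  obtain ⟨e1, rfl⟩ := Prod.ext_iff.1 e'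
  exact ⟨g, e1⟩

theorem GObj.smul_injective_of_bijective_shear (hP : ∀ T, Function.Bijective (P.shear T))
    {T : (Over S)ᵒᵖ} (p : P.sheaf.obj.obj T) {g h} (e : P.smul g p = P.smul h p) : g = h :=
  congrArg Prod.fst ((hP T).1 (a₁ := (g, p)) (a₂ := (h, p)) (Subtype.ext (Prod.ext e rfl)))

variable [Fintype Γ] [DecidableEq Γ] {A B : Type u} [CommRing A] [CommRing B] [Algebra A B]
  {t : Spec (.of A) ⟶ S}

/-- A section `s` of a torsor over `Spec B` yields, by comparison of its two pullbacks to
`Spec (B ⊗ B)`, a cocycle with values in the constant group. -/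
theorem exists_isIdempotentCocycle (hP : ∀ T, Function.Bijective (P.shear T))
    (x : X.obj.obj (op (Over.mk t))) (s : P.sheaf.obj.obj (op (affOver t B)))
    (hs : P.proj.hom.app _ s = X.obj.map (affStr t B).op x) :
    ∃ c : (constantGroup S Γ).obj.obj (op (affOver t (B ⊗[A] B))),
      P.smul c (P.sheaf.obj.map (affMap t (Algebra.TensorProduct.includeLeft (R := A) (S := A)
        (A := B) (B := B))).op s) = P.sheaf.obj.map (affMap t
          (Algebra.TensorProduct.includeRight (R := A) (A := B) (B := B))).op s ∧
      IsIdempotentCocycle (sectionIdem c) := by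
  obtain ⟨c, hc⟩ := GObj.exists_smul_of_bijective_shear hP
    (P.sheaf.obj.map (affMap t (Algebra.TensorProduct.includeRight (R := A) (A := B)
      (B := B))).op s)
    (P.sheaf.obj.map (affMap t (Algebra.TensorProduct.includeLeft (R := A) (S := A) (A := B)
      (B := B))).op s)
    (by rw [NatTrans.naturality_apply, NatTrans.naturality_apply, hs, map_affMap_affStr,
      map_affMap_affStr])
  -- the pullback of the relation `i₂⁎ s = c • i₁⁎ s` along a homomorphism from `B ⊗ B`
  have key : ∀ {E : Type u} [CommRing E] [Algebra A E] (k : B ⊗[A] B →ₐ[A] E) (k₁ k₂ : B →ₐ[A] E),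
      k.comp Algebra.TensorProduct.includeLeft = k₁ →
      k.comp Algebra.TensorProduct.includeRight = k₂ →
      P.smul ((constantGroup S Γ).obj.map (affMap t k).op c)
        (P.sheaf.obj.map (affMap t k₁).op s) = P.sheaf.obj.map (affMap t k₂).op s := by
    rintro E _ _ k _ _ rfl rfl
    have h := congrArg (P.sheaf.obj.map (affMap t k).op) hc
    rw [P.map_smul, map_affMap_comp, map_affMap_comp] at h
    exact h
  refine ⟨c, hc, completeOrthogonalIdempotents_sectionIdem c, fun g => ?_, fun g => ?_⟩
  · have h := key (Algebra.TensorProduct.lmul' A (S := B)) (.id A B) (.id A B)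
      (by ext; simp) (by ext; simp)
    rw [map_sectionIdem (t := t), GObj.smul_injective_of_bijective_shear hP _
      (h.trans (P.one_smul _).symm), sectionIdem_one]
  · let j₁ : B →ₐ[A] B ⊗[A] (B ⊗[A] B) := Algebra.TensorProduct.includeLeft
    let j₂ : B →ₐ[A] B ⊗[A] (B ⊗[A] B) := Algebra.TensorProduct.includeRight.comp
      Algebra.TensorProduct.includeLeft
    let j₃ : B →ₐ[A] B ⊗[A] (B ⊗[A] B) := Algebra.TensorProduct.includeRight.comp
      Algebra.TensorProduct.includeRight
    have h₁₃ := key (Algebra.TensorProduct.map (.id A B)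
      (Algebra.TensorProduct.includeRight (R := A) (A := B) (B := B))) j₁ j₃
      (by ext; simp [j₁]) (by ext; simp [j₃])
    have h₁₂ := key (Algebra.TensorProduct.map (.id A B)
      (Algebra.TensorProduct.includeLeft (R := A) (S := A) (A := B) (B := B))) j₁ j₂
      (by ext; simp [j₁]) (by ext; simp [j₂])
    have h₂₃ := key Algebra.TensorProduct.includeRight j₂ j₃ rfl rfl
    rw [← h₁₂, ← P.mul_smul] at h₂₃
    rw [map_sectionIdem (t := t), GObj.smul_injective_of_bijective_shear hP _
      (h₁₃.trans h₂₃.symm), sectionIdem_mul]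
    simp only [map_sectionIdem (t := t)]

omit [Fintype Γ] [DecidableEq Γ] in
/-- A section over `Spec (C ⊗ B)`, with `B` faithfully flat over `A`, descends to `Spec C` if
any two homomorphisms from `C ⊗ B` which agree on `C` carry it to the same section. -/
theorem exists_section_of_tensor [Module.FaithfullyFlat A B]
    (hPK : Presieve.IsSheaf (bigFpqc S) P.sheaf.obj) (hXK : Presieve.IsSheaf (bigFpqc S) X.obj)
    (x : X.obj.obj (op (Over.mk t))) {C : Type u} [CommRing C] [Algebra A C]
    (s : P.sheaf.obj.obj (op (affOver t (C ⊗[A] B))))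
    (hs : P.proj.hom.app _ s = X.obj.map (affStr t (C ⊗[A] B)).op x)
    (h : ∀ {E : Type u} [CommRing E] [Algebra A E] (k₁ k₂ : C ⊗[A] B →ₐ[A] E),
      (∀ f : C, k₁ (f ⊗ₜ 1) = k₂ (f ⊗ₜ 1)) →
        P.sheaf.obj.map (affMap t k₁).op s = P.sheaf.obj.map (affMap t k₂).op s) :
    ∃ s₀ : P.sheaf.obj.obj (op (affOver t C)),
      P.proj.hom.app _ s₀ = X.obj.map (affStr t C).op x := by
  obtain ⟨s₀, hs₀⟩ := exists_descent (C := C) (D := C ⊗[A] B) t hPK s (h _ _ fun f =>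
    (AlgHom.commutes (Algebra.TensorProduct.includeLeft (R := C) (S := C) (A := C ⊗[A] B)
      (B := C ⊗[A] B)) f).trans (AlgHom.commutes (Algebra.TensorProduct.includeRight (R := C)
        (A := C ⊗[A] B) (B := C ⊗[A] B)) f).symm)
  refine ⟨s₀, injective_map_affMap (C := C) (D := C ⊗[A] B) t hXK ?_⟩
  rw [← NatTrans.naturality_apply, hs₀, hs, map_affMap_affStr]

section

variable [Module.FaithfullyFlat A B] (s : P.sheaf.obj.obj (op (affOver t B)))
  {c : (constantGroup S Γ).obj.obj (op (affOver t (B ⊗[A] B)))}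
  (hc : P.smul c (P.sheaf.obj.map (affMap t (Algebra.TensorProduct.includeLeft (R := A) (S := A)
    (A := B) (B := B))).op s) = P.sheaf.obj.map (affMap t
      (Algebra.TensorProduct.includeRight (R := A) (A := B) (B := B))).op s)
  (he : IsIdempotentCocycle (sectionIdem c))

include hc in
/-- Let `C` be the étale algebra defined by the cocycle of a section `s` over `Spec B`. The
translate of `s` over `Spec (C ⊗ B)` by the tautological section of the group satisfies the
descent condition with respect to `C`. -/
theorem map_smul_taut_eq {b : (constantGroup S Γ).obj.obj
      (op (affOver t (descentRing he.complete ⊗[A] B)))}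
    (hb : ∀ g, sectionIdem b g = tautIdem he g) {E : Type u} [CommRing E] [Algebra A E]
    (k₁ k₂ : descentRing he.complete ⊗[A] B →ₐ[A] E)
    (hk : ∀ f, k₁ (f ⊗ₜ 1) = k₂ (f ⊗ₜ 1)) :
    P.sheaf.obj.map (affMap t k₁).op (P.smul b (P.sheaf.obj.map
      (affMap t (Algebra.TensorProduct.includeRight (R := A) (B := B))).op s)) =
    P.sheaf.obj.map (affMap t k₂).op (P.smul b (P.sheaf.obj.map
      (affMap t (Algebra.TensorProduct.includeRight (R := A) (B := B))).op s)) := by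
  let i : B →ₐ[A] descentRing he.complete ⊗[A] B := Algebra.TensorProduct.includeRight
  let m : B ⊗[A] B →ₐ[A] E :=
    Algebra.TensorProduct.lift (k₁.comp i) (k₂.comp i) fun _ _ => Commute.all _ _
  have hkb : (constantGroup S Γ).obj.map (affMap t k₁).op b =
      (constantGroup S Γ).obj.map (affMap t k₂).op b *
        (constantGroup S Γ).obj.map (affMap t m).op c := by
    refine sectionIdem_ext fun g => ?_
    rw [mul_comm, sectionIdem_mul, ← map_sectionIdem, hb]
    refine (map_tautIdem he k₁ k₂ hk g).trans (Finset.sum_congr rfl fun h _ => ?_)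
    rw [← map_sectionIdem, ← map_sectionIdem, hb, mul_comm g]
  have hm : P.smul ((constantGroup S Γ).obj.map (affMap t m).op c)
      (P.sheaf.obj.map (affMap t (k₁.comp i)).op s) =
        P.sheaf.obj.map (affMap t (k₂.comp i)).op s := by
    have h := congrArg (P.sheaf.obj.map (affMap t m).op) hc
    rw [P.map_smul, map_affMap_comp, map_affMap_comp,
      show m.comp Algebra.TensorProduct.includeLeft = k₁.comp i from
        Algebra.TensorProduct.lift_comp_includeLeft _ _ _,
      show m.comp Algebra.TensorProduct.includeRight = k₂.comp i from
        Algebra.TensorProduct.lift_comp_includeRight _ _ fun _ _ => Commute.all _ _] at h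
    exact h
  rw [P.map_smul, P.map_smul, map_affMap_comp, map_affMap_comp, ← hm, ← P.mul_smul, hkb]

include hc in
theorem exists_section_descentRing
    (hPK : Presieve.IsSheaf (bigFpqc S) P.sheaf.obj) (hXK : Presieve.IsSheaf (bigFpqc S) X.obj)
    (x : X.obj.obj (op (Over.mk t))) (hs : P.proj.hom.app _ s = X.obj.map (affStr t B).op x) :
    ∃ s₀ : P.sheaf.obj.obj (op (affOver t (descentRing he.complete))),
      P.proj.hom.app _ s₀ = X.obj.map (affStr t (descentRing he.complete)).op x := by
  obtain ⟨b, hb⟩ := exists_sectionIdem_eq (t := t) (R := descentRing he.complete ⊗[A] B)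
    (completeOrthogonalIdempotents_tautIdem he)
  refine exists_section_of_tensor hPK hXK x (C := descentRing he.complete) (B := B) _ ?_
    fun k₁ k₂ hk => map_smul_taut_eq s hc he hb k₁ k₂ hk
  rw [P.proj_smul, NatTrans.naturality_apply, hs, map_affMap_affStr]

end

/-- A torsor for the fpqc topology under a finite constant group which has a section over
`Spec B`, with `B` faithfully flat over `A`, is étale-locally trivial over `Spec A`. -/
theorem imageSieve_mem_of_faithfullyFlat [Module.FaithfullyFlat A B]
    (hP : ∀ T, Function.Bijective (P.shear T))
    (hPK : Presieve.IsSheaf (bigFpqc S) P.sheaf.obj) (hXK : Presieve.IsSheaf (bigFpqc S) X.obj)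
    (x : X.obj.obj (op (Over.mk t))) (s : P.sheaf.obj.obj (op (affOver t B)))
    (hs : P.proj.hom.app _ s = X.obj.map (affStr t B).op x) :
    Presheaf.imageSieve P.proj.hom x ∈ bigEtale S (Over.mk t) := by
  obtain ⟨c, hc, he⟩ := exists_isIdempotentCocycle hP x s hs
  obtain ⟨s₀, hs₀⟩ := exists_section_descentRing s hc he hPK hXK x hs
  have h₁ : Etale (affStr t (descentRing he.complete)).left := by
    have := etale_descentRing he
    refine (HasRingHomProperty.Spec_iff (P := @Etale)).2 ?_
    exact RingHom.etale_algebraMap.2 this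
  have h₂ : Surjective (affStr t (descentRing he.complete)).left := by
    -- evaluation at `1` is a homomorphism to the faithfully flat algebra `B`
    let φ : descentRing he.complete →ₐ[A] B := (Pi.evalAlgHom A (fun _ : Γ => B) 1).comp
      (descentRing he.complete).val
    have h : Surjective ((affMap t φ).left ≫ (affStr t (descentRing he.complete)).left) := by
      rw [← Over.comp_left, affMap_affStr]
      refine ((flat_and_surjective_SpecMap_iff (CommRingCat.ofHom (algebraMap A B))).2 ?_).2
      exact RingHom.faithfullyFlat_algebraMap_iff.2 inferInstance
    exact .of_comp (affMap t φ).left _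
  refine GrothendieckTopology.superset_covering _ ?_
    (generate_singleton_mem_bigEtale (affStr t (descentRing he.complete)))
  rw [Sieve.generate_le_iff]
  rintro _ _ ⟨⟩
  exact ⟨s₀, hs₀⟩

end LocalTriviality

/-! ### Reduction of fpqc covers to affine covers -/

section FiniteCovers

open AlgebraicGeometry

universe w

variable {S : Scheme.{u}} {A : Type u} [CommRing A] {t : Spec (.of A) ⟶ S} {ι : Type u} [Finite ι]
  {B : ι → Type u} [∀ j, CommRing (B j)] [∀ j, Algebra A (B j)]
  {F : (Over S)ᵒᵖ ⥤ Type w}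

theorem subsingleton_of_isEmpty (hF : Presieve.IsSheaf (bigFpqc S) F) (Z : Over S)
    [IsEmpty Z.left] : Subsingleton (F.obj (op Z)) := by
  refine ⟨fun s s' => (hF ⊥ ?_).isSeparatedFor.ext fun _ _ h => h.elim⟩
  rw [GrothendieckTopology.mem_over_iff, map_bot]
  exact Scheme.bot_mem_propQCTopology (P := @Flat) Z.left

theorem ofArrows_evalAlgHom_mem :
    Sieve.ofArrows _ (fun j => affMap t (Pi.evalAlgHom A B j)) ∈
      bigFpqc S (affOver t (Π j, B j)) := by
  rw [GrothendieckTopology.mem_over_iff, Sieve.overEquiv_ofArrows]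
  refine Scheme.zariskiTopology_le_fpqcTopology _
    (Precoverage.generate_mem_toGrothendieck ((Scheme.ofArrows_mem_precoverage_iff _).2 ⟨?_, ?_⟩))
  · intro x
    obtain ⟨y, rfl⟩ := (sigmaSpec fun j => CommRingCat.of (B j)).surjective x
    obtain ⟨j, z, rfl⟩ := (sigmaOpenCover fun j => Spec (.of (B j))).exists_eq y
    refine ⟨j, z, ?_⟩
    exact (congrArg (fun k => k z) (ι_sigmaSpec (fun j => CommRingCat.of (B j)) j)).symm
  · intro j
    have h : IsOpenImmersion (Spec.map (CommRingCat.ofHom (Pi.evalRingHom B j))) := inferInstance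
    exact h

/-- An fpqc sheaf has a section over a finite disjoint union of affine schemes which restricts
to given sections over the pieces. -/
theorem exists_section_pi (hF : Presieve.IsSheaf (bigFpqc S) F)
    (s : ∀ j, F.obj (op (affOver t (B j)))) :
    ∃ s' : F.obj (op (affOver t (Π j, B j))),
      ∀ j, F.map (affMap t (Pi.evalAlgHom A B j)).op s' = s j := by
  have h := hF _ (ofArrows_evalAlgHom_mem (t := t) (B := B))
  rw [Sieve.ofArrows, ← Presieve.isSheafFor_iff_generate, Presieve.isSheafFor_arrows_iff] at h
  refine (h s fun i j Z gi gj e => ?_).exists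
  have e' : gi.left ≫ Spec.map (CommRingCat.ofHom (Pi.evalRingHom B i)) =
      gj.left ≫ Spec.map (CommRingCat.ofHom (Pi.evalRingHom B j)) := congrArg (fun k => k.left) e
  obtain rfl | hij := eq_or_ne i j
  · have hm : Mono (Spec.map (CommRingCat.ofHom (Pi.evalRingHom B i))) := inferInstance
    have : gi = gj := Over.OverMorphism.ext (hm.right_cancellation _ _ e')
    rw [this]
  · have : IsEmpty Z.left := by
      refine isEmpty_of_commSq_sigmaι_of_ne (g := fun j => Spec (.of (B j))) (a := gi.left)
        (b := gj.left) ⟨?_⟩ hij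
      rw [← cancel_mono (sigmaSpec fun j => CommRingCat.of (B j))]
      refine (Category.assoc _ _ _).trans (Eq.trans ?_ (Category.assoc _ _ _).symm)
      rw [ι_sigmaSpec, ι_sigmaSpec]
      exact e'
    have := subsingleton_of_isEmpty hF Z
    exact Subsingleton.elim _ _

/-- The product of a finite family of flat algebras whose spectra cover `Spec A` is faithfully
flat. -/
theorem faithfullyFlat_pi (hfl : ∀ j, Flat (Spec.map (CommRingCat.ofHom (algebraMap A (B j)))))
    (hsurj : ∀ x, ∃ j, x ∈ Set.range (Spec.map (CommRingCat.ofHom (algebraMap A (B j))))) :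
    Module.FaithfullyFlat A (Π j, B j) := by
  have hfac : ∀ j, Spec.map (CommRingCat.ofHom (Pi.evalRingHom B j)) ≫
      Spec.map (CommRingCat.ofHom (algebraMap A (Π j, B j))) =
        Spec.map (CommRingCat.ofHom (algebraMap A (B j))) := fun j => by
    rw [← Spec.map_comp]
    rfl
  refine (RingHom.faithfullyFlat_algebraMap_iff).1
    ((flat_and_surjective_SpecMap_iff (CommRingCat.ofHom _)).1 ⟨?_, ⟨fun x => ?_⟩⟩)
  · have h : Spec.map (CommRingCat.ofHom (algebraMap A (Π j, B j))) =
        inv (sigmaSpec fun j => CommRingCat.of (B j)) ≫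
          Limits.Sigma.desc fun j => Spec.map (CommRingCat.ofHom (algebraMap A (B j))) := by
      rw [IsIso.eq_inv_comp]
      refine Limits.Sigma.hom_ext _ _ fun j => ?_
      rw [← Category.assoc, ι_sigmaSpec, Limits.Sigma.ι_desc]
      exact hfac j
    have h' : Flat (inv (sigmaSpec fun j => CommRingCat.of (B j)) ≫
        Limits.Sigma.desc fun j => Spec.map (CommRingCat.ofHom (algebraMap A (B j)))) :=
      inferInstance
    rw [← h] at h'
    exact h'
  · obtain ⟨j, y, rfl⟩ := hsurj x
    exact ⟨Spec.map (CommRingCat.ofHom (Pi.evalRingHom B j)) y,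
      congrArg (fun k => k y) (hfac j)⟩

end FiniteCovers

section LocalSurjectivity

open AlgebraicGeometry

variable {S : Scheme.{u}} {Γ : Type u} [CommGroup Γ] [Finite Γ]
  {X : Sheaf (bigEtale S) (Type (u + 1))} {P : GObj (constantGroup S Γ) X}

/-- A finite flat affine cover of `Spec A` is replaced by the faithfully flat algebra which is the
product of its members, to which the sections extend. -/
theorem imageSieve_mem_of_finite_cover (hP : ∀ T, Function.Bijective (P.shear T))
    (hPK : Presieve.IsSheaf (bigFpqc S) P.sheaf.obj) (hXK : Presieve.IsSheaf (bigFpqc S) X.obj)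
    {A : Type u} [CommRing A] {t : Spec (.of A) ⟶ S} (x : X.obj.obj (op (Over.mk t)))
    {ι : Type u} [Finite ι] {B : ι → Type u} [∀ j, CommRing (B j)] [∀ j, Algebra A (B j)]
    (hfl : ∀ j, Flat (Spec.map (CommRingCat.ofHom (algebraMap A (B j)))))
    (hsurj : ∀ x, ∃ j, x ∈ Set.range (Spec.map (CommRingCat.ofHom (algebraMap A (B j)))))
    (hs : ∀ j, ∃ s : P.sheaf.obj.obj (op (affOver t (B j))),
      P.proj.hom.app _ s = X.obj.map (affStr t (B j)).op x) :
    Presheaf.imageSieve P.proj.hom x ∈ bigEtale S (Over.mk t) := by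
  classical
  have := Fintype.ofFinite Γ
  have := faithfullyFlat_pi hfl hsurj
  choose s hs using hs
  obtain ⟨s', hs'⟩ := exists_section_pi hPK s
  refine imageSieve_mem_of_faithfullyFlat hP hPK hXK x s' ?_
  refine eq_of_locally_eq hXK (ofArrows_evalAlgHom_mem (t := t) (B := B)) ?_
  rintro U f ⟨V, g, _, ⟨j⟩, rfl⟩
  rw [op_comp, Functor.map_comp_apply, Functor.map_comp_apply]
  refine congrArg (X.obj.map g.op) ?_
  rw [← NatTrans.naturality_apply, hs', hs, map_affMap_affStr]

/-- An fpqc cover of an affine scheme is refined by a finite affine flat cover. -/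
theorem imageSieve_mem_of_affine (hP : ∀ T, Function.Bijective (P.shear T))
    (hPK : Presieve.IsSheaf (bigFpqc S) P.sheaf.obj) (hXK : Presieve.IsSheaf (bigFpqc S) X.obj)
    {A : Type u} [CommRing A] (t : Spec (.of A) ⟶ S) (x : X.obj.obj (op (Over.mk t)))
    (hx : Presheaf.imageSieve P.proj.hom x ∈ bigFpqc S (Over.mk t)) :
    Presheaf.imageSieve P.proj.hom x ∈ bigEtale S (Over.mk t) := by
  rw [GrothendieckTopology.mem_over_iff,
    Precoverage.mem_toGrothendieck_iff_of_isStableUnderComposition] at hx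
  obtain ⟨R, hR, hRx⟩ := hx
  obtain ⟨𝒰, _, rfl⟩ := Scheme.mem_propQCPrecoverage_iff_exists_quasiCompactCover.1 hR
  have : MorphismProperty.RespectsLeft @Flat.{u} @IsOpenImmersion :=
    MorphismProperty.Respects.toRespectsLeft
  obtain ⟨𝒱, f, hfin, -⟩ := QuasiCompactCover.exists_hom.{_, u} (P := @Flat)
    (S := Spec (.of A)) 𝒰
  obtain ⟨n, ⟨e⟩⟩ := Finite.exists_equiv_fin 𝒱.I₀
  choose φ hφ using fun j => Spec.map_surjective (𝒱.f j)
  let _ (j : ULift.{u} (Fin n)) : Algebra A (𝒱.X (e.symm j.down)) :=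
    (φ (e.symm j.down)).hom.toAlgebra
  have hB (j : ULift.{u} (Fin n)) : Spec.map (CommRingCat.ofHom
      (algebraMap A (𝒱.X (e.symm j.down)))) = 𝒱.f (e.symm j.down) := hφ _
  refine imageSieve_mem_of_finite_cover hP hPK hXK x (fun j => ?_) (fun y => ?_) (fun j => ?_)
    (B := fun j : ULift.{u} (Fin n) => 𝒱.X (e.symm j.down))
  · rw [hB]
    exact 𝒱.map_prop _
  · refine ⟨⟨e (𝒱.idx y)⟩, ?_⟩
    rw [hB, e.symm_apply_apply]
    exact 𝒱.covers y
  · refine (Sieve.overEquiv_iff (Y := Over.mk t) (Presheaf.imageSieve P.proj.hom x)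
      (Spec.map (CommRingCat.ofHom (algebraMap A (𝒱.X (e.symm j.down)))))).1 ?_
    have h : _ = 𝒱.f (e.symm j.down) := f.w₀ (e.symm j.down)
    rw [hB, ← h]
    exact Sieve.downward_closed _ (hRx _ _ (Presieve.ofArrows.mk _)) _

/-- An fpqc torsor under a finite constant group has sections locally for the étale topology, hence
is an étale torsor. -/
theorem isLocallySurjective_bigEtale (hP : ∀ T, Function.Bijective (P.shear T))
    (hPK : Presieve.IsSheaf (bigFpqc S) P.sheaf.obj) (hXK : Presieve.IsSheaf (bigFpqc S) X.obj)
    (hsurj : Presheaf.IsLocallySurjective (bigFpqc S) P.proj.hom) :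
    Presheaf.IsLocallySurjective (bigEtale S) P.proj.hom where
  imageSieve_mem {T} x := by
    let 𝒰 := T.left.affineCover
    have hcov : Sieve.ofArrows _ (fun j => (Over.homMk (𝒰.f j) : Over.mk (𝒰.f j ≫ T.hom) ⟶ T)) ∈
        bigEtale S T := by
      rw [GrothendieckTopology.mem_over_iff, Sieve.overEquiv_ofArrows]
      exact Scheme.zariskiTopology_le_etaleTopology _
        (Precoverage.generate_mem_toGrothendieck 𝒰.mem₀)
    refine (bigEtale S).transitive hcov _ ?_
    rintro U f ⟨V, g, _, ⟨j⟩, rfl⟩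
    rw [Sieve.pullback_comp]
    refine (bigEtale S).pullback_stable _ ?_
    rw [Presheaf.pullback_imageSieve]
    exact imageSieve_mem_of_affine hP hPK hXK (A := T.left.affineOpenCover.X j) _ _
      (Presheaf.imageSieve_mem _ _ _)

end LocalSurjectivity

/-! ### Group schemes and their subsemigroup schemes -/

section GroupSchemes

open AlgebraicGeometry MonoidalCategory CartesianMonoidalCategory
open scoped MonObj

variable {S : Scheme.{u}}

theorem isSheaf_bigFpqc_uliftYoneda (X : Over S) : Presieve.IsSheaf (bigFpqc S)
    ((GrothendieckTopology.uliftYoneda.{u + 1} (bigEtale S)).obj X).obj :=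
  (isSheaf_iff_isSheaf_of_type _ _).1
    ((GrothendieckTopology.uliftYoneda.{u + 1} (bigFpqc S)).obj X).property

theorem isSheaf_bigFpqc_constantGroup (Γ : Type u) [CommGroup Γ] : Presieve.IsSheaf (bigFpqc S)
    ((constantGroup S Γ).obj ⋙ forget CommGrpCat) := by
  let τ : TopologicalSpace (ULift.{u + 1} Γ) := ⊥
  have : DiscreteTopology (ULift.{u + 1} Γ) := ⟨rfl⟩
  have h := ((Scheme.fpqcTopology.overPullback (Type (u + 1)) S).obj
    ⟨_, isSheaf_fpqcTopology_continuousMapPresheaf.{u + 1, u} (ULift.{u + 1} Γ)⟩).property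
  rw [← isSheaf_iff_isSheaf_of_type]
  refine (Presheaf.isSheaf_of_iso_iff ?_).1 h
  refine NatIso.ofComponents (fun T => Equiv.toIso
    { toFun := fun (g : C(T.unop.left, ULift.{u + 1} Γ)) =>
        (⟨g, IsLocallyConstant.iff_continuous _ |>.2 g.continuous⟩ :
          LocallyConstant T.unop.left (ULift.{u + 1} Γ))
      invFun := fun (g : LocallyConstant T.unop.left (ULift.{u + 1} Γ)) =>
        (g : C(T.unop.left, ULift.{u + 1} Γ))
      left_inv := fun _ => rfl
      right_inv := fun _ => rfl }) ?_
  intro T T' f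
  rfl

variable {Q : Over S} [GrpObj Q]

theorem isGroup_toSheaf [IsCommMonObj Q] : (ofCommGroupScheme Q).toSheaf.IsGroup where
  nonempty T := ⟨⟨toUnit T.unop ≫ η[Q]⟩⟩
  exists_mul_eq {T} x y := by
    let x' : T.unop ⟶ Q := x.down
    let y' : T.unop ⟶ Q := y.down
    refine ⟨⟨y' * x'⁻¹⟩, congrArg ULift.up ?_⟩
    exact (Hom.mul_def (y' * x'⁻¹) x').symm.trans (inv_mul_cancel_right y' x')

theorem SubSemigroupScheme.lift_comp_divHom (M : SubSemigroupScheme Q) {T : Over S}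
    (w : T ⟶ M.X ⊗ M.X) :
    lift (w ≫ M.divHom) ((w ≫ snd _ _) ≫ M.incl) ≫ μ[Q] = (w ≫ fst _ _) ≫ M.incl := by
  have h : w ≫ M.divHom = ((w ≫ fst _ _) ≫ M.incl) * ((w ≫ snd _ _) ≫ M.incl)⁻¹ := by
    rw [Hom.mul_def, Hom.inv_def, divHom, ← Category.assoc, comp_lift]
    simp only [Category.assoc]
  rw [h]
  exact (Hom.mul_def _ _).symm.trans (inv_mul_cancel_right _ _)

/-- If `(x, y) ↦ x y⁻¹` is faithfully flat and quasi-compact, then every section of `Q` is locally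
for the fpqc topology a quotient of two sections of `M`. -/
theorem SubSemigroupScheme.locallyGenerates [IsCommMonObj Q] (M : SubSemigroupScheme Q)
    [Flat M.divHom.left] [Surjective M.divHom.left] [QuasiCompact M.divHom.left] :
    MultTorsor.LocallyGenerates (bigFpqc S) M.inclusion := by
  intro T z
  let z' : T ⟶ Q := z.down
  let W : Over S := Over.mk (Limits.pullback.snd M.divHom.left z'.left ≫ T.hom)
  let π : W ⟶ T := Over.homMk (Limits.pullback.snd M.divHom.left z'.left) rfl
  let q : W ⟶ M.X ⊗ M.X := Over.homMk (Limits.pullback.fst M.divHom.left z'.left) (by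
    refine (congrArg (_ ≫ ·) (Over.w M.divHom)).symm.trans ?_
    refine (Limits.pullback.condition_assoc _).trans ?_
    exact congrArg (_ ≫ ·) (Over.w z'))
  have hq : q ≫ M.divHom = π ≫ z' := Over.OverMorphism.ext Limits.pullback.condition
  have h₁ : Flat π.left := inferInstanceAs (Flat (Limits.pullback.snd M.divHom.left z'.left))
  have h₂ : Surjective π.left :=
    inferInstanceAs (Surjective (Limits.pullback.snd M.divHom.left z'.left))
  have h₃ : QuasiCompact π.left :=
    inferInstanceAs (QuasiCompact (Limits.pullback.snd M.divHom.left z'.left))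
  refine ⟨_, generate_singleton_mem_bigFpqc π, ?_⟩
  rintro U _ ⟨_, j, _, ⟨⟩, rfl⟩
  refine ⟨⟨(j ≫ q) ≫ fst _ _⟩, ⟨(j ≫ q) ≫ snd _ _⟩, congrArg ULift.up ?_⟩
  refine Eq.trans ?_ (M.lift_comp_divHom (j ≫ q))
  rw [Category.assoc j q M.divHom, hq, ← Category.assoc]
  rfl

theorem SubSemigroupScheme.inclusion_injective [IsCommMonObj Q] (M : SubSemigroupScheme Q)
    (T : (Over S)ᵒᵖ) : Function.Injective (M.inclusion.hom.hom.app T) := by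
  intro x y h
  have := M.mono_incl
  refine ULift.ext _ _ ((cancel_mono M.incl).1 ?_)
  exact congrArg ULift.down h

end GroupSchemes

end MultTors

theorem proposition2p9 {S : AlgebraicGeometry.Scheme.{u}} (G : Type u) [CommGroup G] [Finite G]
    (Q : Over S) [GrpObj Q] [IsCommMonObj Q] (M : MultTors.SubSemigroupScheme Q)
    (hM : AlgebraicGeometry.Flat M.X.hom)
    (hflat : AlgebraicGeometry.Flat M.divHom.left)
    (hsurj : AlgebraicGeometry.Surjective M.divHom.left)
    (hqc : AlgebraicGeometry.QuasiCompact M.divHom.left) :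
    (MultTors.MultTorsor.pullbackFunctor (MultTors.constantGroup S G) M.inclusion).IsEquivalence :=
  MultTors.MultTorsor.pullbackFunctor_isEquivalence M.inclusion MultTors.isGroup_toSheaf
    (MultTors.isSheaf_bigFpqc_uliftYoneda Q) (MultTors.isSheaf_bigFpqc_constantGroup G)
    (MultTors.bigEtale_le_bigFpqc S) M.locallyGenerates M.inclusion_injective
    fun _ hPK hP hbij => MultTors.isLocallySurjective_bigEtale hbij hPK
      (MultTors.isSheaf_bigFpqc_uliftYoneda Q) hP
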